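/- **Setting.** Let $r,a>0$ and let $s(x)$ be one of: $x$ (case I, $\rho=0$); $\frac1r\sin(rx)$ (case II, $\rho=1$); $\frac a\pi\sinh(\pi x/a)$ (case III, $\rho=1$); $\frac1r e^{ra/4}\vartheta_1(rx\,|\,ira/\pi)$ (case IV, $\rho=3$), with $\vartheta_1$ the odd Jacobi theta function. Put $\omega_0=0$; $\omega_1=\pi/r$ (II, IV), $\omega_1=ia$ (III); $\omega_2=ia$, $\omega_3=-\omega_1-\omega_2$ (IV); $(\xi_0,\xi_1,\xi_2,\xi_3)=(0,0,-1,1)$; $|\omega|=\sum_{\nu=0}^\rho\omega_\nu$. Let $G(x;\alpha)$ ($\operatorname{Re}\alpha\ne0$) be any Gamma function for $s$, i.e. for each $\alpha$ it is meromorphic in $x$ and $G(x+i\alpha/2;\alpha)/G(x-i\alpha/2;\alpha)=c\,s(x)$ for some constant $c=c(\alpha)\neq0$. Let $\beta>0$, $\lambda\in\mathbb C$ with $\operatorname{Re}\lambda\neq0$, $g=(g_0,\dots,g_{2\rho+1})\in\mathbb C^{2\rho+2}$, $|g|=\sum_\nu g_\nu$, and assume that $s(ni\beta)\ne0$ and $s(ni\lambda\beta)\neq0$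 for all integers $n\ne0$, and that $s(\frac12(\omega_\nu-\omega_\mu+i(1-\lambda)\beta))\ne0$ for $0\le\nu,\mu\le\rho$. Let $N,\tilde N,M,\tilde M\ge0$ be integers. **Operators.** For $x\in\mathbb C^N$, $\tilde x\in\mathbb C^{\tilde N}$ let $$H_{N,\tilde N}(x,\tilde x;g)=\sum_{\varepsilon=\pm}\Big[s(i\lambda\beta)\sum_{j=1}^N (V_j^{\varepsilon})^{1/2}e^{-\varepsilon i\beta\partial_{x_j}}(V_j^{-\varepsilon})^{1/2}-s(i\beta)\sum_{k=1}^{\tilde N}(\tilde V_k^{\varepsilon})^{1/2}e^{+\varepsilon i\lambda\beta\partial_{\tilde x_k}}(\tilde V_k^{-\varepsilon})^{1/2}\Big]+V^0,$$ where $$V_j^{\pm}=\frac{\prod_{\nu=0}^{2\rho+1}s(\pm x_j-ig_\nu\beta)}{s(\pm2x_j)s(\pm2x_j-i\beta)}\prod_{\delta=\pm}\prod_{j'\ne j}\frac{s(x_j+\delta x_{j'}\mp i\lambda\beta)}{s(x_j+\delta x_{j'})}\prod_{k}\frac{s(x_j+\delta\tilde x_k\mp\frac i2(\lambda-1)\beta)}{s(x_j+\delta\tilde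 x_k\mp\frac i2(\lambda+1)\beta)},$$ $$\tilde V_k^{\pm}=\frac{\prod_{\nu=0}^{2\rho+1}s(\pm\tilde x_k-i(g_\nu-\frac{\lambda+1}2)\beta)}{s(\pm2\tilde x_k)s(\pm2\tilde x_k+i\lambda\beta)}\prod_{\delta=\pm}\prod_{k'\ne k}\frac{s(\tilde x_k+\delta\tilde x_{k'}\pm i\beta)}{s(\tilde x_k+\delta\tilde x_{k'})}\prod_{j}\frac{s(\tilde x_k+\delta x_j\mp\frac i2(\lambda-1)\beta)}{s(\tilde x_k+\delta x_j\pm\frac i2(\lambda+1)\beta)},$$ $$V^0=-\frac{\prod_{\nu=1}^\rho s(\frac{\omega_\nu}2)^2}{4}\sum_{\nu=0}^\rho\frac{e^{-r\xi_\nu(2\lambda N-2\tilde N+|g|-\frac12(\rho+1)(\lambda+1))\beta}}{\prod_{\mu\ne\nu}s(\frac12(\omega_\nu-\omega_\mu))}\,\frac{\prod_{\mu=0}^{2\rho+1}s(\frac{\omega_\nu}2+\frac{i\beta}2-ig_\mu\beta)}{\prod_{\mu=0}^{\rho}s(\frac12(\omega_\nu-\omega_\mu+i(1-\lambda)\beta))}$$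 $$\qquad\cdot\prod_{\delta=\pm}\prod_{j}\frac{s(\delta x_j+\frac{\omega_\nu}2+\frac{i\beta}2-i\lambda\beta)}{s(\delta x_j+\frac{\omega_\nu}2+\frac{i\beta}2)}\prod_{k}\frac{s(\delta\tilde x_k+\frac{\omega_\nu}2-\frac{i\lambda\beta}2+i\beta)}{s(\delta\tilde x_k+\frac{\omega_\nu}2-\frac{i\lambda\beta}2)}.$$ **Kernel function.** Let $$\Psi_N(x;g,\lambda,\beta)=\prod_j\Big(\frac{G(2x_j+\frac{i\beta}2;\beta)G(-2x_j+\frac{i\beta}2;\beta)}{\prod_{\nu}G(x_j+\frac{i\beta}2-ig_\nu\beta;\beta)G(-x_j+\frac{i\beta}2-ig_\nu\beta;\beta)}\Big)^{1/2}\prod_{j<k}\prod_{\varepsilon,\varepsilon'=\pm}\Big(\frac{G(\varepsilon x_j+\varepsilon'x_k+\frac{i\beta}2;\beta)}{G(\varepsilon x_j+\varepsilon'x_k-i\lambda\beta+\frac{i\beta}2;\beta)}\Big)^{1/2},$$ $$\Psi_{N,\tilde N}(x,\tilde x;g)=\frac{\Psi_N(x;g,\lambda,\beta)\,\Psi_{\tilde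 N}(\tilde x;g',1/\lambda,\lambda\beta)}{\prod_{j,k}\prod_{\delta=\pm}\big(s(x_j+\delta\tilde x_k+\frac i2(\lambda-1)\beta)\,s(x_j+\delta\tilde x_k-\frac i2(\lambda-1)\beta)\big)^{1/2}},\qquad g'_\nu=\frac{\lambda+1-2g_\nu}{2\lambda},$$ and, with $\tilde g_\nu=\frac12(\lambda+1)-g_\nu$, $$F(x,\tilde x,y,\tilde y)=\Psi_{N,\tilde N}(x,\tilde x;g)\,\Psi_{M,\tilde M}(y,\tilde y;\tilde g)\prod_{j=1}^N\prod_{k=1}^M\prod_{\varepsilon,\varepsilon'=\pm}G(\varepsilon x_j+\varepsilon'y_k-\tfrac{i\lambda\beta}2;\beta)$$ $$\qquad\cdot\prod_{j=1}^N\prod_{k=1}^{\tilde M}\prod_{\delta=\pm}s(x_j+\delta\tilde y_k)\prod_{j=1}^{\tilde N}\prod_{k=1}^{M}\prod_{\delta=\pm}s(\tilde x_j+\delta y_k)\prod_{j=1}^{\tilde N}\prod_{k=1}^{\tilde M}\prod_{\varepsilon,\varepsilon'=\pm}G(\varepsilon\tilde x_j+\varepsilon'\tilde y_k-\tfrac{i\beta}2;\lambda\beta).$$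 **Square roots.** The square roots are understood as follows. Let $D\subset\mathbb C^{N}\times\mathbb C^{\tilde N}$ and $E\subset\mathbb C^{M}\times\mathbb C^{\tilde M}$ be any sets that are invariant under all the argument shifts of $H_{N,\tilde N}$, resp. $H_{M,\tilde M}$, and at whose points no factor ($G$ or $s$) of $\Psi_{N,\tilde N}(\cdot\,;g)$, resp. $\Psi_{M,\tilde M}(\cdot\,;\tilde g)$, is zero or infinite and no variable-dependent denominator of the coefficients of $H_{N,\tilde N}(\cdot\,;g)$, resp. $H_{M,\tilde M}(\cdot\,;\tilde g)$, vanishes. Let $\Psi_{N,\tilde N}$ and $\Psi_{M,\tilde M}$ denote any functions on $D$, resp. $E$, whose squares are the squares of the above expressions, and let $(V_j^+)^{1/2}$, $(\tilde V_k^+)^{1/2}$ be any functions on $D$, resp. $E$, with squares $V^+_j,\tilde V^+_k$. **Claim.** There are functions $(V_j^-)^{1/2}$, $(\tilde V_k^-)^{1/2}$ on $D$ and on $E$ with squares $V_j^-,\tilde V_k^-$, each complex differentiable on $D$ (resp. $E$) whenever the chosen ground state and the corresponding $(V_j^+)^{1/2}$ or $(\tilde V_k^+)^{1/2}$ are, such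 that $$\big(H_{N,\tilde N}(x,\tilde x;g)-H_{M,\tilde M}(y,\tilde y;\tilde g)-C\big)F(x,\tilde x,y,\tilde y)=0,$$ $$C=\frac{\prod_{\nu=1}^{\rho}s(\frac12\omega_\nu)^2}{4}\,s\Big(i\beta\big[2\lambda(N-M)-2(\tilde N-\tilde M)+|g|-\tfrac12(\rho+1)(\lambda+1)\big]-|\omega|\Big),$$ for all $(x,\tilde x)\in D$, $(y,\tilde y)\in E$ such that no $G$- or $s$-cross factor of $F$ is zero or infinite at $(x,\tilde x,y,\tilde y)$ and at the points reached from it by a single shift. This holds for arbitrary $g$ in cases I, II, III, and in case IV whenever $$2\lambda(N-M-1)-2(\tilde N-\tilde M+1)+\sum_{\nu=0}^7g_\nu=0 .$$ -/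

import Mathlib

namespace KvD

open Complex Finset

noncomputable section

/-- The four cases (I)-(IV). -/
inductive Kind
  | rational
  | trigonometric
  | hyperbolic
  | elliptic

/-- A case together with the parameters `r, a > 0` of the function `s`. -/
structure Setting where
  kind : Kind
  r : ℝ
  a : ℝ
  r_pos : 0 < r
  a_pos : 0 < a

/-- The odd Jacobi theta function of Whittaker and Watson,
`θ₁(z|τ) = 2 ∑_{n ≥ 0} (-1)^n q^{(n+1/2)²} sin((2n+1)z)` with `q = exp(iπτ)`,
written as `-i exp(iπτ/4 + iz) ∑_{n ∈ ℤ} exp(2πi n (z/π + 1/2 + τ/2) + πi n² τ)`. -/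
def theta1 (z τ : ℂ) : ℂ :=
  -I * exp (I * Real.pi * τ / 4 + I * z) * jacobiTheta₂ (z / Real.pi + 1 / 2 + τ / 2) τ

namespace Setting

/-- The function `s(x)`. -/
def s (S : Setting) (x : ℂ) : ℂ :=
  match S.kind with
  | .rational => x
  | .trigonometric => 1 / (S.r : ℂ) * sin (S.r * x)
  | .hyperbolic => (S.a : ℂ) / Real.pi * sinh (Real.pi * x / S.a)
  | .elliptic => 1 / (S.r : ℂ) * exp (S.r * S.a / 4) *
      theta1 (S.r * x) (I * S.r * S.a / Real.pi)

/-- The number `ρ`. -/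
def rho (S : Setting) : ℕ :=
  match S.kind with
  | .rational => 0
  | .trigonometric => 1
  | .hyperbolic => 1
  | .elliptic => 3

/-- The period `ω₁` (not used in the rational case). -/
def omega1 (S : Setting) : ℂ :=
  match S.kind with
  | .rational => 0
  | .trigonometric => Real.pi / S.r
  | .hyperbolic => I * S.a
  | .elliptic => Real.pi / S.r

/-- The periods `ω_ν`; only the indices `0 ≤ ν ≤ ρ` are used. -/
def omega (S : Setting) : ℕ → ℂ
  | 0 => 0
  | 1 => S.omega1
  | 2 => I * S.a
  | _ => -S.omega1 - I * S.a

/-- `|ω| = ω₀ + ⋯ + ω_ρ`. -/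
def omegaSum (S : Setting) : ℂ := ∑ ν ∈ range (S.rho + 1), S.omega ν

/-- `(1/4) ∏_{ν=1}^{ρ} s(ω_ν/2)²`. -/
def prefactor (S : Setting) : ℂ := (∏ ν ∈ Icc 1 S.rho, S.s (S.omega ν / 2) ^ 2) / 4

end Setting

/-- The numbers `(ξ₀, ξ₁, ξ₂, ξ₃) = (0, 0, -1, 1)`. -/
def xi : ℕ → ℂ
  | 2 => -1
  | 3 => 1
  | _ => 0

/-- `G(x; α)` is a Gamma function: for every `α` with `Re α ≠ 0` it is a meromorphic function of
`x` and `G(x + iα/2; α) / G(x - iα/2; α) = c s(x)`, as meromorphic functions of `x`, with a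
constant `c ≠ 0` (which may depend on `α`). -/
def IsGammaFunction (S : Setting) (G : ℂ → ℂ → ℂ) : Prop :=
  ∀ α : ℂ, α.re ≠ 0 →
    MeromorphicOn (fun x => G x α) Set.univ ∧
    ∃ c : ℂ, c ≠ 0 ∧ ∀ᶠ x in Filter.codiscrete ℂ,
      G (x + I * α / 2) α / G (x - I * α / 2) α = c * S.s x

/-- `G(·; α)` has neither a pole nor a zero at `x`. -/
def GRegular (G : ℂ → ℂ → ℂ) (x α : ℂ) : Prop :=
  AnalyticAt ℂ (fun z => G z α) x ∧ G x α ≠ 0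

/-- The sign `ε = ±` as a complex number. -/
abbrev sg (ε : ℤˣ) : ℂ := ((ε : ℤ) : ℂ)

/-- The variables `(x, x̃)`, `x ∈ ℂ^N`, `x̃ ∈ ℂ^Ñ`. -/
abbrev Config (N Nt : ℕ) : Type := (Fin N → ℂ) × (Fin Nt → ℂ)

/-- The argument shifts of the difference operators: `exp(-ε iβ ∂/∂x_j)` evaluates a function at
`x_j - ε iβ`, and `exp(+ε iλβ ∂/∂x̃_k)` evaluates it at `x̃_k + ε iλβ`. -/
def shift {N Nt : ℕ} (lam β : ℂ) (ε : ℤˣ) : Fin N ⊕ Fin Nt → Config N Nt → Config N Nt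
  | .inl j, p => (Function.update p.1 j (p.1 j - sg ε * I * β), p.2)
  | .inr k, p => (p.1, Function.update p.2 k (p.2 k + sg ε * I * lam * β))

section Operator

variable (S : Setting) {N Nt : ℕ} (g : Fin (2 * S.rho + 2) → ℂ) (lam β : ℂ)

/-- The coefficients `V_j^ε(x, x̃)` (index `inl j`) and `Ṽ_k^ε(x, x̃)` (index `inr k`). -/
def coeff (ε : ℤˣ) : Fin N ⊕ Fin Nt → Config N Nt → ℂ
  | .inl j, (x, xt) =>
      (∏ ν, S.s (sg ε * x j - I * g ν * β)) /
          (S.s (sg ε * (2 * x j)) * S.s (sg ε * (2 * x j) - I * β)) *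
        ∏ δ : ℤˣ,
          ((∏ j' ∈ univ.erase j,
              S.s (x j + sg δ * x j' - sg ε * I * lam * β) / S.s (x j + sg δ * x j')) *
            ∏ k, S.s (x j + sg δ * xt k - sg ε * I * (lam - 1) * β / 2) /
              S.s (x j + sg δ * xt k - sg ε * I * (lam + 1) * β / 2))
  | .inr k, (x, xt) =>
      (∏ ν, S.s (sg ε * xt k - I * (g ν - (lam + 1) / 2) * β)) /
          (S.s (sg ε * (2 * xt k)) * S.s (sg ε * (2 * xt k) + I * lam * β)) *
        ∏ δ : ℤˣ,
          ((∏ k' ∈ univ.erase k,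
              S.s (xt k + sg δ * xt k' + sg ε * I * β) / S.s (xt k + sg δ * xt k')) *
            ∏ j, S.s (xt k + sg δ * x j - sg ε * I * (lam - 1) * β / 2) /
              S.s (xt k + sg δ * x j + sg ε * I * (lam + 1) * β / 2))

/-- The coefficient `V⁰(x, x̃)`. -/
def potential (p : Config N Nt) : ℂ :=
  -S.prefactor * ∑ ν ∈ range (S.rho + 1),
    exp (-S.r * xi ν *
        (2 * lam * N - 2 * Nt + (∑ μ, g μ) - (S.rho + 1) * (lam + 1) / 2) * β) /
      (∏ μ ∈ (range (S.rho + 1)).erase ν, S.s ((S.omega ν - S.omega μ) / 2)) *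
    ((∏ μ, S.s (S.omega ν / 2 + I * β / 2 - I * g μ * β)) /
      (∏ μ ∈ range (S.rho + 1), S.s ((S.omega ν - S.omega μ + I * (1 - lam) * β) / 2))) *
    ∏ δ : ℤˣ,
      ((∏ j, S.s (sg δ * p.1 j + S.omega ν / 2 + I * β / 2 - I * lam * β) /
          S.s (sg δ * p.1 j + S.omega ν / 2 + I * β / 2)) *
        ∏ k, S.s (sg δ * p.2 k + S.omega ν / 2 - I * lam * β / 2 + I * β) /
          S.s (sg δ * p.2 k + S.omega ν / 2 - I * lam * β / 2))

/-- `w` is a determination on `D` of the square roots `(V_j^ε)^{1/2}`, `(Ṽ_k^ε)^{1/2}`. -/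
def IsCoeffRoot (D : Set (Config N Nt)) (w : ℤˣ → Fin N ⊕ Fin Nt → Config N Nt → ℂ) : Prop :=
  ∀ ε J, ∀ p ∈ D, w ε J p ^ 2 = coeff S g lam β ε J p

/-- The deformed operator
`H_{N,Ñ} = ∑_ε [ s(iλβ) ∑_j (V_j^ε)^{1/2} exp(-ε iβ ∂/∂x_j) (V_j^{-ε})^{1/2}
  - s(iβ) ∑_k (Ṽ_k^ε)^{1/2} exp(+ε iλβ ∂/∂x̃_k) (Ṽ_k^{-ε})^{1/2} ] + V⁰`,
formed with the determination `w` of the square roots, applied to `f` at the point `p`. -/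
def deformedOperator (w : ℤˣ → Fin N ⊕ Fin Nt → Config N Nt → ℂ) (f : Config N Nt → ℂ)
    (p : Config N Nt) : ℂ :=
  (∑ ε : ℤˣ,
    (S.s (I * lam * β) * ∑ j : Fin N,
        w ε (.inl j) p *
          (w (-ε) (.inl j) (shift lam β ε (.inl j) p) * f (shift lam β ε (.inl j) p)) -
      S.s (I * β) * ∑ k : Fin Nt,
        w ε (.inr k) p *
          (w (-ε) (.inr k) (shift lam β ε (.inr k) p) * f (shift lam β ε (.inr k) p)))) +
    potential S g lam β p * f p

end Operator

section GroundState

variable (S : Setting) (G : ℂ → ℂ → ℂ)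

/-- The square `Ψ_N(x; g, λ, β)²` of the undeformed ground state. -/
def groundSq {N : ℕ} (g : Fin (2 * S.rho + 2) → ℂ) (lam β : ℂ) (x : Fin N → ℂ) : ℂ :=
  (∏ j, G (2 * x j + I * β / 2) β * G (-2 * x j + I * β / 2) β /
      ∏ ν, G (x j + I * β / 2 - I * g ν * β) β * G (-x j + I * β / 2 - I * g ν * β) β) *
    ∏ j : Fin N, ∏ k ∈ univ.filter (fun k => j < k), ∏ ε : ℤˣ, ∏ ε' : ℤˣ,
      G (sg ε * x j + sg ε' * x k + I * β / 2) β /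
        G (sg ε * x j + sg ε' * x k - I * lam * β + I * β / 2) β

/-- The arguments of all factors `G` of `Ψ_N(x; g, λ, β)` are neither poles nor zeros of `G`. -/
structure GroundRegular {N : ℕ} (g : Fin (2 * S.rho + 2) → ℂ) (lam β : ℂ) (x : Fin N → ℂ) :
    Prop where
  double : ∀ (ε : ℤˣ) j, GRegular G (sg ε * (2 * x j) + I * β / 2) β
  single : ∀ (ε : ℤˣ) j ν, GRegular G (sg ε * x j + I * β / 2 - I * g ν * β) β
  pair_num : ∀ (ε ε' : ℤˣ) j k, j < k →
    GRegular G (sg ε * x j + sg ε' * x k + I * β / 2) β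
  pair_den : ∀ (ε ε' : ℤˣ) j k, j < k →
    GRegular G (sg ε * x j + sg ε' * x k - I * lam * β + I * β / 2) β

variable {N Nt : ℕ} (g : Fin (2 * S.rho + 2) → ℂ) (lam β : ℂ)

/-- The parameters `g'_ν = (λ + 1 - 2 g_ν) / 2λ`. -/
def gPrime (ν : Fin (2 * S.rho + 2)) : ℂ := (lam + 1 - 2 * g ν) / (2 * lam)

/-- The square `Ψ_{N,Ñ}(x, x̃; g, λ, β)²` of the deformed ground state. -/
def deformedGroundSq (p : Config N Nt) : ℂ :=
  groundSq S G g lam β p.1 * groundSq S G (gPrime S g lam) (1 / lam) (lam * β) p.2 /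
    ∏ j, ∏ δ : ℤˣ, ∏ k,
      S.s (p.1 j + sg δ * p.2 k + I * (lam - 1) * β / 2) *
        S.s (p.1 j + sg δ * p.2 k - I * (lam - 1) * β / 2)

/-- `(x, x̃)` is in general position: no factor of `Ψ_{N,Ñ}` is zero or infinite there, and no
denominator of the coefficients `V_j^±`, `Ṽ_k^±`, `V⁰` vanishes. -/
structure IsRegular (p : Config N Nt) : Prop where
  ground : GroundRegular S G g lam β p.1
  ground' : GroundRegular S G (gPrime S g lam) (1 / lam) (lam * β) p.2
  mixed : ∀ (ε δ : ℤˣ) j k, S.s (p.1 j + sg δ * p.2 k + sg ε * I * (lam - 1) * β / 2) ≠ 0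
  coeff_mixed : ∀ (ε δ : ℤˣ) j k,
    S.s (p.1 j + sg δ * p.2 k + sg ε * I * (lam + 1) * β / 2) ≠ 0
  coeff_mixed' : ∀ (ε δ : ℤˣ) j k,
    S.s (p.2 k + sg δ * p.1 j + sg ε * I * (lam + 1) * β / 2) ≠ 0
  coeff_double : ∀ (ε : ℤˣ) j,
    S.s (sg ε * (2 * p.1 j)) ≠ 0 ∧ S.s (sg ε * (2 * p.1 j) - I * β) ≠ 0
  coeff_double' : ∀ (ε : ℤˣ) k,
    S.s (sg ε * (2 * p.2 k)) ≠ 0 ∧ S.s (sg ε * (2 * p.2 k) + I * lam * β) ≠ 0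
  coeff_pair : ∀ (δ : ℤˣ) j j', j ≠ j' → S.s (p.1 j + sg δ * p.1 j') ≠ 0
  coeff_pair' : ∀ (δ : ℤˣ) k k', k ≠ k' → S.s (p.2 k + sg δ * p.2 k') ≠ 0
  potential : ∀ (δ : ℤˣ) j, ∀ ν ≤ S.rho,
    S.s (sg δ * p.1 j + S.omega ν / 2 + I * β / 2) ≠ 0
  potential' : ∀ (δ : ℤˣ) k, ∀ ν ≤ S.rho,
    S.s (sg δ * p.2 k + S.omega ν / 2 - I * lam * β / 2) ≠ 0

/-- A set of points in general position that is invariant under all shifts in the operator. -/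
def IsAdmissible (D : Set (Config N Nt)) : Prop :=
  ∀ p ∈ D, IsRegular S G g lam β p ∧ ∀ ε J, shift lam β ε J p ∈ D

/-- `Ψ` is a determination on `D` of the deformed ground state `Ψ_{N,Ñ}(x, x̃; g, λ, β)`. -/
def IsDeformedGroundState (D : Set (Config N Nt)) (Ψ : Config N Nt → ℂ) : Prop :=
  ∀ p ∈ D, Ψ p ^ 2 = deformedGroundSq S G g lam β p

end GroundState

section Kernel

variable (S : Setting) (G : ℂ → ℂ → ℂ) {N Nt M Mt : ℕ} (lam β : ℂ)

/-- The `G`- and `s`-cross factors of the kernel function. -/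
def crossFactor (p : Config N Nt) (q : Config M Mt) : ℂ :=
  (∏ j, ∏ k, ∏ ε : ℤˣ, ∏ ε' : ℤˣ, G (sg ε * p.1 j + sg ε' * q.1 k - I * lam * β / 2) β) *
  (∏ j, ∏ k, ∏ δ : ℤˣ, S.s (p.1 j + sg δ * q.2 k)) *
  (∏ j, ∏ k, ∏ δ : ℤˣ, S.s (p.2 j + sg δ * q.1 k)) *
  ∏ j, ∏ k, ∏ ε : ℤˣ, ∏ ε' : ℤˣ,
    G (sg ε * p.2 j + sg ε' * q.2 k - I * β / 2) (lam * β)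

/-- No factor of `crossFactor` is zero or infinite at `(p, q)`. -/
structure CrossRegular (p : Config N Nt) (q : Config M Mt) : Prop where
  xy : ∀ (ε ε' : ℤˣ) j k, GRegular G (sg ε * p.1 j + sg ε' * q.1 k - I * lam * β / 2) β
  xyt : ∀ (δ : ℤˣ) j k, S.s (p.1 j + sg δ * q.2 k) ≠ 0
  xty : ∀ (δ : ℤˣ) j k, S.s (p.2 j + sg δ * q.1 k) ≠ 0
  xtyt : ∀ (ε ε' : ℤˣ) j k,
    GRegular G (sg ε * p.2 j + sg ε' * q.2 k - I * β / 2) (lam * β)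

/-- `CrossRegular` at `(p, q)` and at all points reached from `(p, q)` by one shift. -/
def CrossRegularNear (p : Config N Nt) (q : Config M Mt) : Prop :=
  CrossRegular S G lam β p q ∧ (∀ ε J, CrossRegular S G lam β (shift lam β ε J p) q) ∧
    ∀ ε J, CrossRegular S G lam β p (shift lam β ε J q)

/-- The kernel function `F_{N,Ñ,M,M̃}`, formed with the determinations `Ψ` of `Ψ_{N,Ñ}(x, x̃; g)`
and `Θ` of `Ψ_{M,M̃}(y, ỹ; g̃)`. -/
def kernelFunction (Ψ : Config N Nt → ℂ) (Θ : Config M Mt → ℂ) (p : Config N Nt)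
    (q : Config M Mt) : ℂ :=
  Ψ p * Θ q * crossFactor S G lam β p q

/-- The parameters `g̃_ν = (λ + 1)/2 - g_ν`. -/
def gTilde (g : Fin (2 * S.rho + 2) → ℂ) (ν : Fin (2 * S.rho + 2)) : ℂ := (lam + 1) / 2 - g ν

/-- The constant `C_{N,Ñ,M,M̃}`. -/
def kernelConst (g : Fin (2 * S.rho + 2) → ℂ) (N Nt M Mt : ℕ) : ℂ :=
  S.prefactor * S.s (I * β * (2 * lam * ((N : ℂ) - M) - 2 * ((Nt : ℂ) - Mt) + (∑ ν, g ν) -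
    (S.rho + 1) * (lam + 1) / 2) - S.omegaSum)

end Kernel

end

end KvD

open KvD Complex

namespace KvD

open Complex Finset

noncomputable section

/-! By the difference equation of `G`, moving one variable by one step multiplies the cross factor
of `F` by an explicit quotient of values of `s` (`crossFactor_shift`). The same equation gives a
detailed balance for the ground state (`deformedGroundSq_shift`): `Ψ²` at a point times the
coefficient of the step to a neighbour equals `Ψ²` at the neighbour times the coefficient of the
step back. Hence, once `Ψ` and the roots of `V_J^+` are chosen, the backward translate of
`(V_J^+)^{1/2} Ψ`, divided by `Ψ`, is a square root of `V_J^-`. With this choice all roots disappear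
from `H F / F` (`deformedOperator_rootOf`), and an identity in `s` alone remains
(`functional_identity`).

That identity is a partial fraction expansion. For equally many poles `a_i` and zeros `b_k`,
`sum_prod_s_div` evaluates the sum over `i` of `∏_k s(a_i - b_k) / ∏_{j≠i} s(a_i - a_j)` as `s(∑ a -
∑ b)`; in the elliptic case `∑ a = ∑ b` is required. All four cases are treated together, because
`s(x+y) s(x-y) = A(x) B(y) - B(x) A(y)`, with `B = 1` outside the elliptic case. The resulting
three-term relation drives the induction on the number of poles.

In `source_identity` the poles are `±X_J + c_J`, with `X_J` running through all variables `x, x̃, y,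
ỹ`, together with the two families `(ω_ν + b)/2` and `(ω_ν + b')/2`. The zeros are the `h_ν` and
`±X_J + c_J + d_J`. The duplication formula `s_two_mul` turns the products over half periods into
the double-angle denominators, so that, up to a common factor, the pole `±X_J + c_J` contributes
`s(d_J)` times a coefficient times a cross ratio. At each half-period pole the variables of one side
collapse to an exponential, and the other side supplies a summand of `V⁰`.

The choice `b = iβ`, `b' = iλβ`, `h_ν = i g_ν β` with the values in `offset` and `step` makes `x,
x̃` and the first family produce `H_{N,Ñ}`. The variables `y, ỹ` and the second family produce
`-H_{M,M̃}`, since their steps have the opposite sign and `s` is odd; the right-hand side is `C`.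
The requirement `∑ a = ∑ b` is exactly the elliptic parameter condition. It also matches the
exponentials with those in `V⁰`, which are trivial in the other cases because `ξ_ν = 0` there. -/

/-! ### The theta function -/

/-- The terms of the theta series in the variable `z`, indexed by `k ∈ ℤ`, with nome `exp(iπτ/2)`. -/
def halfTerm (τ : ℂ) (k : ℤ) (z : ℂ) : ℂ := exp (I * Real.pi * τ * k ^ 2 / 2 + 2 * I * k * z)

/-- The terms of the series for `I * theta1 z τ`. -/
def thetaTerm (τ : ℂ) (n : ℤ) (z : ℂ) : ℂ :=
  exp (I * Real.pi * τ * (n + 1 / 2) ^ 2 + I * (2 * n + 1) * z + Real.pi * I * n)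

lemma pi_ne_zero' : (Real.pi : ℂ) ≠ 0 := by exact_mod_cast Real.pi_ne_zero

lemma thetaTerm_eq (τ : ℂ) (n : ℤ) (z : ℂ) :
    thetaTerm τ n z = exp (I * Real.pi * τ / 4 + I * z) *
      jacobiTheta₂_term n (z / Real.pi + 1 / 2 + τ / 2) τ := by
  have := pi_ne_zero'
  rw [thetaTerm, jacobiTheta₂_term, ← exp_add]
  congr 1
  field_simp
  ring

lemma hasSum_thetaTerm {τ : ℂ} (hτ : 0 < τ.im) (z : ℂ) :
    HasSum (fun n => thetaTerm τ n z) (I * theta1 z τ) := by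
  have h := (hasSum_jacobiTheta₂_term (z / Real.pi + 1 / 2 + τ / 2) hτ).mul_left
    (exp (I * Real.pi * τ / 4 + I * z))
  have e : I * theta1 z τ = exp (I * Real.pi * τ / 4 + I * z) *
      jacobiTheta₂ (z / Real.pi + 1 / 2 + τ / 2) τ := by
    rw [theta1]
    linear_combination (-exp (I * Real.pi * τ / 4 + I * z) *
      jacobiTheta₂ (z / Real.pi + 1 / 2 + τ / 2) τ) * I_sq
  rw [e]
  simpa only [thetaTerm_eq] using h

lemma summable_halfTerm {τ : ℂ} (hτ : 0 < τ.im) (z : ℂ) :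
    Summable (fun k => halfTerm τ k z) := by
  have h : 0 < (τ / 2).im := by
    have : (τ / 2).im = τ.im / 2 := by
      simp
    rw [this]; positivity
  have := (summable_jacobiTheta₂_term_iff (z / Real.pi) (τ / 2)).2 h
  refine this.congr fun k => ?_
  have := pi_ne_zero'
  rw [halfTerm, jacobiTheta₂_term]
  congr 1
  field_simp
  ring

/-- The even part of the theta series. -/
def thetaEven (τ z : ℂ) : ℂ := ∑' n : ℤ, halfTerm τ (2 * n) z

/-- The odd part of the theta series. -/
def thetaOdd (τ z : ℂ) : ℂ := ∑' n : ℤ, halfTerm τ (2 * n + 1) z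

/-- `(m, n) ↦ (m + n + 1, m - n)` identifies `ℤ × ℤ` with the pairs of opposite parity. -/
def parityEquiv : (ℤ × ℤ) ⊕ (ℤ × ℤ) ≃ ℤ × ℤ where
  toFun := Sum.elim (fun p => (p.1 + p.2, p.1 - p.2 - 1)) (fun p => (p.1 + p.2, p.1 - p.2))
  invFun := fun p => if (p.1 + p.2) % 2 = 0 then .inr ((p.1 + p.2) / 2, (p.1 - p.2) / 2)
    else .inl ((p.1 + p.2 + 1) / 2, (p.1 - p.2 - 1) / 2)
  left_inv := by
    rintro (⟨a, b⟩ | ⟨a, b⟩)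
    · change (if (a + b + (a - b - 1)) % 2 = 0 then _ else _) = _
      rw [if_neg (by omega)]
      simp only [Sum.elim_inl, Sum.inl.injEq, Prod.mk.injEq]
      omega
    · change (if (a + b + (a - b)) % 2 = 0 then _ else _) = _
      rw [if_pos (by omega)]
      simp only [Sum.elim_inr, Sum.inr.injEq, Prod.mk.injEq]
      omega
  right_inv := by
    rintro ⟨a, b⟩
    by_cases h : (a + b) % 2 = 0
    · simp only [h, if_true, Sum.elim_inr, Prod.mk.injEq]
      omega
    · simp only [h, if_false, Sum.elim_inl, Prod.mk.injEq]
      omega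

lemma exp_int_mul_two_pi (n : ℤ) (z : ℂ) : exp (z + n * (2 * Real.pi * I)) = exp z := by
  rw [exp_add, exp_int_mul_two_pi_mul_I, mul_one]

/-- With `m = p + l` and `n = p - l - 1`, the parallelogram identity `(m+1/2)² + (n+1/2)² =
((m+n+1)² + (m-n)²)/2` separates `x` from `y`. Here `m + n + 1 = 2p` and `m - n = 2l + 1`; the sign
is `exp(πi(m+n))` with `m + n` odd. -/
lemma thetaTerm_mul_inl (τ : ℂ) (p l : ℤ) (x y : ℂ) :
    thetaTerm τ (p + l) (x + y) * thetaTerm τ (p - l - 1) (x - y) =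
      -(halfTerm τ (2 * p) x * halfTerm τ (2 * l + 1) y) := by
  simp only [thetaTerm, halfTerm, ← exp_add]
  have : ∀ z, -exp z = exp (z + Real.pi * I) := fun z => by
    rw [exp_add, exp_pi_mul_I]; ring
  rw [this]
  conv_rhs => rw [← exp_int_mul_two_pi (p - 1)]
  push_cast
  congr 1
  ring

lemma thetaTerm_mul_inr (τ : ℂ) (p l : ℤ) (x y : ℂ) :
    thetaTerm τ (p + l) (x + y) * thetaTerm τ (p - l) (x - y) =
      halfTerm τ (2 * p + 1) x * halfTerm τ (2 * l) y := by
  simp only [thetaTerm, halfTerm, ← exp_add]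
  conv_rhs => rw [← exp_int_mul_two_pi p]
  push_cast
  congr 1
  ring

/-- The double series is rearranged along `m + n + 1` and `m - n`. These have opposite parity, so it
splits into two products of an even and an odd series. The point is the antisymmetric two-term form,
which is a 2×2 determinant. -/
lemma theta1_mul {τ : ℂ} (hτ : 0 < τ.im) (x y : ℂ) :
    theta1 (x + y) τ * theta1 (x - y) τ =
      thetaEven τ x * thetaOdd τ y - thetaOdd τ x * thetaEven τ y := by
  have hs : ∀ z, Summable fun k => ‖thetaTerm τ k z‖ := fun z => (hasSum_thetaTerm hτ z).summable.norm
  have he : ∀ z, Summable fun k : ℤ => ‖halfTerm τ (2 * k) z‖ := fun z =>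
    ((summable_halfTerm hτ z).norm).comp_injective (i := fun k : ℤ => 2 * k)
      (fun a b h => by simpa using h)
  have ho : ∀ z, Summable fun k : ℤ => ‖halfTerm τ (2 * k + 1) z‖ := fun z =>
    ((summable_halfTerm hτ z).norm).comp_injective (i := fun k : ℤ => 2 * k + 1)
      (fun a b h => by simpa using h)
  have h1 : HasSum (fun p : ℤ × ℤ => thetaTerm τ p.1 (x + y) * thetaTerm τ p.2 (x - y))
      ((I * theta1 (x + y) τ) * (I * theta1 (x - y) τ)) := by
    rw [← (hasSum_thetaTerm hτ (x + y)).tsum_eq, ← (hasSum_thetaTerm hτ (x - y)).tsum_eq,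
      tsum_mul_tsum_of_summable_norm (hs _) (hs _)]
    exact (summable_mul_of_summable_norm (hs _) (hs _)).hasSum
  rw [← parityEquiv.hasSum_iff] at h1
  have h2 : HasSum (fun p : ℤ × ℤ => -(halfTerm τ (2 * p.1) x * halfTerm τ (2 * p.2 + 1) y))
      (-(thetaEven τ x * thetaOdd τ y)) := by
    rw [thetaEven, thetaOdd, tsum_mul_tsum_of_summable_norm (he _) (ho _)]
    exact (summable_mul_of_summable_norm (he _) (ho _)).hasSum.neg
  have h3 : HasSum (fun p : ℤ × ℤ => halfTerm τ (2 * p.1 + 1) x * halfTerm τ (2 * p.2) y)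
      (thetaOdd τ x * thetaEven τ y) := by
    rw [thetaEven, thetaOdd, tsum_mul_tsum_of_summable_norm (ho _) (he _)]
    exact (summable_mul_of_summable_norm (ho _) (he _)).hasSum
  have h4 : HasSum ((fun p : ℤ × ℤ => thetaTerm τ p.1 (x + y) * thetaTerm τ p.2 (x - y)) ∘
      parityEquiv) (-(thetaEven τ x * thetaOdd τ y) + thetaOdd τ x * thetaEven τ y) :=
    HasSum.sum (h2.congr_fun fun p => thetaTerm_mul_inl τ p.1 p.2 x y)
      (h3.congr_fun fun p => thetaTerm_mul_inr τ p.1 p.2 x y)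
  have := h1.unique h4
  linear_combination (-1) * this + (theta1 (x + y) τ * theta1 (x - y) τ) * I_sq

lemma exp_real_tsum_ne_zero {f : ℤ → ℝ} {g : ℤ → ℂ} (hg : Summable g)
    (h : ∀ n, g n = exp (f n)) : ∑' n, g n ≠ 0 := by
  have e : g = fun n => ((Real.exp (f n) : ℝ) : ℂ) := by
    funext n; rw [h n]; push_cast; rfl
  rw [e] at hg ⊢
  rw [← Complex.ofReal_tsum]
  have hs : Summable fun n => Real.exp (f n) := Complex.summable_ofReal.1 hg
  have := hs.tsum_pos (fun n => (Real.exp_pos _).le) 0 (Real.exp_pos _)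
  exact_mod_cast this.ne'

/-- For purely imaginary `τ` the series at `0` and at `τ/2` have positive terms. At `1/2` the terms
alternate, but the modular transformation `τ ↦ -1/τ` moves this point to a half period of the
previous kind. -/
lemma jacobiTheta₂_half_period_ne_zero {t : ℝ} (ht : 0 < t) :
    jacobiTheta₂ 0 (I * t) ≠ 0 ∧ jacobiTheta₂ (I * t / 2) (I * t) ≠ 0 ∧
      jacobiTheta₂ (1 / 2) (I * t) ≠ 0 := by
  have him : ∀ {u : ℝ}, 0 < u → 0 < (I * u : ℂ).im := fun hu => by simpa using hu
  have key : ∀ {u : ℝ}, 0 < u → jacobiTheta₂ (I * u / 2) (I * u) ≠ 0 := fun {u} hu => by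
    refine exp_real_tsum_ne_zero (f := fun n => -Real.pi * u * (n + n ^ 2))
      (hasSum_jacobiTheta₂_term _ (him hu)).summable fun n => ?_
    rw [jacobiTheta₂_term]
    congr 1
    push_cast
    linear_combination (Real.pi * u * (n + n ^ 2) : ℂ) * I_sq
  refine ⟨?_, key ht, ?_⟩
  · refine exp_real_tsum_ne_zero (f := fun n => -Real.pi * t * n ^ 2)
      (hasSum_jacobiTheta₂_term _ (him ht)).summable fun n => ?_
    rw [jacobiTheta₂_term]
    congr 1
    push_cast
    linear_combination (Real.pi * t * n ^ 2 : ℂ) * I_sq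
  · have ht' : (t : ℂ) ≠ 0 := by exact_mod_cast ht.ne'
    rw [jacobiTheta₂_functional_equation]
    have e1 : (-1 : ℂ) / (I * t) = I * ((1 / t : ℝ) : ℂ) := by
      push_cast
      rw [div_eq_iff (mul_ne_zero I_ne_zero ht')]
      field_simp
      rw [I_sq]
    have e2 : (1 / 2 : ℂ) / (I * t) = -(I * ((1 / t : ℝ) : ℂ) / 2) := by
      rw [← e1]; field_simp
    rw [e1, e2, jacobiTheta₂_neg_left]
    refine mul_ne_zero (mul_ne_zero ?_ (exp_ne_zero _)) (key (by positivity))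
    rw [one_div]
    refine inv_ne_zero ?_
    rw [Ne, cpow_eq_zero_iff]
    rintro ⟨h, -⟩
    have : (t : ℂ) = 0 := by linear_combination h + (t : ℂ) * I_sq
    exact ht' this

lemma theta1_add_pi (z τ : ℂ) : theta1 (z + Real.pi) τ = -theta1 z τ := by
  have e : (z + Real.pi) / Real.pi + 1 / 2 + τ / 2 = (z / Real.pi + 1 / 2 + τ / 2) + 1 := by
    rw [add_div, div_self pi_ne_zero']; ring
  rw [theta1, theta1, e, jacobiTheta₂_add_left,
    show I * Real.pi * τ / 4 + I * (z + Real.pi) =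
      (I * Real.pi * τ / 4 + I * z) + Real.pi * I by ring, exp_add _ (Real.pi * I), exp_pi_mul_I]
  ring

lemma theta1_add_pi_mul (z τ : ℂ) :
    theta1 (z + Real.pi * τ) τ = -exp (-(I * Real.pi * τ) - 2 * I * z) * theta1 z τ := by
  have hp := pi_ne_zero'
  have e : (z + Real.pi * τ) / Real.pi + 1 / 2 + τ / 2 = (z / Real.pi + 1 / 2 + τ / 2) + τ := by
    field_simp; ring
  rw [theta1, theta1, e, jacobiTheta₂_add_left']
  have e2 : exp (I * Real.pi * τ / 4 + I * (z + Real.pi * τ)) *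
      exp (-Real.pi * I * (τ + 2 * (z / Real.pi + 1 / 2 + τ / 2))) =
      -(exp (-(I * Real.pi * τ) - 2 * I * z) * exp (I * Real.pi * τ / 4 + I * z)) := by
    rw [← exp_add, ← exp_add,
      show -exp (-(I * Real.pi * τ) - 2 * I * z + (I * Real.pi * τ / 4 + I * z)) =
        exp (-(I * Real.pi * τ) - 2 * I * z + (I * Real.pi * τ / 4 + I * z)) *
          exp (-(Real.pi * I)) by rw [exp_neg, exp_pi_mul_I]; norm_num, ← exp_add]
    congr 1
    field_simp
    ring
  linear_combination (-I * jacobiTheta₂ (z / Real.pi + 1 / 2 + τ / 2) τ) * e2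

lemma theta1_neg (z τ : ℂ) : theta1 (-z) τ = -theta1 z τ := by
  have hp := pi_ne_zero'
  have e : -z / Real.pi + 1 / 2 + τ / 2 = -((z / Real.pi + 1 / 2 + τ / 2)) + 1 + τ := by ring
  rw [theta1, theta1, e, jacobiTheta₂_add_left', jacobiTheta₂_add_left, jacobiTheta₂_neg_left]
  have e2 : exp (I * Real.pi * τ / 4 + I * -z) *
      exp (-Real.pi * I * (τ + 2 * (-((z / Real.pi + 1 / 2 + τ / 2)) + 1))) =
      -exp (I * Real.pi * τ / 4 + I * z) := by
    rw [← exp_add,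
      show -exp (I * Real.pi * τ / 4 + I * z) =
        exp (I * Real.pi * τ / 4 + I * z) *
          exp (-(Real.pi * I)) by rw [exp_neg, exp_pi_mul_I]; norm_num, ← exp_add]
    congr 1
    field_simp
    ring
  linear_combination (-I * jacobiTheta₂ (z / Real.pi + 1 / 2 + τ / 2) τ) * e2

/-! ### Properties of the function `s` -/

namespace Setting

variable (S : Setting)

lemma r_ne_zero : (S.r : ℂ) ≠ 0 := by exact_mod_cast S.r_pos.ne'
lemma a_ne_zero : (S.a : ℂ) ≠ 0 := by exact_mod_cast S.a_pos.ne'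

lemma tau_im_pos : 0 < (I * S.r * S.a / Real.pi : ℂ).im := by
  have : (I * S.r * S.a / Real.pi : ℂ) = I * ((S.r * S.a / Real.pi : ℝ) : ℂ) := by
    push_cast; ring
  rw [this]
  have := S.r_pos
  have := S.a_pos
  have : 0 < S.r * S.a / Real.pi := by positivity
  simpa using this

lemma s_neg (x : ℂ) : S.s (-x) = -S.s x := by
  unfold s
  split
  · rfl
  · rw [mul_neg, sin_neg, mul_neg]
  · rw [mul_neg, neg_div, sinh_neg, mul_neg]
  · rw [mul_neg, theta1_neg, mul_neg]

lemma s_zero : S.s 0 = 0 := by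
  have := S.s_neg 0
  rw [neg_zero] at this
  linear_combination this / 2

lemma s_sub_comm (x y : ℂ) : S.s (x - y) = -S.s (y - x) := by
  rw [← s_neg, neg_sub]

lemma differentiable_s : Differentiable ℂ S.s := by
  unfold s
  split
  · exact differentiable_id
  · fun_prop
  · fun_prop
  · have h : Differentiable ℂ fun z => jacobiTheta₂ z (I * S.r * S.a / Real.pi) :=
      fun z => differentiableAt_jacobiTheta₂_fst z S.tau_im_pos
    have h2 : Differentiable ℂ fun x : ℂ =>
        jacobiTheta₂ (S.r * x / Real.pi + 1 / 2 + I * S.r * S.a / Real.pi / 2)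
          (I * S.r * S.a / Real.pi) := h.comp (f := fun x : ℂ =>
            S.r * x / Real.pi + 1 / 2 + I * S.r * S.a / Real.pi / 2) (by fun_prop)
    unfold theta1
    fun_prop

lemma continuous_s : Continuous S.s := S.differentiable_s.continuous

/-- Outside the elliptic case `A = s²` and `B = 1`, by the addition formulas. In the elliptic case
`A` and `B` are multiples of the even and odd parts of the theta series. -/
lemma exists_s_add_mul_s_sub :
    ∃ A B : ℂ → ℂ, (S.kind ≠ .elliptic → ∀ x, B x = 1) ∧
      ∀ x y, S.s (x + y) * S.s (x - y) = A x * B y - B x * A y := by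
  unfold s
  split
  · exact ⟨fun x => x ^ 2, fun _ => 1, fun _ _ => rfl, fun x y => by ring⟩
  · refine ⟨fun x => (1 / S.r * sin (S.r * x)) ^ 2, fun _ => 1, fun _ _ => rfl, fun x y => ?_⟩
    rw [mul_add, mul_sub, sin_add, sin_sub]
    linear_combination (-1 / S.r ^ 2 * sin (S.r * y) ^ 2 : ℂ) * sin_sq_add_cos_sq (S.r * x) +
      (1 / S.r ^ 2 * sin (S.r * x) ^ 2 : ℂ) * sin_sq_add_cos_sq (S.r * y)
  · refine ⟨fun x => (S.a / Real.pi * sinh (Real.pi * x / S.a)) ^ 2, fun _ => 1, fun _ _ => rfl,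
      fun x y => ?_⟩
    rw [mul_add, mul_sub, add_div, sub_div, sinh_add, sinh_sub]
    linear_combination
      (-(S.a / Real.pi) ^ 2 * sinh (Real.pi * y / S.a) ^ 2 : ℂ) *
        cosh_sq_sub_sinh_sq (Real.pi * x / S.a) +
      ((S.a / Real.pi) ^ 2 * sinh (Real.pi * x / S.a) ^ 2 : ℂ) *
        cosh_sq_sub_sinh_sq (Real.pi * y / S.a)
  · rename_i hk
    set τ : ℂ := I * S.r * S.a / Real.pi with hτ
    set K : ℂ := 1 / S.r * exp (S.r * S.a / 4)
    refine ⟨fun x => K * thetaEven τ (S.r * x), fun x => K * thetaOdd τ (S.r * x),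
      fun h => absurd hk h, fun x y => ?_⟩
    have := theta1_mul S.tau_im_pos (S.r * x) (S.r * y)
    rw [← hτ] at this
    rw [mul_add, mul_sub]
    linear_combination K ^ 2 * this

/-- The Plücker relation for the 2×2 minors formed from the vectors `(A, B)` at the four points. -/
lemma s_three_term (x y z w : ℂ) :
    S.s (x + y) * S.s (x - y) * (S.s (z + w) * S.s (z - w)) +
      S.s (x + z) * S.s (x - z) * (S.s (w + y) * S.s (w - y)) +
      S.s (x + w) * S.s (x - w) * (S.s (y + z) * S.s (y - z)) = 0 := by
  obtain ⟨A, B, -, h⟩ := S.exists_s_add_mul_s_sub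
  simp only [h]
  ring

/-- When `B = 1`, each product of two values of `s` is a difference of values of `A`, and the three
differences telescope. -/
lemma s_mul_sub_mul (hk : S.kind ≠ .elliptic) (p q d : ℂ) :
    S.s p * S.s q - S.s (p - d) * S.s (q - d) = S.s d * S.s (p + q - d) := by
  obtain ⟨A, B, hB, h⟩ := S.exists_s_add_mul_s_sub
  have h1 := h ((p + q) / 2) ((p - q) / 2)
  have h2 := h ((p + q) / 2 - d) ((p - q) / 2)
  have h3 := h ((p + q) / 2) ((p + q) / 2 - d)
  simp only [hB hk] at h1 h2 h3
  ring_nf at h1 h2 h3 ⊢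
  linear_combination h1 - h2 - h3

end Setting

/-! ### Quasi-periods, half periods and the duplication formula -/

/-- The signs in the quasi-periodicity of `s`. -/
def sigma (ν : ℕ) : ℂ := if ν = 0 then 1 else -1

lemma sigma_sq (ν : ℕ) : sigma ν ^ 2 = 1 := by
  unfold sigma; split <;> norm_num

namespace Setting

variable (S : Setting)

lemma s_add_omega1 (hk : S.kind ≠ .rational) (x : ℂ) : S.s (x + S.omega1) = -S.s x := by
  have hr := S.r_ne_zero
  have ha := S.a_ne_zero
  have hp := pi_ne_zero'
  unfold s omega1
  split <;> rename_i h
  · exact absurd h hk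
  · rw [show (S.r : ℂ) * (x + Real.pi / S.r) = S.r * x + Real.pi by field_simp, sin_add_pi]
    ring
  · rw [show Real.pi * (x + I * S.a) / S.a = Real.pi * x / S.a + Real.pi * I by field_simp,
      sinh_add, sinh_mul_I, cosh_mul_I, sin_pi, cos_pi]
    ring
  · rw [show (S.r : ℂ) * (x + Real.pi / S.r) = S.r * x + Real.pi by field_simp, theta1_add_pi]
    ring

lemma s_add_I_mul_a (hk : S.kind = .elliptic) (x : ℂ) :
    S.s (x + I * S.a) = -exp (-2 * I * S.r * x + S.r * S.a) * S.s x := by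
  have hp := pi_ne_zero'
  unfold s
  rw [hk]
  simp only
  have e : (S.r : ℂ) * (x + I * S.a) = S.r * x + Real.pi * (I * S.r * S.a / Real.pi) := by
    field_simp
  rw [e, theta1_add_pi_mul]
  have e2 : -(I * Real.pi * (I * S.r * S.a / Real.pi)) - 2 * I * (S.r * x) =
      -2 * I * S.r * x + S.r * S.a := by
    field_simp
    linear_combination (-S.r * S.a : ℂ) * I_sq
  rw [e2]
  ring

lemma rho_cases : (S.rho = 0 ∧ S.kind = .rational) ∨ (S.rho = 1 ∧ S.kind ≠ .rational ∧
    S.kind ≠ .elliptic) ∨ (S.rho = 3 ∧ S.kind = .elliptic) := by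
  unfold rho
  split <;> simp_all

lemma xi_eq_zero (hk : S.kind ≠ .elliptic) {ν : ℕ} (hν : ν ≤ S.rho) : xi ν = 0 := by
  rcases S.rho_cases with h | h | h
  · have : ν = 0 := by omega
    subst this; rfl
  · have : ν = 0 ∨ ν = 1 := by omega
    rcases this with rfl | rfl <;> rfl
  · exact absurd h.2 hk

lemma s_add_half_omega {ν : ℕ} (hν : ν ≤ S.rho) (x : ℂ) :
    S.s (x + S.omega ν / 2) = sigma ν * exp (2 * I * S.r * xi ν * x) * S.s (x - S.omega ν / 2) := by
  have h0 : S.s (x + S.omega 0 / 2) = sigma 0 * exp (2 * I * S.r * xi 0 * x) *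
      S.s (x - S.omega 0 / 2) := by simp [omega, sigma, xi]
  have h1 : S.kind ≠ .rational → S.s (x + S.omega 1 / 2) = sigma 1 *
      exp (2 * I * S.r * xi 1 * x) * S.s (x - S.omega 1 / 2) := fun hk => by
    have := S.s_add_omega1 hk (x - S.omega1 / 2)
    simp only [omega, sigma, xi]
    simp only [one_ne_zero, if_false, mul_zero, zero_mul, exp_zero, mul_one, neg_mul, one_mul]
    rw [← this]
    ring_nf
  rcases S.rho_cases with h | h | h
  · have : ν = 0 := by omega
    subst this; exact h0
  · have : ν = 0 ∨ ν = 1 := by omega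
    rcases this with rfl | rfl
    exacts [h0, h1 h.2.1]
  · have hk : S.kind ≠ .rational := by rw [h.2]; simp
    have hν : ν = 0 ∨ ν = 1 ∨ ν = 2 ∨ ν = 3 := by omega
    rcases hν with rfl | rfl | rfl | rfl
    · exact h0
    · exact h1 hk
    · have := S.s_add_I_mul_a h.2 (x - I * S.a / 2)
      simp only [omega, sigma, xi]
      rw [show x - I * S.a / 2 + I * S.a = x + I * S.a / 2 by ring,
        show -2 * I * S.r * (x - I * S.a / 2) + S.r * S.a = 2 * I * S.r * -1 * x by
          linear_combination (S.r * S.a : ℂ) * I_sq] at this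
      rw [this]
      simp
    · have h2 := S.s_add_omega1 hk (x - S.omega1 / 2 + I * S.a / 2)
      have h3 := S.s_add_I_mul_a h.2 (x - S.omega1 / 2 - I * S.a / 2)
      simp only [omega, sigma, xi]
      rw [show x - S.omega1 / 2 - I * S.a / 2 + I * S.a = x - S.omega1 / 2 + I * S.a / 2 by ring] at h3
      rw [h3, show x - S.omega1 / 2 + I * S.a / 2 + S.omega1 = x - (-S.omega1 - I * S.a) / 2 by ring]
        at h2
      rw [h2, show x + (-S.omega1 - I * S.a) / 2 = x - S.omega1 / 2 - I * S.a / 2 by ring]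
      -- The translation by `ω₃ = -ω₁ - ω₂` combines the previous two. The factor `-1` comes from `r
      -- ω₁ = π` and is the sign `sigma 3`.
      have e : exp (2 * I * S.r * 1 * x) * exp (-2 * I * S.r * (x - S.omega1 / 2 - I * S.a / 2) +
          S.r * S.a) = -1 := by
        rw [← exp_add, ← exp_pi_mul_I]
        congr 1
        unfold omega1
        rw [h.2]
        have hr := S.r_ne_zero
        field_simp
        linear_combination (S.r * S.a : ℂ) * I_sq
      simp only [OfNat.ofNat_ne_zero, if_false]
      linear_combination S.s (x - S.omega1 / 2 - I * S.a / 2) * e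

/-- Modulo the lattice the arguments of `jacobiTheta₂` are `τ/2`, `1/2` and `0`, where the theta
function was shown not to vanish. -/
lemma s_half_I_mul_a_ne_zero (hk : S.kind = .elliptic) :
    S.s (S.omega1 / 2) ≠ 0 ∧ S.s (I * S.a / 2) ≠ 0 ∧ S.s (S.omega1 / 2 + I * S.a / 2) ≠ 0 := by
  have hp := pi_ne_zero'
  have hr := S.r_ne_zero
  set t : ℝ := S.r * S.a / Real.pi with ht
  have htp : 0 < t := by
    have := S.r_pos; have := S.a_pos; positivity
  have hτ : (I * S.r * S.a / Real.pi : ℂ) = I * t := by rw [ht]; push_cast; ring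
  have hI : (S.r * (I * S.a) / Real.pi : ℂ) = I * t := by rw [ht]; push_cast; ring
  obtain ⟨h1, h2, h3⟩ := jacobiTheta₂_half_period_ne_zero htp
  have key : ∀ x : ℂ, jacobiTheta₂ (S.r * x / Real.pi + 1 / 2 + I * t / 2) (I * t) ≠ 0 →
      S.s x ≠ 0 := fun x hx => by
    unfold s
    rw [hk]
    simp only [theta1, hτ]
    refine mul_ne_zero (mul_ne_zero (one_div_ne_zero hr) (exp_ne_zero _))
      (mul_ne_zero (mul_ne_zero (neg_ne_zero.2 I_ne_zero) (exp_ne_zero _)) hx)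
  have ho : S.omega1 = Real.pi / S.r := by unfold omega1; rw [hk]
  rw [ho]
  refine ⟨key _ ?_, key _ ?_, key _ ?_⟩
  · rw [show (S.r * (Real.pi / S.r / 2) / Real.pi + 1 / 2 + I * t / 2 : ℂ) = I * t / 2 + 1 by
      field_simp; ring, jacobiTheta₂_add_left]
    exact h2
  · rw [show (S.r * (I * S.a / 2) / Real.pi + 1 / 2 + I * t / 2 : ℂ) = 1 / 2 + I * t by
      rw [← hI]; field_simp; ring, jacobiTheta₂_add_left']
    exact mul_ne_zero (exp_ne_zero _) h3
  · rw [show (S.r * (Real.pi / S.r / 2 + I * S.a / 2) / Real.pi + 1 / 2 + I * t / 2 : ℂ) =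
      0 + 1 + I * t by rw [← hI]; field_simp; ring, jacobiTheta₂_add_left', jacobiTheta₂_add_left]
    exact mul_ne_zero (exp_ne_zero _) h1

/-- In the elliptic case every half difference equals, up to sign and a full quasi-period, one of
the three half periods. This keeps the poles within each half-period family apart. -/
lemma s_half_omega_sub_ne_zero {ν μ : ℕ} (hν : ν ≤ S.rho) (hμ : μ ≤ S.rho) (h : ν ≠ μ) :
    S.s ((S.omega ν - S.omega μ) / 2) ≠ 0 := by
  wlog hlt : μ < ν generalizing ν μ
  · rw [show (S.omega ν - S.omega μ) / 2 = -((S.omega μ - S.omega ν) / 2) by ring, s_neg]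
    exact neg_ne_zero.2 (this hμ hν h.symm (by omega))
  have hr := S.r_ne_zero
  have ha := S.a_ne_zero
  have hp := pi_ne_zero'
  rcases S.rho_cases with hc | hc | hc
  · omega
  · have : ν = 1 ∧ μ = 0 := by omega
    obtain ⟨rfl, rfl⟩ := this
    have hk := hc.2
    simp only [omega, sub_zero]
    unfold s omega1
    split <;> rename_i hS
    · exact absurd hS hk.1
    · rw [show (S.r : ℂ) * (Real.pi / S.r / 2) = Real.pi / 2 by field_simp, sin_pi_div_two]
      simpa using hr
    · rw [show (Real.pi * (I * S.a / 2) / S.a : ℂ) = (Real.pi / 2) * I by field_simp,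
        sinh_mul_I, sin_pi_div_two]
      simp [hp, ha]
    · exact absurd hS hk.2
  · obtain ⟨h1, h2, h3⟩ := S.s_half_I_mul_a_ne_zero hc.2
    have hk : S.kind ≠ .rational := by rw [hc.2]; simp
    have hv : (ν = 1 ∧ μ = 0) ∨ (ν = 2 ∧ μ = 0) ∨ (ν = 3 ∧ μ = 0) ∨ (ν = 2 ∧ μ = 1) ∨
      (ν = 3 ∧ μ = 1) ∨ (ν = 3 ∧ μ = 2) := by omega
    rcases hv with ⟨rfl, rfl⟩ | ⟨rfl, rfl⟩ | ⟨rfl, rfl⟩ | ⟨rfl, rfl⟩ | ⟨rfl, rfl⟩ | ⟨rfl, rfl⟩ <;>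
      simp only [omega, sub_zero]
    · exact h1
    · exact h2
    · rw [show (-S.omega1 - I * S.a) / 2 = -(S.omega1 / 2 + I * S.a / 2) by ring, s_neg]
      exact neg_ne_zero.2 h3
    · have := S.s_add_omega1 hk ((I * S.a - S.omega1) / 2)
      rw [show (I * S.a - S.omega1) / 2 + S.omega1 = S.omega1 / 2 + I * S.a / 2 by ring] at this
      exact neg_ne_zero.1 (this ▸ h3)
    · have := S.s_add_omega1 hk (I * S.a / 2)
      rw [show (-S.omega1 - I * S.a - S.omega1) / 2 = -(I * S.a / 2 + S.omega1) by ring, s_neg, this,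
        neg_neg]
      exact h2
    · have := S.s_add_I_mul_a hc.2 (S.omega1 / 2)
      rw [show (-S.omega1 - I * S.a - I * S.a) / 2 = -(S.omega1 / 2 + I * S.a) by ring, s_neg, this]
      simp [h1]

lemma s_half_omega_ne_zero {ν : ℕ} (hν : ν ≤ S.rho) (h : ν ≠ 0) : S.s (S.omega ν / 2) ≠ 0 := by
  have := S.s_half_omega_sub_ne_zero hν (Nat.zero_le _) h
  simpa [omega] using this

lemma prod_s_add_half_omega (x : ℂ) :
    ∏ μ ∈ range (S.rho + 1), S.s (x + S.omega μ / 2) =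
      (-1) ^ S.rho * ∏ μ ∈ range (S.rho + 1), S.s (x - S.omega μ / 2) := by
  rw [prod_congr rfl fun μ hμ => S.s_add_half_omega (by simpa [Nat.lt_succ_iff] using hμ) x,
    prod_mul_distrib]
  congr 1
  rcases S.rho_cases with h | h | h <;> rw [h.1] <;> simp [prod_range_succ, sigma, xi]
  rw [← exp_add]
  norm_num

/-- The duplication formula. -/
lemma s_two_mul (u : ℂ) :
    S.s (2 * u) * ∏ μ ∈ Icc 1 S.rho, S.s (-(S.omega μ / 2)) =
      2 * ∏ μ ∈ range (S.rho + 1), S.s (u - S.omega μ / 2) := by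
  have hr := S.r_ne_zero
  have ha := S.a_ne_zero
  have hp := pi_ne_zero'
  rcases S.rho_cases with hc | hc | hc
  · rw [hc.1]
    unfold s
    rw [hc.2]
    simp [omega]
  · rw [hc.1]
    simp only [Icc_self, prod_singleton, prod_range_succ, prod_range_zero, one_mul, omega]
    unfold s omega1
    split <;> rename_i hS
    · exact absurd hS hc.2.1
    · rw [show (S.r : ℂ) * -(Real.pi / S.r / 2) = -(Real.pi / 2) by field_simp,
        show (S.r : ℂ) * (u - Real.pi / S.r / 2) = S.r * u - Real.pi / 2 by field_simp,
        sin_neg, sin_pi_div_two, sin_sub_pi_div_two,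
        show (S.r : ℂ) * (2 * u) = 2 * (S.r * u) by ring, sin_two_mul]
      simp only [zero_div, sub_zero]
      ring
    · rw [show (Real.pi * -(I * S.a / 2) / S.a : ℂ) = -((Real.pi / 2) * I) by field_simp,
        show (Real.pi * (u - I * S.a / 2) / S.a : ℂ) = Real.pi * u / S.a - (Real.pi / 2) * I by
          field_simp,
        sinh_neg, sinh_sub, sinh_mul_I, cosh_mul_I, sin_pi_div_two, cos_pi_div_two,
        show (Real.pi * (2 * u) / S.a : ℂ) = 2 * (Real.pi * u / S.a) by ring, sinh_two_mul]
      simp only [zero_div, sub_zero]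
      ring
    · exact absurd hS hc.2.2
  · have hq := S.prod_s_add_half_omega u
    -- The arguments are chosen so that the first term contains `s(2u)`, while the others are `∏ s(u
    -- - ω_μ/2)` and `∏ s(u + ω_μ/2)` up to sign. These two products agree up to sign by `hq`, which
    -- explains the factor `2`.
    have h3 := S.s_three_term (u + S.omega1 / 4) (u - S.omega1 / 4)
      (I * S.a / 2 + S.omega1 / 4) (-(S.omega1 / 4))
    rw [hc.1] at hq ⊢
    have hI : Icc 1 3 = ({1, 2, 3} : Finset ℕ) := rfl
    rw [hI, prod_insert (by simp), prod_pair (by simp)]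
    simp only [prod_range_succ, prod_range_zero, one_mul, omega, s_neg] at hq ⊢
    rw [show u + S.omega1 / 4 + (u - S.omega1 / 4) = 2 * u by ring,
      show u + S.omega1 / 4 - (u - S.omega1 / 4) = S.omega1 / 2 by ring,
      show I * S.a / 2 + S.omega1 / 4 + -(S.omega1 / 4) = I * S.a / 2 by ring,
      show I * S.a / 2 + S.omega1 / 4 - -(S.omega1 / 4) = -((-S.omega1 - I * S.a) / 2) by ring,
      show u + S.omega1 / 4 + (I * S.a / 2 + S.omega1 / 4) = u - (-S.omega1 - I * S.a) / 2 by ring,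
      show u + S.omega1 / 4 - (I * S.a / 2 + S.omega1 / 4) = u - I * S.a / 2 by ring,
      show -(S.omega1 / 4) + (u - S.omega1 / 4) = u - S.omega1 / 2 by ring,
      show -(S.omega1 / 4) - (u - S.omega1 / 4) = -(u - 0 / 2) by ring,
      show u + S.omega1 / 4 + -(S.omega1 / 4) = u + 0 / 2 by ring,
      show u + S.omega1 / 4 - -(S.omega1 / 4) = u + S.omega1 / 2 by ring,
      show u - S.omega1 / 4 + (I * S.a / 2 + S.omega1 / 4) = u + I * S.a / 2 by ring,
      show u - S.omega1 / 4 - (I * S.a / 2 + S.omega1 / 4) = u + (-S.omega1 - I * S.a) / 2 by ring,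
      s_neg, s_neg] at h3
    linear_combination h3 - hq

/-- Each half-period family brings one constant from the duplication formula into the residues;
`prefactor` normalises the square of this constant to `1`. -/
lemma prefactor_mul :
    S.prefactor * (2 / ∏ μ ∈ Icc 1 S.rho, S.s (-(S.omega μ / 2))) ^ 2 = 1 := by
  have h : ∏ μ ∈ Icc 1 S.rho, S.s (-(S.omega μ / 2)) ≠ 0 := prod_ne_zero_iff.2 fun μ hμ => by
    rw [s_neg]
    rw [mem_Icc] at hμ
    exact neg_ne_zero.2 (S.s_half_omega_ne_zero hμ.2 (by omega))
  have e : S.prefactor = (∏ μ ∈ Icc 1 S.rho, S.s (-(S.omega μ / 2))) ^ 2 / 4 := by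
    rw [prefactor, ← prod_pow]
    simp only [s_neg, neg_sq]
  rw [e]
  field_simp
  norm_num

lemma prod_s_sub_half_omega (u : ℂ) :
    ∏ μ ∈ range (S.rho + 1), S.s (u - S.omega μ / 2) =
      S.s (2 * u) / (2 / ∏ μ ∈ Icc 1 S.rho, S.s (-(S.omega μ / 2))) := by
  rw [div_div_eq_mul_div, s_two_mul]
  ring

lemma exists_s_ne_zero : ∃ x, S.s x ≠ 0 := by
  rcases S.rho_cases with hc | hc | hc
  · refine ⟨1, ?_⟩
    unfold s
    rw [hc.2]
    simp
  · exact ⟨_, S.s_half_omega_ne_zero (ν := 1) (by omega) one_ne_zero⟩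
  · exact ⟨_, S.s_half_omega_ne_zero (ν := 1) (by omega) one_ne_zero⟩

open Filter Topology in
lemma eventually_s_ne_zero (x : ℂ) : ∀ᶠ z in 𝓝[≠] x, S.s z ≠ 0 := by
  have han : AnalyticOnNhd ℂ S.s Set.univ := fun z _ => S.differentiable_s.analyticAt z
  rcases (han x trivial).eventually_eq_zero_or_eventually_ne_zero with h | h
  · exfalso
    obtain ⟨y, hy⟩ := S.exists_s_ne_zero
    exact hy (han.eqOn_zero_of_preconnected_of_eventuallyEq_zero isPreconnected_univ trivial h
      trivial)
  · exact h

open Filter Topology in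
lemma eventually_s_affine_ne_zero {m : ℂ} (hm : m ≠ 0) (x t₀ : ℂ) :
    ∀ᶠ t in 𝓝[≠] t₀, S.s (x + m * t) ≠ 0 := by
  have h : Tendsto (fun t : ℂ => x + m * t) (𝓝[≠] t₀) (𝓝[≠] (x + m * t₀)) := by
    refine tendsto_nhdsWithin_iff.2 ⟨?_, ?_⟩
    · exact (Continuous.tendsto (by fun_prop) t₀).mono_left nhdsWithin_le_nhds
    · filter_upwards [self_mem_nhdsWithin] with t ht
      simpa [hm] using ht
  exact h.eventually (S.eventually_s_ne_zero _)

end Setting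

/-! ### Partial fractions for `s` -/

namespace Setting

variable (S : Setting)

/-- The exchange relation behind the induction step of `sum_prod_s_div`. -/
lemma s_exchange (p q b c z : ℂ) :
    S.s (p - q) * S.s (p + q - b - c) * (S.s (z - b) * S.s (z - c)) =
      S.s (p - b) * S.s (p - c) * (S.s (z - q) * S.s (z - (b + c - q))) -
      S.s (q - b) * S.s (q - c) * (S.s (z - p) * S.s (z - (b + c - p))) := by
  have h := S.s_three_term (z - (b + c) / 2) ((b - c) / 2) (p - (b + c) / 2) (q - (b + c) / 2)
  rw [show z - (b + c) / 2 + (b - c) / 2 = z - c by ring,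
    show z - (b + c) / 2 - (b - c) / 2 = z - b by ring,
    show p - (b + c) / 2 + (q - (b + c) / 2) = p + q - b - c by ring,
    show p - (b + c) / 2 - (q - (b + c) / 2) = p - q by ring,
    show z - (b + c) / 2 + (p - (b + c) / 2) = z - (b + c - p) by ring,
    show z - (b + c) / 2 - (p - (b + c) / 2) = z - p by ring,
    show q - (b + c) / 2 + (b - c) / 2 = q - c by ring,
    show q - (b + c) / 2 - (b - c) / 2 = q - b by ring,
    show z - (b + c) / 2 + (q - (b + c) / 2) = z - (b + c - q) by ring,
    show z - (b + c) / 2 - (q - (b + c) / 2) = z - q by ring,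
    show (b - c) / 2 + (p - (b + c) / 2) = p - c by ring,
    show (b - c) / 2 - (p - (b + c) / 2) = -(p - b) by ring, s_neg] at h
  linear_combination h

/-- A zero placed on the pole `a_q` kills the term of `q` and removes this pole from all other
terms, so one pole and one zero are lost. -/
lemma sum_s_sub_mul_div {ι : Type*} [DecidableEq ι] {A : Finset ι} {a : ι → ℂ}
    (hA : ∀ i ∈ A, ∀ j ∈ A, i ≠ j → S.s (a i - a j) ≠ 0) {q : ι} (hq : q ∈ A) (f : ι → ℂ) :
    ∑ i ∈ A, S.s (a i - a q) * f i / ∏ j ∈ A.erase i, S.s (a i - a j) =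
      ∑ i ∈ A.erase q, f i / ∏ j ∈ (A.erase q).erase i, S.s (a i - a j) := by
  rw [← add_sum_erase _ _ hq, sub_self, s_zero, zero_mul, zero_div, zero_add]
  refine sum_congr rfl fun i hi => ?_
  have hi' := mem_erase.1 hi
  rw [erase_right_comm, ← mul_prod_erase (A.erase i) _ (mem_erase.2 ⟨hi'.1.symm, hq⟩)]
  exact mul_div_mul_left _ _ (hA _ hi'.2 _ hq hi'.1)

open Filter Topology in
/-- The partial fraction identity for `s`. -/
lemma sum_prod_s_div {ι : Type*} [DecidableEq ι] (n : ℕ) :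
    ∀ (A : Finset ι) (B : Multiset ℂ) (a : ι → ℂ), A.card = n → B.card = n →
      (∀ i ∈ A, ∀ j ∈ A, i ≠ j → S.s (a i - a j) ≠ 0) →
      (S.kind = .elliptic → ∑ i ∈ A, a i = B.sum) →
      ∑ i ∈ A, (B.map fun b => S.s (a i - b)).prod / ∏ j ∈ A.erase i, S.s (a i - a j) =
        S.s (∑ i ∈ A, a i - B.sum) := by
  induction n with
  | zero =>
    intro A B a hA hB _ _
    rw [card_eq_zero] at hA
    rw [Multiset.card_eq_zero] at hB
    simp [hA, hB, s_zero]
  | succ n ih =>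
    intro A B a hA hB hne hbal
    rcases n with _ | n
    · obtain ⟨i, rfl⟩ := card_eq_one.1 hA
      obtain ⟨b, rfl⟩ := Multiset.card_eq_one.1 hB
      simp
    -- two distinct poles
    obtain ⟨p, hp, q, hq, hpq⟩ := one_lt_card.1 (show 1 < A.card by omega)
    have hpq0 := hne p hp q hq hpq
    have hqp0 := hne q hq p hp hpq.symm
    -- The generic case. By `s_exchange` the zeros `b, c` may be replaced by `a_r, b + c - a_r` for
    -- `r = p, q`. This preserves the sum of the zeros and cancels the pole `a_r`, so the induction
    -- hypothesis gives the same value for both replacements.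
    have key : ∀ (b c : ℂ) (B' : Multiset ℂ), B'.card = n →
        (S.kind = .elliptic → ∑ i ∈ A, a i = (b ::ₘ c ::ₘ B').sum) →
        S.s (a p + a q - b - c) ≠ 0 →
        ∑ i ∈ A, ((b ::ₘ c ::ₘ B').map fun b => S.s (a i - b)).prod /
          ∏ j ∈ A.erase i, S.s (a i - a j) = S.s (∑ i ∈ A, a i - (b ::ₘ c ::ₘ B').sum) := by
      intro b c B' hB' hbal hz
      have hsub : ∀ r ∈ A, ∑ i ∈ A, S.s (a i - a r) *
          (S.s (a i - (b + c - a r)) * (B'.map fun b => S.s (a i - b)).prod) /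
            ∏ j ∈ A.erase i, S.s (a i - a j) = S.s (∑ i ∈ A, a i - (b ::ₘ c ::ₘ B').sum) := by
        intro r hr
        rw [S.sum_s_sub_mul_div hne hr]
        have hs : ∑ i ∈ A.erase r, a i - ((b + c - a r) ::ₘ B').sum =
            ∑ i ∈ A, a i - (b ::ₘ c ::ₘ B').sum := by
          rw [← add_sum_erase _ _ hr]
          simp only [Multiset.sum_cons]
          ring
        have := ih (A.erase r) ((b + c - a r) ::ₘ B') a (by rw [card_erase_of_mem hr, hA]; rfl)
          (by simp [hB']) (fun i hi j hj => hne i (mem_of_mem_erase hi) j (mem_of_mem_erase hj))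
          (fun hk => by rw [← sub_eq_zero, hs, sub_eq_zero]; exact hbal hk)
        rw [hs] at this
        simpa only [Multiset.map_cons, Multiset.prod_cons] using this
      have hmul : S.s (a p - a q) * S.s (a p + a q - b - c) *
          ∑ i ∈ A, ((b ::ₘ c ::ₘ B').map fun b => S.s (a i - b)).prod /
            ∏ j ∈ A.erase i, S.s (a i - a j) =
          (S.s (a p - b) * S.s (a p - c) - S.s (a q - b) * S.s (a q - c)) *
            S.s (∑ i ∈ A, a i - (b ::ₘ c ::ₘ B').sum) := by
        rw [sub_mul]
        nth_rewrite 1 [← hsub q hq]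
        rw [← hsub p hp, mul_sum, mul_sum, mul_sum, ← sum_sub_distrib]
        refine sum_congr rfl fun i _ => ?_
        simp only [Multiset.map_cons, Multiset.prod_cons]
        have := S.s_exchange (a p) (a q) b c (a i)
        linear_combination ((B'.map fun b => S.s (a i - b)).prod /
          ∏ j ∈ A.erase i, S.s (a i - a j)) * this
      refine mul_left_cancel₀ (mul_ne_zero hpq0 hz) (hmul.trans ?_)
      -- In the elliptic case both sides vanish by the balancing condition; otherwise the two
      -- prefactors agree by `s_mul_sub_mul`.
      by_cases hk : S.kind = .elliptic
      · rw [hbal hk, sub_self, s_zero, mul_zero, mul_zero]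
      · have := S.s_mul_sub_mul hk (a p - b) (a p - c) (a p - a q)
        rw [show a p - b - (a p - a q) = a q - b by ring,
          show a p - c - (a p - a q) = a q - c by ring,
          show a p - b + (a p - c) - (a p - a q) = a p + a q - b - c by ring] at this
        rw [this]
    obtain ⟨b, B₁, rfl⟩ : ∃ b B₁, B = b ::ₘ B₁ := by
      obtain ⟨b, hb⟩ := Multiset.card_pos_iff_exists_mem.1 (show 0 < B.card by omega)
      exact ⟨b, B.erase b, (Multiset.cons_erase hb).symm⟩
    rw [Multiset.card_cons] at hB
    obtain ⟨c, B₂, rfl⟩ : ∃ b B₂, B₁ = b ::ₘ B₂ := by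
      obtain ⟨b, hb⟩ := Multiset.card_pos_iff_exists_mem.1 (show 0 < B₁.card by omega)
      exact ⟨b, B₁.erase b, (Multiset.cons_erase hb).symm⟩
    rw [Multiset.card_cons] at hB
    -- With only two zeros the exchange can be unavoidably degenerate, since elliptic balancing
    -- forces `a_p + a_q = b + c`. This case is computed directly.
    rcases n with _ | n
    · have hB₂ : B₂ = 0 := Multiset.card_eq_zero.1 (by omega)
      have hA' : A = {p, q} := by
        symm
        apply eq_of_subset_of_card_le
        · intro x hx
          rcases mem_insert.1 hx with rfl | hx
          · exact hp
          · rw [mem_singleton.1 hx]; exact hq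
        · rw [hA, card_pair hpq]
      subst hB₂ hA'
      have e1 : ({p, q} : Finset ι).erase p = {q} := erase_insert (by simpa using hpq)
      have e2 : ({p, q} : Finset ι).erase q = {p} := by
        rw [pair_comm]; exact erase_insert (by simpa using hpq.symm)
      rw [sum_pair hpq, e1, e2, prod_singleton, prod_singleton, S.s_sub_comm (a q) (a p)]
      rw [sum_pair hpq] at hbal ⊢
      simp only [Multiset.map_cons, Multiset.prod_cons, Multiset.map_zero, Multiset.prod_zero,
        mul_one, Multiset.sum_cons, Multiset.sum_zero, add_zero] at hbal ⊢
      rw [div_neg, ← sub_eq_add_neg, ← sub_div, div_eq_iff hpq0]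
      by_cases hk : S.kind = .elliptic
      · have h := hbal hk
        rw [h, sub_self, s_zero, zero_mul, show a q - b = -(a p - c) by linear_combination h,
          show a q - c = -(a p - b) by linear_combination h, s_neg, s_neg]
        ring
      · have := S.s_mul_sub_mul hk (a p - b) (a p - c) (a p - a q)
        rw [show a p - b - (a p - a q) = a q - b by ring,
          show a p - c - (a p - a q) = a q - c by ring,
          show a p - b + (a p - c) - (a p - a q) = a p + a q - (b + c) by ring] at this
        rw [this, mul_comm]
    · obtain ⟨d, B₃, rfl⟩ : ∃ b B₃, B₂ = b ::ₘ B₃ := by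
        obtain ⟨b, hb⟩ := Multiset.card_pos_iff_exists_mem.1 (show 0 < B₂.card by omega)
        exact ⟨b, B₂.erase b, (Multiset.cons_erase hb).symm⟩
      rw [Multiset.card_cons] at hB
      -- A third zero `d` allows `b` to move to `b + t` with the total sum fixed. For small `t ≠ 0`
      -- the generic case applies, and continuity gives `t = 0`.
      set L : ℂ → ℂ := fun t => ∑ i ∈ A,
        (((b + t) ::ₘ c ::ₘ (d - t) ::ₘ B₃).map fun b => S.s (a i - b)).prod /
          ∏ j ∈ A.erase i, S.s (a i - a j) with hL
      have hsum : ∀ t, ((b + t) ::ₘ c ::ₘ (d - t) ::ₘ B₃).sum = (b ::ₘ c ::ₘ d ::ₘ B₃).sum :=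
        fun t => by simp only [Multiset.sum_cons]; ring
      have hcont : Continuous L := by
        have := S.continuous_s
        simp only [hL, Multiset.map_cons, Multiset.prod_cons]
        fun_prop
      have hev : ∀ᶠ t in 𝓝[≠] (0 : ℂ), L t = S.s (∑ i ∈ A, a i - (b ::ₘ c ::ₘ d ::ₘ B₃).sum) := by
        filter_upwards [S.eventually_s_affine_ne_zero (m := -1) (by norm_num)
          (a p + a q - b - c) 0] with t ht
        have := key (b + t) c ((d - t) ::ₘ B₃) (by rw [Multiset.card_cons]; omega)
          (fun hk => by rw [hsum]; exact hbal hk) (by convert ht using 2; ring)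
        rw [hsum] at this
        exact this
      have h0 : L 0 = S.s (∑ i ∈ A, a i - (b ::ₘ c ::ₘ d ::ₘ B₃).sum) :=
        tendsto_nhds_unique_of_eventuallyEq ((hcont.tendsto 0).mono_left nhdsWithin_le_nhds)
          tendsto_const_nhds hev
      simpa [hL] using h0

end Setting

/-! ### Products over signs and the source identity -/

lemma prod_signs {R : Type*} [CommMonoid R] (f : ℤˣ → R) : ∏ δ : ℤˣ, f δ = f 1 * f (-1) := by
  rw [show (univ : Finset ℤˣ) = {1, -1} from by decide, prod_pair (by decide)]

lemma sum_signs {R : Type*} [AddCommMonoid R] (f : ℤˣ → R) : ∑ δ : ℤˣ, f δ = f 1 + f (-1) := by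
  rw [show (univ : Finset ℤˣ) = {1, -1} from by decide, sum_pair (by decide)]

lemma prod_signs' {R : Type*} [CommMonoid R] (f : ℤˣ → R) (ε : ℤˣ) :
    ∏ δ : ℤˣ, f δ = f ε * f (-ε) := by
  rw [prod_signs]
  rcases Int.units_eq_one_or ε with rfl | rfl
  · rfl
  · rw [neg_neg, mul_comm]

lemma sg_one : sg 1 = 1 := by simp [sg]
lemma sg_neg (ε : ℤˣ) : sg (-ε) = -sg ε := by simp [sg]
lemma sg_neg_one : sg (-1) = -1 := by simp [sg]
lemma sg_mul (ε δ : ℤˣ) : sg (ε * δ) = sg ε * sg δ := by simp [sg]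
lemma sg_mul_self (ε : ℤˣ) : sg ε * sg ε = 1 := by
  rcases Int.units_eq_one_or ε with rfl | rfl <;> simp [sg]

lemma prod_erase_prod_signs {J R : Type*} [Fintype J] [DecidableEq J] [CommMonoid R]
    (f : J × ℤˣ → R) (j : J) (ε : ℤˣ) :
    ∏ x ∈ univ.erase (j, ε), f x = f (j, -ε) * ∏ i ∈ univ.erase j, ∏ δ : ℤˣ, f (i, δ) := by
  have h : (univ : Finset (J × ℤˣ)).erase (j, ε) = insert (j, -ε) ((univ.erase j) ×ˢ univ) := by
    ext ⟨i, δ⟩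
    by_cases hi : i = j
    · subst hi
      simp [Int.units_ne_iff_eq_neg]
    · simp [hi, Int.units_eq_one_or]
  rw [h, prod_insert (by simp), prod_product]

namespace Setting

variable (S : Setting)

/-- Reflection at the half period carries each numerator to the denominator of the opposite sign.
The two exponential factors multiply to something independent of `x`, and this is how variables drop
out of a half-period residue. -/
lemma prod_signs_half_omega {ν : ℕ} (hν : ν ≤ S.rho) (x d : ℂ)
    (h : ∀ δ : ℤˣ, S.s (S.omega ν / 2 + d / 2 - sg δ * x) ≠ 0) :
    ∏ δ : ℤˣ, S.s (S.omega ν / 2 - d / 2 - sg δ * x) / S.s (S.omega ν / 2 + d / 2 - sg δ * x) =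
      exp (-2 * I * S.r * xi ν * d) := by
  have h1 := h 1
  have h2 := h (-1)
  have e := S.s_add_half_omega hν
  have e1 := e (-(x + d / 2))
  have e2 := e (x - d / 2)
  rw [prod_signs]
  simp only [sg_one, sg_neg_one] at *
  rw [show -(x + d / 2) + S.omega ν / 2 = S.omega ν / 2 - d / 2 - 1 * x by ring,
    show -(x + d / 2) - S.omega ν / 2 = -(S.omega ν / 2 + d / 2 - -1 * x) by ring, s_neg] at e1
  rw [show x - d / 2 + S.omega ν / 2 = S.omega ν / 2 - d / 2 - -1 * x by ring,
    show x - d / 2 - S.omega ν / 2 = -(S.omega ν / 2 + d / 2 - 1 * x) by ring, s_neg] at e2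
  rw [e1, e2, show -2 * I * S.r * xi ν * d =
    2 * I * S.r * xi ν * -(x + d / 2) + 2 * I * S.r * xi ν * (x - d / 2) by ring, exp_add]
  generalize S.s (S.omega ν / 2 + d / 2 - -1 * x) = u at *
  generalize S.s (S.omega ν / 2 + d / 2 - 1 * x) = v at *
  field_simp
  exact sigma_sq ν

section Source

variable {J : Type*} [Fintype J] (X c d e : J → ℂ) (b b' : ℂ)
  (h : Fin (2 * S.rho + 2) → ℂ)

/-- The term of the source identity that belongs to the pole `ε X_j + c_j`. -/
def sourceTerm [DecidableEq J] (j : J) (ε : ℤˣ) : ℂ :=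
  (∏ ν, S.s (sg ε * X j + c j - h ν)) /
      (S.s (sg ε * (2 * X j)) * S.s (sg ε * (2 * X j) - e j)) *
    ∏ i ∈ univ.erase j, ∏ δ : ℤˣ, S.s (sg ε * X j + c j - (sg δ * X i + c i) - d i) /
      S.s (sg ε * X j + c j - (sg δ * X i + c i))

/-- The term of the source identity that belongs to the pole `(b + ω_ν) / 2`. -/
def halfPeriodTerm (P : J → Prop) [DecidablePred P] (ν : ℕ) : ℂ :=
  (∏ μ, S.s ((S.omega ν + b) / 2 - h μ)) /
      ((∏ μ ∈ (range (S.rho + 1)).erase ν, S.s ((S.omega ν - S.omega μ) / 2)) *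
        ∏ μ ∈ range (S.rho + 1), S.s ((S.omega ν - S.omega μ + (b - b')) / 2)) *
    ∏ i, if P i then ∏ δ : ℤˣ, S.s ((S.omega ν + b) / 2 - (sg δ * X i + c i) - d i) /
        S.s ((S.omega ν + b) / 2 - (sg δ * X i + c i))
      else exp (-2 * I * S.r * xi ν * d i)

/-- The poles in the source identity. -/
def poleSet : Finset ((J × ℤˣ) ⊕ ℕ ⊕ ℕ) :=
  univ.disjSum ((range (S.rho + 1)).disjSum (range (S.rho + 1)))

/-- The location of the poles in the source identity. -/
def pole : (J × ℤˣ) ⊕ ℕ ⊕ ℕ → ℂ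
  | .inl x => sg x.2 * X x.1 + c x.1
  | .inr (.inl ν) => (S.omega ν + b) / 2
  | .inr (.inr ν) => (S.omega ν + b') / 2

/-- The location of the zeros in the source identity. -/
def zero : Fin (2 * S.rho + 2) ⊕ (J × ℤˣ) → ℂ
  | .inl ν => h ν
  | .inr x => sg x.2 * X x.1 + c x.1 + d x.1

lemma erase_disjSum_inl {α β : Type*} [DecidableEq α] [DecidableEq β] (s : Finset α)
    (t : Finset β) (a : α) : (s.disjSum t).erase (.inl a) = (s.erase a).disjSum t := by
  ext (x | x) <;> simp

lemma erase_disjSum_inr {α β : Type*} [DecidableEq α] [DecidableEq β] (s : Finset α)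
    (t : Finset β) (a : β) : (s.disjSum t).erase (.inr a) = s.disjSum (t.erase a) := by
  ext (x | x) <;> simp

/-- The difference of the sums of all poles and of all zeros. -/
def balance : ℂ :=
  (S.rho + 1) * (b + b') / 2 + S.omegaSum - ∑ ν, h ν - 2 * ∑ j, d j

lemma sum_pole_sub_sum_zero :
    ∑ i ∈ S.poleSet (J := J), S.pole X c b b' i - ∑ i, S.zero X c d h i =
      S.balance d b b' h := by
  simp only [poleSet, sum_disjSum, Fintype.sum_sum_type, pole, zero, Fintype.sum_prod_type,
    sum_signs, balance, omegaSum]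
  simp only [add_div, sum_add_distrib, sum_const, card_range, nsmul_eq_mul, ← sum_div, sg_one,
    sg_neg_one, one_mul, neg_one_mul, sum_neg_distrib]
  push_cast
  ring

/-- For variables outside `P`, `2c = b - d` means that the argument is symmetric about the half
period, so that `prod_signs_half_omega` collapses their factors. -/
lemma prod_div_eq_halfPeriodTerm (P : J → Prop) [DecidablePred P]
    (hP : ∀ j, ¬ P j → 2 * c j = b - d j) {ν : ℕ} (hν : ν ≤ S.rho)
    (hne : ∀ j (ε : ℤˣ), S.s ((S.omega ν + b) / 2 - (sg ε * X j + c j)) ≠ 0) :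
    ((∏ μ, S.s ((S.omega ν + b) / 2 - h μ)) *
      ∏ i, ∏ δ : ℤˣ, S.s ((S.omega ν + b) / 2 - (sg δ * X i + c i) - d i)) /
      ((∏ i, ∏ δ : ℤˣ, S.s ((S.omega ν + b) / 2 - (sg δ * X i + c i))) *
      ((∏ μ ∈ (range (S.rho + 1)).erase ν, S.s ((S.omega ν + b) / 2 - (S.omega μ + b) / 2)) *
      ∏ μ ∈ range (S.rho + 1), S.s ((S.omega ν + b) / 2 - (S.omega μ + b') / 2))) =
      S.halfPeriodTerm X c d b b' h P ν := by
  have h1 : ∏ μ ∈ (range (S.rho + 1)).erase ν, S.s ((S.omega ν + b) / 2 - (S.omega μ + b) / 2) =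
      ∏ μ ∈ (range (S.rho + 1)).erase ν, S.s ((S.omega ν - S.omega μ) / 2) :=
    prod_congr rfl fun μ _ => by congr 1; ring
  have h2 : ∏ μ ∈ range (S.rho + 1), S.s ((S.omega ν + b) / 2 - (S.omega μ + b') / 2) =
      ∏ μ ∈ range (S.rho + 1), S.s ((S.omega ν - S.omega μ + (b - b')) / 2) :=
    prod_congr rfl fun μ _ => by congr 1; ring
  rw [halfPeriodTerm, h1, h2, mul_comm (∏ i, ∏ δ : ℤˣ, S.s ((S.omega ν + b) / 2 -
    (sg δ * X i + c i))), mul_div_mul_comm, ← prod_div_distrib]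
  congr 1
  refine prod_congr rfl fun i _ => ?_
  rw [← prod_div_distrib]
  split
  · rfl
  · rename_i hi
    have e1 : ∀ δ : ℤˣ, (S.omega ν + b) / 2 - (sg δ * X i + c i) - d i =
        S.omega ν / 2 - d i / 2 - sg δ * X i := fun δ => by linear_combination (-1 / 2) * hP i hi
    have e2 : ∀ δ : ℤˣ, (S.omega ν + b) / 2 - (sg δ * X i + c i) =
        S.omega ν / 2 + d i / 2 - sg δ * X i := fun δ => by linear_combination (-1 / 2) * hP i hi
    rw [prod_congr rfl fun δ _ => by rw [e1 δ, e2 δ]]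
    exact S.prod_signs_half_omega hν _ _ fun δ => by rw [← e2]; exact hne i δ

/-- The conditions on `c, d, e` say that the two duplication factors at the pole `±X_j + c_j` are
`s(±2X_j - d_j)` and `s(±2X_j - e_j)`. The former cancels against a zero. The hypothesis `h2'` only
keeps these poles away from the half-period poles. -/
lemma source_identity_generic [DecidableEq J] (P : J → Prop) [DecidablePred P]
    (hP : ∀ j, P j → 2 * c j = b' - d j ∧ e j = b - 2 * c j)
    (hP' : ∀ j, ¬ P j → 2 * c j = b - d j ∧ e j = b' - 2 * c j)
    (h1 : ∀ j (ε : ℤˣ), S.s (sg ε * (2 * X j)) ≠ 0)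
    (h2 : ∀ j (ε : ℤˣ), S.s (sg ε * (2 * X j) - e j) ≠ 0)
    (h2' : ∀ j (ε : ℤˣ), S.s (sg ε * (2 * X j) - d j) ≠ 0)
    (h3 : ∀ j i, j ≠ i → ∀ ε δ : ℤˣ, S.s (sg ε * X j + c j - (sg δ * X i + c i)) ≠ 0)
    (h4 : ∀ ν ≤ S.rho, ∀ μ ≤ S.rho, S.s ((S.omega ν - S.omega μ + (b - b')) / 2) ≠ 0)
    (hbal : S.kind = .elliptic → S.balance d b b' h = 0) :
    ∑ j, ∑ ε : ℤˣ, S.s (d j) * S.sourceTerm X c d e h j ε -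
        S.prefactor * ∑ ν ∈ range (S.rho + 1), (S.halfPeriodTerm X c d b b' h P ν +
          S.halfPeriodTerm X c d b' b h (fun j => ¬ P j) ν) =
      -(S.prefactor * S.s (S.balance d b b' h)) := by
  have hK := S.prefactor_mul
  set K : ℂ := 2 / ∏ μ ∈ Icc 1 S.rho, S.s (-(S.omega μ / 2)) with hKdef
  have hK0 : K ≠ 0 := by rintro h0; rw [h0] at hK; norm_num at hK
  -- nonvanishing at the half periods
  have hdup : ∀ u, S.s (2 * u) ≠ 0 → ∀ ν ≤ S.rho, S.s (u - S.omega ν / 2) ≠ 0 := by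
    intro u hu ν hν h0
    have := S.prod_s_sub_half_omega u
    rw [prod_eq_zero (mem_range.2 (Nat.lt_succ_of_le hν)) h0, ← hKdef] at this
    exact div_ne_zero hu hK0 this.symm
  have hb : ∀ j (ε : ℤˣ), S.s (2 * (sg ε * X j + c j - b / 2)) *
      S.s (2 * (sg ε * X j + c j - b' / 2)) =
        S.s (sg ε * (2 * X j) - d j) * S.s (sg ε * (2 * X j) - e j) := by
    intro j ε
    by_cases hj : P j
    · obtain ⟨p1, p2⟩ := hP j hj
      rw [mul_comm]
      congr 2
      · linear_combination p1
      · linear_combination p2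
    · obtain ⟨p1, p2⟩ := hP' j hj
      congr 2
      · linear_combination p1
      · linear_combination p2
  have hb0 : ∀ j (ε : ℤˣ), S.s (2 * (sg ε * X j + c j - b / 2)) ≠ 0 ∧
      S.s (2 * (sg ε * X j + c j - b' / 2)) ≠ 0 := fun j ε =>
    mul_ne_zero_iff.1 (by rw [hb]; exact mul_ne_zero (h2' j ε) (h2 j ε))
  have hn1 : ∀ j (ε : ℤˣ), ∀ ν ≤ S.rho, S.s (sg ε * X j + c j - (S.omega ν + b) / 2) ≠ 0 :=
    fun j ε ν hν => by
      convert hdup _ (hb0 j ε).1 ν hν using 2; ring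
  have hn2 : ∀ j (ε : ℤˣ), ∀ ν ≤ S.rho, S.s (sg ε * X j + c j - (S.omega ν + b') / 2) ≠ 0 :=
    fun j ε ν hν => by
      convert hdup _ (hb0 j ε).2 ν hν using 2; ring
  have hswap : ∀ {x y : ℂ}, S.s (x - y) ≠ 0 → S.s (y - x) ≠ 0 := fun hxy => by
    rw [S.s_sub_comm]; exact neg_ne_zero.2 hxy
  have hpf := S.sum_prod_s_div _ (S.poleSet (J := J))
    ((univ : Finset (Fin (2 * S.rho + 2) ⊕ (J × ℤˣ))).val.map (S.zero X c d h))
    (S.pole X c b b') rfl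
    (by
      simp only [Multiset.card_map, card_val, card_univ, Fintype.card_sum, Fintype.card_fin,
        poleSet, card_disjSum, card_range]
      omega)
    (by
      rintro (⟨j, ε⟩ | ν | ν) hi (⟨i, δ⟩ | μ | μ) hj hij <;>
        simp [poleSet] at hi hj <;> simp only [pole]
      · by_cases hji : j = i
        · subst hji
          have : δ = -ε := by
            rw [← Int.units_ne_iff_eq_neg]; rintro rfl; exact hij rfl
          subst this
          convert h1 j ε using 2
          rw [sg_neg]; ring
        · exact h3 j i hji ε δ
      · exact hn1 j ε μ hj
      · exact hn2 j ε μ hj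
      · exact hswap (hn1 i δ ν hi)
      · have := S.s_half_omega_sub_ne_zero hi hj (by rintro rfl; exact hij rfl)
        convert this using 2; ring
      · convert h4 ν hi μ hj using 2; ring
      · exact hswap (hn2 i δ ν hi)
      · refine hswap ?_
        convert h4 μ hj ν hi using 2; ring
      · have := S.s_half_omega_sub_ne_zero hi hj (by rintro rfl; exact hij rfl)
        convert this using 2; ring)
    (fun hk => by
      have := hbal hk
      rw [← S.sum_pole_sub_sum_zero X c, sub_eq_zero] at this
      exact this)
  have hs : ((univ : Finset (Fin (2 * S.rho + 2) ⊕ (J × ℤˣ))).val.map (S.zero X c d h)).sum =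
    ∑ i, S.zero X c d h i := rfl
  rw [hs, sum_pole_sub_sum_zero] at hpf
  rw [← hpf]
  have hp : ∀ z, (((univ : Finset (Fin (2 * S.rho + 2) ⊕ (J × ℤˣ))).val.map
      (S.zero X c d h)).map fun b => S.s (z - b)).prod =
      (∏ ν, S.s (z - h ν)) * ∏ i, ∏ δ : ℤˣ, S.s (z - (sg δ * X i + c i) - d i) := by
    intro z
    rw [Multiset.map_map]
    change ∏ i, S.s (z - S.zero X c d h i) = _
    simp only [Fintype.prod_sum_type, Fintype.prod_prod_type, zero, sub_sub]
  simp only [hp]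
  simp only [poleSet, sum_disjSum, Fintype.sum_prod_type]
  simp only [erase_disjSum_inl, erase_disjSum_inr, prod_disjSum, prod_erase_prod_signs]
  simp only [pole, Fintype.prod_prod_type]
  -- The variable `j` itself contributes two zeros: the one with the same sign gives `s(-d_j)`, the
  -- one with the opposite sign gives `s(±2X_j - d_j)` and cancels a duplication factor.
  have hA : ∀ j (ε : ℤˣ), S.prefactor * (((∏ ν, S.s (sg ε * X j + c j - h ν)) *
      ∏ i, ∏ δ : ℤˣ, S.s (sg ε * X j + c j - (sg δ * X i + c i) - d i)) /
      ((S.s (sg ε * X j + c j - (sg (-ε) * X j + c j)) *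
        ∏ i ∈ univ.erase j, ∏ δ : ℤˣ, S.s (sg ε * X j + c j - (sg δ * X i + c i))) *
      ((∏ μ ∈ range (S.rho + 1), S.s (sg ε * X j + c j - (S.omega μ + b) / 2)) *
      ∏ μ ∈ range (S.rho + 1), S.s (sg ε * X j + c j - (S.omega μ + b') / 2)))) =
      -(S.s (d j) * S.sourceTerm X c d e h j ε) := by
    intro j ε
    rw [prod_congr rfl fun μ _ => show S.s (sg ε * X j + c j - (S.omega μ + b) / 2) =
        S.s (sg ε * X j + c j - b / 2 - S.omega μ / 2) by congr 1; ring,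
      prod_congr rfl fun μ _ => show S.s (sg ε * X j + c j - (S.omega μ + b') / 2) =
        S.s (sg ε * X j + c j - b' / 2 - S.omega μ / 2) by congr 1; ring,
      prod_s_sub_half_omega, prod_s_sub_half_omega, ← hKdef, div_mul_div_comm, hb,
      ← mul_prod_erase univ _ (mem_univ j),
      prod_signs' (fun δ => S.s (sg ε * X j + c j - (sg δ * X j + c j) - d j)) ε, sub_self, zero_sub,
      S.s_neg (d j), sourceTerm,
      show sg ε * X j + c j - (sg (-ε) * X j + c j) = sg ε * (2 * X j) by rw [sg_neg]; ring]
    simp only [prod_div_distrib]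
    have q1 := h1 j ε
    have q2 := h2 j ε
    have q3 := h2' j ε
    have q4 : ∏ i ∈ univ.erase j, ∏ δ : ℤˣ, S.s (sg ε * X j + c j - (sg δ * X i + c i)) ≠ 0 :=
      prod_ne_zero_iff.2 fun i hi => prod_ne_zero_iff.2 fun δ _ => h3 j i (ne_of_mem_erase hi).symm ε δ
    generalize S.s (sg ε * (2 * X j)) = u1 at *
    generalize S.s (sg ε * (2 * X j) - e j) = u2 at *
    generalize S.s (sg ε * (2 * X j) - d j) = u3 at *
    generalize ∏ i ∈ univ.erase j, ∏ δ : ℤˣ, S.s (sg ε * X j + c j - (sg δ * X i + c i)) = u4 at *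
    generalize S.s (d j) = u5
    generalize ∏ ν, S.s (sg ε * X j + c j - h ν) = u6
    generalize ∏ i ∈ univ.erase j, ∏ δ : ℤˣ, S.s (sg ε * X j + c j - (sg δ * X i + c i) - d i) = u7
    field_simp
    linear_combination (-u5 * u6 * u7) * hK
  have hB : ∀ ν ∈ range (S.rho + 1), ((∏ μ, S.s ((S.omega ν + b) / 2 - h μ)) *
      ∏ i, ∏ δ : ℤˣ, S.s ((S.omega ν + b) / 2 - (sg δ * X i + c i) - d i)) /
      ((∏ i, ∏ δ : ℤˣ, S.s ((S.omega ν + b) / 2 - (sg δ * X i + c i))) *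
      ((∏ μ ∈ (range (S.rho + 1)).erase ν, S.s ((S.omega ν + b) / 2 - (S.omega μ + b) / 2)) *
      ∏ μ ∈ range (S.rho + 1), S.s ((S.omega ν + b) / 2 - (S.omega μ + b') / 2))) =
      S.halfPeriodTerm X c d b b' h P ν := by
    intro ν hν
    exact S.prod_div_eq_halfPeriodTerm X c d b b' h P (fun j hj => (hP' j hj).1)
      (Nat.lt_succ_iff.1 (mem_range.1 hν))
      fun j ε => hswap (hn1 j ε ν (Nat.lt_succ_iff.1 (mem_range.1 hν)))
  have hB' : ∀ ν ∈ range (S.rho + 1), ((∏ μ, S.s ((S.omega ν + b') / 2 - h μ)) *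
      ∏ i, ∏ δ : ℤˣ, S.s ((S.omega ν + b') / 2 - (sg δ * X i + c i) - d i)) /
      ((∏ i, ∏ δ : ℤˣ, S.s ((S.omega ν + b') / 2 - (sg δ * X i + c i))) *
      ((∏ μ ∈ range (S.rho + 1), S.s ((S.omega ν + b') / 2 - (S.omega μ + b) / 2)) *
      ∏ μ ∈ (range (S.rho + 1)).erase ν, S.s ((S.omega ν + b') / 2 - (S.omega μ + b') / 2))) =
      S.halfPeriodTerm X c d b' b h (fun j => ¬ P j) ν := by
    intro ν hν
    rw [mul_comm (∏ μ ∈ range (S.rho + 1), _)]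
    exact S.prod_div_eq_halfPeriodTerm X c d b' b h (fun j => ¬ P j)
      (fun j hj => (hP j (not_not.1 hj)).1) (Nat.lt_succ_iff.1 (mem_range.1 hν))
      fun j ε => hswap (hn2 j ε ν (Nat.lt_succ_iff.1 (mem_range.1 hν)))
  rw [sum_congr rfl hB, sum_congr rfl hB', mul_add, mul_sum]
  simp only [mul_sum, hA, sum_neg_distrib, mul_add, sum_add_distrib]
  ring

open Filter Topology in
-- The factors `s(±2X_j - d_j)` no longer occur in the final formula, so their zeros are removable:
-- all variables are translated by a common small `t ≠ 0`, and then `t → 0`.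
lemma source_identity [DecidableEq J] (P : J → Prop) [DecidablePred P]
    (hP : ∀ j, P j → 2 * c j = b' - d j ∧ e j = b - 2 * c j)
    (hP' : ∀ j, ¬ P j → 2 * c j = b - d j ∧ e j = b' - 2 * c j)
    (h1 : ∀ j (ε : ℤˣ), S.s (sg ε * (2 * X j)) ≠ 0)
    (h2 : ∀ j (ε : ℤˣ), S.s (sg ε * (2 * X j) - e j) ≠ 0)
    (h3 : ∀ j i, j ≠ i → ∀ ε δ : ℤˣ, S.s (sg ε * X j + c j - (sg δ * X i + c i)) ≠ 0)
    (h4 : ∀ ν ≤ S.rho, ∀ μ ≤ S.rho, S.s ((S.omega ν - S.omega μ + (b - b')) / 2) ≠ 0)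
    (hbal : S.kind = .elliptic → S.balance d b b' h = 0) :
    ∑ j, ∑ ε : ℤˣ, S.s (d j) * S.sourceTerm X c d e h j ε -
        S.prefactor * ∑ ν ∈ range (S.rho + 1), (S.halfPeriodTerm X c d b b' h P ν +
          S.halfPeriodTerm X c d b' b h (fun j => ¬ P j) ν) =
      -(S.prefactor * S.s (S.balance d b b' h)) := by
  have hc := S.continuous_s
  have hdup : ∀ u, S.s (2 * u) ≠ 0 → ∀ ν ≤ S.rho, S.s (u - S.omega ν / 2) ≠ 0 := by
    intro u hu ν hν h0
    have := S.s_two_mul u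
    rw [prod_eq_zero (mem_range.2 (Nat.lt_succ_of_le hν)) h0, mul_zero, mul_eq_zero] at this
    refine this.elim hu (prod_ne_zero_iff.2 fun μ hμ => ?_)
    rw [mem_Icc] at hμ
    rw [s_neg]
    exact neg_ne_zero.2 (S.s_half_omega_ne_zero hμ.2 (by omega))
  -- continuity of the terms in a common translation of all variables
  have hterm : ∀ j (ε : ℤˣ), ContinuousAt
      (fun t : ℂ => S.sourceTerm (fun j => X j + t) c d e h j ε) 0 := by
    intro j ε
    refine ContinuousAt.mul (ContinuousAt.div (by fun_prop) (by fun_prop) ?_) ?_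
    · simp only [add_zero]; exact mul_ne_zero (h1 j ε) (h2 j ε)
    · refine tendsto_finsetProd _ fun i hi => tendsto_finsetProd _ fun δ _ => ?_
      refine ContinuousAt.div (by fun_prop) (by fun_prop) ?_
      simp only [add_zero]
      exact h3 j i (ne_of_mem_erase hi).symm ε δ
  have hhalf : ∀ (b b' : ℂ) (Q : J → Prop) [DecidablePred Q], (∀ j, Q j → e j = b - 2 * c j) →
      ∀ ν ∈ range (S.rho + 1), ContinuousAt
      (fun t : ℂ => S.halfPeriodTerm (fun j => X j + t) c d b b' h Q ν) 0 := by
    intro b b' Q _ hQ ν hν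
    refine ContinuousAt.mul continuousAt_const ?_
    refine tendsto_finsetProd _ fun i _ => ?_
    by_cases hi : Q i
    · simp only [hi, if_true]
      refine tendsto_finsetProd _ fun δ _ => ?_
      refine ContinuousAt.div (by fun_prop) (by fun_prop) ?_
      simp only [add_zero]
      rw [S.s_sub_comm, neg_ne_zero]
      have := hdup (sg δ * X i + c i - b / 2) (by
        convert h2 i δ using 2
        rw [hQ i hi]; ring) ν (Nat.lt_succ_iff.1 (mem_range.1 hν))
      convert this using 2; ring
    · simp only [hi, if_false]
      exact tendsto_const_nhds
  set L : ℂ → ℂ := fun t => ∑ j, ∑ ε : ℤˣ, S.s (d j) * S.sourceTerm (fun j => X j + t) c d e h j ε -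
        S.prefactor * ∑ ν ∈ range (S.rho + 1),
          (S.halfPeriodTerm (fun j => X j + t) c d b b' h P ν +
          S.halfPeriodTerm (fun j => X j + t) c d b' b h (fun j => ¬ P j) ν) with hL
  have hcont : ContinuousAt L 0 := by
    refine ContinuousAt.sub (tendsto_finsetSum _ fun j _ => tendsto_finsetSum _ fun ε _ =>
      continuousAt_const.mul (hterm j ε)) (continuousAt_const.mul
        (tendsto_finsetSum _ fun ν hν => ContinuousAt.add
          (hhalf b b' P (fun j hj => (hP j hj).2) ν hν)
          (hhalf b' b (fun j => ¬ P j) (fun j hj => (hP' j hj).2) ν hν)))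
  have hne : ∀ {f : ℂ → ℂ}, Continuous f → S.s (f 0) ≠ 0 → ∀ᶠ t in 𝓝[≠] (0 : ℂ), S.s (f t) ≠ 0 :=
    fun hf h0 => ((hc.comp hf).continuousAt.eventually_ne h0).filter_mono nhdsWithin_le_nhds
  have hev : ∀ᶠ t in 𝓝[≠] (0 : ℂ), L t = -(S.prefactor * S.s (S.balance d b b' h)) := by
    have g1 : ∀ᶠ t in 𝓝[≠] (0 : ℂ), ∀ j (ε : ℤˣ), S.s (sg ε * (2 * (X j + t))) ≠ 0 :=
      eventually_all.2 fun j => eventually_all.2 fun ε =>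
        hne (f := fun t => sg ε * (2 * (X j + t))) (by fun_prop) (by simpa using h1 j ε)
    have g2 : ∀ᶠ t in 𝓝[≠] (0 : ℂ), ∀ j (ε : ℤˣ), S.s (sg ε * (2 * (X j + t)) - e j) ≠ 0 :=
      eventually_all.2 fun j => eventually_all.2 fun ε =>
        hne (f := fun t => sg ε * (2 * (X j + t)) - e j) (by fun_prop) (by simpa using h2 j ε)
    -- No value at `t = 0` is available here; the argument moves with slope `±2`, and the zeros of
    -- `s` are isolated.
    have g2' : ∀ᶠ t in 𝓝[≠] (0 : ℂ), ∀ j (ε : ℤˣ), S.s (sg ε * (2 * (X j + t)) - d j) ≠ 0 :=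
      eventually_all.2 fun j => eventually_all.2 fun ε => by
        have hm : sg ε * 2 ≠ 0 := mul_ne_zero (fun h0 => by
          have := sg_mul_self ε
          rw [h0] at this; norm_num at this) two_ne_zero
        refine (S.eventually_s_affine_ne_zero hm (sg ε * (2 * X j) - d j) 0).mono fun t ht => ?_
        convert ht using 2; ring
    have g3 : ∀ᶠ t in 𝓝[≠] (0 : ℂ), ∀ j i, j ≠ i → ∀ ε δ : ℤˣ,
        S.s (sg ε * (X j + t) + c j - (sg δ * (X i + t) + c i)) ≠ 0 :=
      eventually_all.2 fun j => eventually_all.2 fun i => by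
        by_cases hji : j = i
        · exact Eventually.of_forall fun t hh => absurd hji hh
        · refine Eventually.mono ?_ fun t ht _ => ht
          exact eventually_all.2 fun ε => eventually_all.2 fun δ =>
            hne (f := fun t => sg ε * (X j + t) + c j - (sg δ * (X i + t) + c i)) (by fun_prop)
              (by simpa using h3 j i hji ε δ)
    filter_upwards [g1, g2, g2', g3] with t t1 t2 t2' t3
    exact S.source_identity_generic (fun j => X j + t) c d e b b' h P hP hP' t1 t2 t2' t3 h4 hbal
  have h0 := tendsto_nhds_unique_of_eventuallyEq (hcont.mono_left nhdsWithin_le_nhds)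
    tendsto_const_nhds hev
  simpa [hL] using h0

end Source
end Setting

/-! ### Sign and reflection rules for products of `s` -/

namespace Setting

variable (S : Setting)

lemma prod_s_neg (f : Fin (2 * S.rho + 2) → ℂ) : ∏ ν, S.s (-f ν) = ∏ ν, S.s (f ν) := by
  simp only [s_neg, prod_neg, card_univ, Fintype.card_fin]
  rw [Even.neg_one_pow ⟨S.rho + 1, by ring⟩, one_mul]

/-- For `ε = 1` the two factors are interchanged; for `ε = -1` the oddness of `s` cancels in each
quotient. -/
lemma prod_signs_div (X Y u v : ℂ) (ε : ℤˣ) :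
    ∏ δ : ℤˣ, S.s (sg ε * X - sg δ * Y - u) / S.s (sg ε * X - sg δ * Y - v) =
      ∏ δ : ℤˣ, S.s (X + sg δ * Y - sg ε * u) / S.s (X + sg δ * Y - sg ε * v) := by
  rw [prod_signs, prod_signs]
  rcases Int.units_eq_one_or ε with rfl | rfl <;> simp only [sg_one, sg_neg_one]
  · rw [mul_comm]
    congr 3 <;> ring
  · have : ∀ w, S.s (-1 * X - 1 * Y - w) = -S.s (X + 1 * Y - -1 * w) ∧
        S.s (-1 * X - -1 * Y - w) = -S.s (X + -1 * Y - -1 * w) := fun w => by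
      constructor <;> rw [← s_neg] <;> congr 1 <;> ring
    simp only [this, neg_div_neg_eq]

lemma s_signs_ne_zero {X Y w : ℂ} (H : ∀ ε δ : ℤˣ, S.s (X + sg δ * Y + sg ε * w) ≠ 0) (ε δ : ℤˣ) :
    S.s (sg ε * X - sg δ * Y + w) ≠ 0 ∧ S.s (sg ε * X - sg δ * Y - w) ≠ 0 ∧
      S.s (sg δ * Y - sg ε * X + w) ≠ 0 ∧ S.s (sg δ * Y - sg ε * X - w) ≠ 0 := by
  have key : ∀ ε δ η : ℤˣ, S.s (sg ε * X - sg δ * Y + sg η * w) ≠ 0 := by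
    intro ε δ η
    have h := H (ε * η) (-(ε * δ))
    rcases Int.units_eq_one_or ε with rfl | rfl
    · convert h using 2
      simp only [sg_mul, sg_neg, sg_one]; ring
    · rw [← neg_ne_zero, ← s_neg]
      convert h using 2
      simp only [sg_mul, sg_neg, sg_one]; ring
  refine ⟨?_, ?_, ?_, ?_⟩
  · simpa [sg_one] using key ε δ 1
  · simpa [sg_neg_one, ← sub_eq_add_neg] using key ε δ (-1)
  · rw [← neg_ne_zero, ← s_neg]
    convert key ε δ (-1) using 2
    rw [sg_neg_one]; ring
  · rw [← neg_ne_zero, ← s_neg]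
    convert key ε δ 1 using 2
    rw [sg_one]; ring

lemma s_signs_ne_zero' {X Y : ℂ} (H : ∀ δ : ℤˣ, S.s (X + sg δ * Y) ≠ 0) (ε δ : ℤˣ) :
    S.s (sg ε * X - sg δ * Y) ≠ 0 ∧ S.s (sg δ * Y - sg ε * X) ≠ 0 := by
  have := S.s_signs_ne_zero (X := X) (Y := Y) (w := 0) (by simpa using H) ε δ
  simp only [add_zero] at this
  exact ⟨this.1, this.2.2.1⟩

end Setting

/-! ### Residues at the variables as coefficients times cross ratios -/

section Ratio

variable (S : Setting) {N Nt M Mt : ℕ} (lam β : ℂ)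

/-- The quotient of the cross factors at the shifted and at the original point. -/
def crossRatio (ε : ℤˣ) : Fin N ⊕ Fin Nt → Config N Nt → Config M Mt → ℂ
  | .inl j, (x, _), (y, yt) => ∏ δ : ℤˣ,
      ((∏ k, S.s (x j + sg δ * y k - sg ε * (I * (1 - lam) * β / 2)) /
          S.s (x j + sg δ * y k - sg ε * (I * (1 + lam) * β / 2))) *
        ∏ k, S.s (x j + sg δ * yt k - sg ε * (I * β)) / S.s (x j + sg δ * yt k))
  | .inr j, (_, xt), (y, yt) => ∏ δ : ℤˣ,
      ((∏ k, S.s (xt j + sg δ * yt k - sg ε * (I * (1 - lam) * β / 2)) /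
          S.s (xt j + sg δ * yt k + sg ε * (I * (1 + lam) * β / 2))) *
        ∏ k, S.s (xt j + sg δ * y k + sg ε * (I * lam * β)) / S.s (xt j + sg δ * y k))

/-- `s` does not vanish in the denominators of `crossRatio`. -/
structure CrossNonzero (p : Config N Nt) (q : Config M Mt) : Prop where
  xy : ∀ (ε δ : ℤˣ) j k, S.s (p.1 j + sg δ * q.1 k + sg ε * (I * (1 + lam) * β / 2)) ≠ 0
  xyt : ∀ (δ : ℤˣ) j k, S.s (p.1 j + sg δ * q.2 k) ≠ 0
  xty : ∀ (δ : ℤˣ) j k, S.s (p.2 j + sg δ * q.1 k) ≠ 0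
  xtyt : ∀ (ε δ : ℤˣ) j k, S.s (p.2 j + sg δ * q.2 k + sg ε * (I * (1 + lam) * β / 2)) ≠ 0

/-- All variables of the kernel function. -/
def allVars (p : Config N Nt) (q : Config M Mt) : (Fin N ⊕ Fin Nt) ⊕ (Fin M ⊕ Fin Mt) → ℂ :=
  Sum.elim (Sum.elim p.1 p.2) (Sum.elim q.1 q.2)

/-- A function on the variables which depends only on their species. -/
def species (u₁ u₂ u₃ u₄ : ℂ) : (Fin N ⊕ Fin Nt) ⊕ (Fin M ⊕ Fin Mt) → ℂ :=
  Sum.elim (Sum.elim (fun _ => u₁) (fun _ => u₂)) (Sum.elim (fun _ => u₃) (fun _ => u₄))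

variable (N Nt M Mt) in
/-- The shifts `c_J`. -/
def offset : (Fin N ⊕ Fin Nt) ⊕ (Fin M ⊕ Fin Mt) → ℂ :=
  species 0 (I * (1 + lam) * β / 2) (I * (1 + lam) * β / 2) 0

variable (N Nt M Mt) in
/-- The steps `d_J`. -/
def step : (Fin N ⊕ Fin Nt) ⊕ (Fin M ⊕ Fin Mt) → ℂ :=
  species (I * lam * β) (-(I * β)) (-(I * lam * β)) (I * β)

variable (N Nt M Mt) in
/-- The shifts in the double-angle factors of the coefficients. -/
def doubleStep : (Fin N ⊕ Fin Nt) ⊕ (Fin M ⊕ Fin Mt) → ℂ :=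
  species (I * β) (-(I * lam * β)) (-(I * β)) (I * lam * β)

variable (g : Fin (2 * S.rho + 2) → ℂ)

lemma erase_univ_inl {α γ : Type*} [Fintype α] [Fintype γ] [DecidableEq α] [DecidableEq γ] (a : α) :
    (univ : Finset (α ⊕ γ)).erase (.inl a) = (univ.erase a).disjSum univ := by
  rw [← univ_disjSum_univ, Setting.erase_disjSum_inl]

lemma erase_univ_inr {α γ : Type*} [Fintype α] [Fintype γ] [DecidableEq α] [DecidableEq γ] (a : γ) :
    (univ : Finset (α ⊕ γ)).erase (.inr a) = univ.disjSum (univ.erase a) := by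
  rw [← univ_disjSum_univ, Setting.erase_disjSum_inr]

/-- Brings the contribution of one species to a residue into the shape used in `coeff` and
`crossRatio`. Only the differences of offsets and the step of that species enter. -/
lemma prod_pair_eq {κ : Type*} (s : Finset κ) (X c : ℂ) (Y c' d : κ → ℂ) (ε : ℤˣ) (u v : κ → ℤˣ → ℂ)
    (hu : ∀ i ∈ s, ∀ δ, u i δ = X + sg δ * Y i - sg ε * (c' i + d i - c))
    (hv : ∀ i ∈ s, ∀ δ, v i δ = X + sg δ * Y i - sg ε * (c' i - c)) :
    ∏ i ∈ s, ∏ δ : ℤˣ, S.s (sg ε * X + c - (sg δ * Y i + c' i) - d i) /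
      S.s (sg ε * X + c - (sg δ * Y i + c' i)) = ∏ δ : ℤˣ, ∏ i ∈ s, S.s (u i δ) / S.s (v i δ) := by
  rw [prod_comm (s := univ)]
  refine prod_congr rfl fun i hi => ?_
  have := S.prod_signs_div X (Y i) (c' i + d i - c) (c' i - c) ε
  calc _ = ∏ δ : ℤˣ, S.s (sg ε * X - sg δ * Y i - (c' i + d i - c)) /
      S.s (sg ε * X - sg δ * Y i - (c' i - c)) := prod_congr rfl fun δ _ => by
        congr 2 <;> ring
    _ = _ := this
    _ = _ := prod_congr rfl fun δ _ => by rw [hu i hi, hv i hi]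

lemma sourceTerm_x (p : Config N Nt) (q : Config M Mt) (ε : ℤˣ) (j : Fin N) :
    S.sourceTerm (allVars p q) (offset N Nt M Mt lam β) (step N Nt M Mt lam β)
      (doubleStep N Nt M Mt lam β) (fun ν => I * g ν * β) (.inl (.inl j)) ε =
      coeff S g lam β ε (.inl j) p * crossRatio S lam β ε (.inl j) p q := by
  obtain ⟨x, xt⟩ := p
  obtain ⟨y, yt⟩ := q
  rw [Setting.sourceTerm, erase_univ_inl, erase_univ_inl, prod_disjSum, prod_disjSum,
    ← univ_disjSum_univ, prod_disjSum]
  simp only [allVars, offset, step, doubleStep, species, Sum.elim_inl, Sum.elim_inr, coeff,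
    crossRatio, prod_mul_distrib]
  rw [prod_pair_eq S _ (x j) 0 x (fun _ => 0) (fun _ => I * lam * β) ε
      (fun i δ => x j + sg δ * x i - sg ε * I * lam * β) (fun i δ => x j + sg δ * x i)
      (fun _ _ _ => by ring) (fun _ _ _ => by ring),
    prod_pair_eq S _ (x j) 0 xt (fun _ => I * (1 + lam) * β / 2) (fun _ => -(I * β)) ε
      (fun i δ => x j + sg δ * xt i - sg ε * I * (lam - 1) * β / 2)
      (fun i δ => x j + sg δ * xt i - sg ε * I * (lam + 1) * β / 2)
      (fun _ _ _ => by ring) (fun _ _ _ => by ring),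
    prod_pair_eq S _ (x j) 0 y (fun _ => I * (1 + lam) * β / 2) (fun _ => -(I * lam * β)) ε
      (fun i δ => x j + sg δ * y i - sg ε * (I * (1 - lam) * β / 2))
      (fun i δ => x j + sg δ * y i - sg ε * (I * (1 + lam) * β / 2))
      (fun _ _ _ => by ring) (fun _ _ _ => by ring),
    prod_pair_eq S _ (x j) 0 yt (fun _ => 0) (fun _ => I * β) ε
      (fun i δ => x j + sg δ * yt i - sg ε * (I * β)) (fun i δ => x j + sg δ * yt i)
      (fun _ _ _ => by ring) (fun _ _ _ => by ring)]
  simp only [add_zero]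
  ring

lemma sourceTerm_xt (p : Config N Nt) (q : Config M Mt) (ε : ℤˣ) (j : Fin Nt) :
    S.sourceTerm (allVars p q) (offset N Nt M Mt lam β) (step N Nt M Mt lam β)
      (doubleStep N Nt M Mt lam β) (fun ν => I * g ν * β) (.inl (.inr j)) ε =
      coeff S g lam β ε (.inr j) p * crossRatio S lam β ε (.inr j) p q := by
  obtain ⟨x, xt⟩ := p
  obtain ⟨y, yt⟩ := q
  rw [Setting.sourceTerm, erase_univ_inl, erase_univ_inr, prod_disjSum, prod_disjSum,
    ← univ_disjSum_univ, prod_disjSum]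
  simp only [allVars, offset, step, doubleStep, species, Sum.elim_inl, Sum.elim_inr, coeff,
    crossRatio, prod_mul_distrib]
  rw [prod_pair_eq S _ (xt j) (I * (1 + lam) * β / 2) x (fun _ => 0) (fun _ => I * lam * β) ε
      (fun i δ => xt j + sg δ * x i - sg ε * I * (lam - 1) * β / 2)
      (fun i δ => xt j + sg δ * x i + sg ε * I * (lam + 1) * β / 2)
      (fun _ _ _ => by ring) (fun _ _ _ => by ring),
    prod_pair_eq S _ (xt j) (I * (1 + lam) * β / 2) xt (fun _ => I * (1 + lam) * β / 2)
      (fun _ => -(I * β)) ε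
      (fun i δ => xt j + sg δ * xt i + sg ε * I * β)
      (fun i δ => xt j + sg δ * xt i)
      (fun _ _ _ => by ring) (fun _ _ _ => by ring),
    prod_pair_eq S _ (xt j) (I * (1 + lam) * β / 2) y (fun _ => I * (1 + lam) * β / 2)
      (fun _ => -(I * lam * β)) ε
      (fun i δ => xt j + sg δ * y i + sg ε * (I * lam * β))
      (fun i δ => xt j + sg δ * y i)
      (fun _ _ _ => by ring) (fun _ _ _ => by ring),
    prod_pair_eq S _ (xt j) (I * (1 + lam) * β / 2) yt (fun _ => 0) (fun _ => I * β) ε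
      (fun i δ => xt j + sg δ * yt i - sg ε * (I * (1 - lam) * β / 2))
      (fun i δ => xt j + sg δ * yt i + sg ε * (I * (1 + lam) * β / 2))
      (fun _ _ _ => by ring) (fun _ _ _ => by ring)]
  rw [prod_congr rfl fun ν _ => show S.s (sg ε * xt j + I * (1 + lam) * β / 2 - I * g ν * β) =
    S.s (sg ε * xt j - I * (g ν - (lam + 1) / 2) * β) by congr 1; ring]
  simp only [sub_neg_eq_add]
  ring

/-- Reflecting the arguments exchanges `ε` with `-ε` and, together with the offset `i(1+λ)β/2`,
turns `g` into `gTilde`. No sign survives, since the number of single-variable factors is even and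
there are two double-angle factors. -/
lemma sourceTerm_y (p : Config N Nt) (q : Config M Mt) (ε : ℤˣ) (j : Fin M) :
    S.sourceTerm (allVars p q) (offset N Nt M Mt lam β) (step N Nt M Mt lam β)
      (doubleStep N Nt M Mt lam β) (fun ν => I * g ν * β) (.inr (.inl j)) ε =
      coeff S (gTilde S lam g) lam β (-ε) (.inl j) q * crossRatio S lam β (-ε) (.inl j) q p := by
  obtain ⟨x, xt⟩ := p
  obtain ⟨y, yt⟩ := q
  rw [Setting.sourceTerm, erase_univ_inr, erase_univ_inl, prod_disjSum, prod_disjSum,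
    ← univ_disjSum_univ, prod_disjSum]
  simp only [allVars, offset, step, doubleStep, species, Sum.elim_inl, Sum.elim_inr, coeff,
    crossRatio, prod_mul_distrib, sg_neg, gTilde]
  rw [prod_pair_eq S _ (y j) (I * (1 + lam) * β / 2) x (fun _ => 0) (fun _ => I * lam * β) ε
      (fun i δ => y j + sg δ * x i - -sg ε * (I * (1 - lam) * β / 2))
      (fun i δ => y j + sg δ * x i - -sg ε * (I * (1 + lam) * β / 2))
      (fun _ _ _ => by ring) (fun _ _ _ => by ring),
    prod_pair_eq S _ (y j) (I * (1 + lam) * β / 2) xt (fun _ => I * (1 + lam) * β / 2)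
      (fun _ => -(I * β)) ε
      (fun i δ => y j + sg δ * xt i - -sg ε * (I * β))
      (fun i δ => y j + sg δ * xt i)
      (fun _ _ _ => by ring) (fun _ _ _ => by ring),
    prod_pair_eq S _ (y j) (I * (1 + lam) * β / 2) y (fun _ => I * (1 + lam) * β / 2)
      (fun _ => -(I * lam * β)) ε
      (fun i δ => y j + sg δ * y i - -sg ε * I * lam * β)
      (fun i δ => y j + sg δ * y i)
      (fun _ _ _ => by ring) (fun _ _ _ => by ring),
    prod_pair_eq S _ (y j) (I * (1 + lam) * β / 2) yt (fun _ => 0) (fun _ => I * β) ε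
      (fun i δ => y j + sg δ * yt i - -sg ε * I * (lam - 1) * β / 2)
      (fun i δ => y j + sg δ * yt i - -sg ε * I * (lam + 1) * β / 2)
      (fun _ _ _ => by ring) (fun _ _ _ => by ring)]
  rw [prod_congr rfl fun ν _ => show S.s (-sg ε * y j - I * ((lam + 1) / 2 - g ν) * β) =
      S.s (-(sg ε * y j + I * (1 + lam) * β / 2 - I * g ν * β)) by congr 1; ring,
    S.prod_s_neg fun ν => sg ε * y j + I * (1 + lam) * β / 2 - I * g ν * β,
    show -sg ε * (2 * y j) = -(sg ε * (2 * y j)) by ring,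
    show -(sg ε * (2 * y j)) - I * β = -(sg ε * (2 * y j) - -(I * β)) by ring, S.s_neg, S.s_neg]
  simp only [neg_mul_neg]
  ring

lemma sourceTerm_yt (p : Config N Nt) (q : Config M Mt) (ε : ℤˣ) (j : Fin Mt) :
    S.sourceTerm (allVars p q) (offset N Nt M Mt lam β) (step N Nt M Mt lam β)
      (doubleStep N Nt M Mt lam β) (fun ν => I * g ν * β) (.inr (.inr j)) ε =
      coeff S (gTilde S lam g) lam β (-ε) (.inr j) q * crossRatio S lam β (-ε) (.inr j) q p := by
  obtain ⟨x, xt⟩ := p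
  obtain ⟨y, yt⟩ := q
  rw [Setting.sourceTerm, erase_univ_inr, erase_univ_inr, prod_disjSum, prod_disjSum,
    ← univ_disjSum_univ, prod_disjSum]
  simp only [allVars, offset, step, doubleStep, species, Sum.elim_inl, Sum.elim_inr, coeff,
    crossRatio, prod_mul_distrib, sg_neg, gTilde]
  rw [prod_pair_eq S _ (yt j) 0 x (fun _ => 0) (fun _ => I * lam * β) ε
      (fun i δ => yt j + sg δ * x i + -sg ε * (I * lam * β))
      (fun i δ => yt j + sg δ * x i)
      (fun _ _ _ => by ring) (fun _ _ _ => by ring),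
    prod_pair_eq S _ (yt j) 0 xt (fun _ => I * (1 + lam) * β / 2)
      (fun _ => -(I * β)) ε
      (fun i δ => yt j + sg δ * xt i - -sg ε * (I * (1 - lam) * β / 2))
      (fun i δ => yt j + sg δ * xt i + -sg ε * (I * (1 + lam) * β / 2))
      (fun _ _ _ => by ring) (fun _ _ _ => by ring),
    prod_pair_eq S _ (yt j) 0 y (fun _ => I * (1 + lam) * β / 2)
      (fun _ => -(I * lam * β)) ε
      (fun i δ => yt j + sg δ * y i - -sg ε * I * (lam - 1) * β / 2)
      (fun i δ => yt j + sg δ * y i + -sg ε * I * (lam + 1) * β / 2)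
      (fun _ _ _ => by ring) (fun _ _ _ => by ring),
    prod_pair_eq S _ (yt j) 0 yt (fun _ => 0) (fun _ => I * β) ε
      (fun i δ => yt j + sg δ * yt i + -sg ε * I * β)
      (fun i δ => yt j + sg δ * yt i)
      (fun _ _ _ => by ring) (fun _ _ _ => by ring)]
  rw [prod_congr rfl fun ν _ => show S.s (-sg ε * yt j - I * ((lam + 1) / 2 - g ν - (lam + 1) / 2) * β) =
      S.s (-(sg ε * yt j + 0 - I * g ν * β)) by congr 1; ring,
    S.prod_s_neg fun ν => sg ε * yt j + 0 - I * g ν * β,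
    show -sg ε * (2 * yt j) = -(sg ε * (2 * yt j)) by ring,
    show -(sg ε * (2 * yt j)) + I * lam * β = -(sg ε * (2 * yt j) - (I * lam * β)) by ring, S.s_neg,
    S.s_neg]
  simp only [neg_mul_neg]
  ring

end Ratio

/-! ### Residues at the half periods and the functional identity -/

section HalfPeriod

variable (S : Setting)

namespace Setting

lemma s_half_omega_sub {ν : ℕ} (hν : ν ≤ S.rho) (z : ℂ) :
    S.s (S.omega ν / 2 - z) =
      -sigma ν * exp (-2 * I * S.r * xi ν * z) * S.s (S.omega ν / 2 + z) := by
  have := S.s_add_half_omega hν (-z)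
  rw [show -z + S.omega ν / 2 = S.omega ν / 2 - z by ring,
    show -z - S.omega ν / 2 = -(S.omega ν / 2 + z) by ring, s_neg,
    show 2 * I * S.r * xi ν * -z = -2 * I * S.r * xi ν * z by ring] at this
  rw [this]; ring

lemma sigma_ne_zero (ν : ℕ) : sigma ν ≠ 0 := by
  unfold sigma; split <;> norm_num

/-- Reflection of a quotient at a half period. -/
lemma s_half_omega_sub_div {ν : ℕ} (hν : ν ≤ S.rho) (z w : ℂ) :
    S.s (S.omega ν / 2 - z) / S.s (S.omega ν / 2 - w) =
      exp (-2 * I * S.r * xi ν * (z - w)) * (S.s (S.omega ν / 2 + z) / S.s (S.omega ν / 2 + w)) := by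
  have h1 := sigma_ne_zero ν
  have h2 := exp_ne_zero (-2 * I * S.r * xi ν * w)
  rw [S.s_half_omega_sub hν z, S.s_half_omega_sub hν w, mul_sub, exp_sub,
    mul_div_mul_comm, mul_div_mul_left _ _ (neg_ne_zero.2 h1)]

/-- Reflection of the product of the singly shifted factors at a half period. -/
lemma prod_s_half_omega_sub {ν : ℕ} (hν : ν ≤ S.rho) (f : Fin (2 * S.rho + 2) → ℂ) :
    ∏ μ, S.s (S.omega ν / 2 - f μ) =
      exp (-2 * I * S.r * xi ν * ∑ μ, f μ) * ∏ μ, S.s (S.omega ν / 2 + f μ) := by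
  have h : (-sigma ν) ^ (2 * S.rho + 2) = 1 := by
    rw [show 2 * S.rho + 2 = 2 * (S.rho + 1) by ring, pow_mul, neg_sq, sigma_sq, one_pow]
  rw [prod_congr rfl fun μ _ => S.s_half_omega_sub hν (f μ), prod_mul_distrib, prod_mul_distrib,
    prod_const, card_univ, Fintype.card_fin, h, one_mul, ← exp_sum, mul_sum]

/-- Reflection of the product over all half periods at a half period. -/
lemma prod_s_half_omega_sub_omega {ν : ℕ} (hν : ν ≤ S.rho) (u : ℂ) :
    ∏ μ ∈ range (S.rho + 1), S.s ((S.omega ν - S.omega μ - u) / 2) =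
      -exp (-4 * I * S.r * xi ν * u) *
        ∏ μ ∈ range (S.rho + 1), S.s ((S.omega ν - S.omega μ + u) / 2) := by
  -- By duplication both products reduce to `s(ω_ν ± u)` over the same constant, and both values are
  -- related to `s(u)` by a quasi-period.
  have e1 : ∀ v, ∏ μ ∈ range (S.rho + 1), S.s ((S.omega ν - S.omega μ + v) / 2) =
      S.s (S.omega ν + v) / (2 / ∏ μ ∈ Icc 1 S.rho, S.s (-(S.omega μ / 2))) := fun v => by
    rw [show S.omega ν + v = 2 * ((S.omega ν + v) / 2) by ring, ← prod_s_sub_half_omega]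
    exact prod_congr rfl fun μ _ => by congr 1; ring
  simp only [sub_eq_add_neg _ u]
  rw [e1, e1]
  have h1 := S.s_half_omega_sub hν (u - S.omega ν / 2)
  have h2 := S.s_add_half_omega hν (u + S.omega ν / 2)
  rw [show S.omega ν / 2 - (u - S.omega ν / 2) = S.omega ν + -u by ring,
    show S.omega ν / 2 + (u - S.omega ν / 2) = u by ring] at h1
  rw [show u + S.omega ν / 2 + S.omega ν / 2 = S.omega ν + u by ring,
    show u + S.omega ν / 2 - S.omega ν / 2 = u by ring] at h2
  rw [h1, h2, show -2 * I * S.r * xi ν * (u - S.omega ν / 2) =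
    -4 * I * S.r * xi ν * u + 2 * I * S.r * xi ν * (u + S.omega ν / 2) by ring, exp_add]
  ring

end Setting

variable {N Nt M Mt : ℕ} (lam β : ℂ) (g : Fin (2 * S.rho + 2) → ℂ)

/-- Only the elliptic case has nonzero `ξ_ν`, so exponents need to be compared only there, where the
balancing condition is available. -/
lemma exp_xi_eq {ν : ℕ} (hν : ν ≤ S.rho) {z w : ℂ} (h : S.kind = .elliptic → z = w) :
    exp (-2 * I * S.r * xi ν * z) = exp (-2 * I * S.r * xi ν * w) := by
  by_cases hk : S.kind = .elliptic
  · rw [h hk]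
  · rw [S.xi_eq_zero hk hν]; simp

lemma kind_elliptic_rho (h : S.kind = .elliptic) : S.rho = 3 := by
  unfold Setting.rho; rw [h]

/-- The summands of `V⁰`. -/
def potentialTerm (p : Config N Nt) (ν : ℕ) : ℂ :=
  exp (-S.r * xi ν *
        (2 * lam * N - 2 * Nt + (∑ μ, g μ) - (S.rho + 1) * (lam + 1) / 2) * β) /
      (∏ μ ∈ (range (S.rho + 1)).erase ν, S.s ((S.omega ν - S.omega μ) / 2)) *
    ((∏ μ, S.s (S.omega ν / 2 + I * β / 2 - I * g μ * β)) /
      (∏ μ ∈ range (S.rho + 1), S.s ((S.omega ν - S.omega μ + I * (1 - lam) * β) / 2))) *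
    ∏ δ : ℤˣ,
      ((∏ j, S.s (sg δ * p.1 j + S.omega ν / 2 + I * β / 2 - I * lam * β) /
          S.s (sg δ * p.1 j + S.omega ν / 2 + I * β / 2)) *
        ∏ k, S.s (sg δ * p.2 k + S.omega ν / 2 - I * lam * β / 2 + I * β) /
          S.s (sg δ * p.2 k + S.omega ν / 2 - I * lam * β / 2))

lemma potential_eq (p : Config N Nt) :
    potential S g lam β p =
      -S.prefactor * ∑ ν ∈ range (S.rho + 1), potentialTerm S lam β g p ν := rfl

lemma prod_signs_neg (f : ℂ → ℂ) : ∏ δ : ℤˣ, f (-sg δ) = ∏ δ : ℤˣ, f (sg δ) := by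
  rw [prod_signs, prod_signs, sg_one, sg_neg_one, neg_neg, mul_comm]

lemma halfPeriodTerm_left (p : Config N Nt) (q : Config M Mt) {ν : ℕ} (hν : ν ≤ S.rho)
    (hbal : S.kind = .elliptic →
      2 * lam * ((N : ℂ) - M - 1) - 2 * ((Nt : ℂ) - Mt + 1) + ∑ ν, g ν = 0) :
    S.halfPeriodTerm (allVars p q) (offset N Nt M Mt lam β) (step N Nt M Mt lam β) (I * β)
      (I * lam * β) (fun ν => I * g ν * β) (fun i => i.isLeft = true) ν =
      potentialTerm S lam β g p ν := by
  rw [Setting.halfPeriodTerm, potentialTerm]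
  simp only [Fintype.prod_sum_type, Sum.isLeft_inl, Sum.isLeft_inr, if_true, Bool.false_eq_true,
    if_false, allVars, offset, step, species, Sum.elim_inl, Sum.elim_inr, prod_const, card_univ,
    Fintype.card_fin, prod_mul_distrib]
  rw [prod_comm (s := (univ : Finset (Fin N))), prod_comm (s := (univ : Finset (Fin Nt)))]
  have e1 : ∏ δ : ℤˣ, ∏ j, S.s ((S.omega ν + I * β) / 2 - (sg δ * p.1 j + 0) - I * lam * β) /
      S.s ((S.omega ν + I * β) / 2 - (sg δ * p.1 j + 0)) =
      ∏ δ : ℤˣ, ∏ j, S.s (sg δ * p.1 j + S.omega ν / 2 + I * β / 2 - I * lam * β) /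
          S.s (sg δ * p.1 j + S.omega ν / 2 + I * β / 2) := by
    rw [← prod_signs_neg fun ε => ∏ j, S.s (ε * p.1 j + S.omega ν / 2 + I * β / 2 - I * lam * β) /
          S.s (ε * p.1 j + S.omega ν / 2 + I * β / 2)]
    exact prod_congr rfl fun δ _ => prod_congr rfl fun j _ => by congr 2 <;> ring
  have e2 : ∏ δ : ℤˣ, ∏ j, S.s ((S.omega ν + I * β) / 2 - (sg δ * p.2 j + I * (1 + lam) * β / 2) -
      -(I * β)) / S.s ((S.omega ν + I * β) / 2 - (sg δ * p.2 j + I * (1 + lam) * β / 2)) =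
      ∏ δ : ℤˣ, ∏ k, S.s (sg δ * p.2 k + S.omega ν / 2 - I * lam * β / 2 + I * β) /
          S.s (sg δ * p.2 k + S.omega ν / 2 - I * lam * β / 2) := by
    rw [← prod_signs_neg fun ε => ∏ k, S.s (ε * p.2 k + S.omega ν / 2 - I * lam * β / 2 + I * β) /
          S.s (ε * p.2 k + S.omega ν / 2 - I * lam * β / 2)]
    exact prod_congr rfl fun δ _ => prod_congr rfl fun j _ => by congr 2 <;> ring
  have e3 : ∏ μ, S.s ((S.omega ν + I * β) / 2 - I * g μ * β) =
      ∏ μ, S.s (S.omega ν / 2 + I * β / 2 - I * g μ * β) :=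
    prod_congr rfl fun μ _ => by congr 1; ring
  have e4 : ∏ μ ∈ range (S.rho + 1), S.s ((S.omega ν - S.omega μ + (I * β - I * lam * β)) / 2) =
      ∏ μ ∈ range (S.rho + 1), S.s ((S.omega ν - S.omega μ + I * (1 - lam) * β) / 2) :=
    prod_congr rfl fun μ _ => by congr 1; ring
  -- The left side collects the collapsed variables `y, ỹ` and depends on `M, M̃`; balancing
  -- rewrites it in terms of `N, Ñ` and `g`.
  have e5 : exp (-2 * I * S.r * xi ν * -(I * lam * β)) ^ M *
      exp (-2 * I * S.r * xi ν * (I * β)) ^ Mt = exp (-S.r * xi ν *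
        (2 * lam * N - 2 * Nt + (∑ μ, g μ) - (S.rho + 1) * (lam + 1) / 2) * β) := by
    rw [← exp_nat_mul, ← exp_nat_mul, ← exp_add,
      show -S.r * xi ν * (2 * lam * N - 2 * Nt + (∑ μ, g μ) - (S.rho + 1) * (lam + 1) / 2) * β =
        -2 * I * S.r * xi ν * (-I / 2 * (2 * lam * N - 2 * Nt + (∑ μ, g μ) -
          (S.rho + 1) * (lam + 1) / 2) * β) by
        linear_combination (-S.r * xi ν * (2 * lam * N - 2 * Nt + (∑ μ, g μ) -
          (S.rho + 1) * (lam + 1) / 2) * β) * I_sq,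
      show (M : ℂ) * (-2 * I * S.r * xi ν * -(I * lam * β)) + Mt * (-2 * I * S.r * xi ν * (I * β)) =
        -2 * I * S.r * xi ν * (I * β * (Mt - lam * M)) by ring]
    refine exp_xi_eq S hν fun hk => ?_
    have hb := hbal hk
    have hr : (S.rho : ℂ) = 3 := by exact_mod_cast kind_elliptic_rho S hk
    linear_combination (I * β / 2) * hb - I / 4 * (lam + 1) * β * hr
  rw [e1, e2, e3, e4, e5]
  ring

lemma halfPeriodTerm_right (p : Config N Nt) (q : Config M Mt) {ν : ℕ} (hν : ν ≤ S.rho)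
    (hbal : S.kind = .elliptic →
      2 * lam * ((N : ℂ) - M - 1) - 2 * ((Nt : ℂ) - Mt + 1) + ∑ ν, g ν = 0) :
    S.halfPeriodTerm (allVars p q) (offset N Nt M Mt lam β) (step N Nt M Mt lam β) (I * lam * β)
      (I * β) (fun ν => I * g ν * β) (fun i => ¬ i.isLeft = true) ν =
      -potentialTerm S lam β (gTilde S lam g) q ν := by
  rw [Setting.halfPeriodTerm, potentialTerm]
  simp only [Fintype.prod_sum_type, Sum.isLeft_inl, Sum.isLeft_inr, if_true, Bool.false_eq_true,
    if_false, allVars, offset, step, species, Sum.elim_inl, Sum.elim_inr, prod_const, card_univ,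
    Fintype.card_fin, prod_mul_distrib, not_true_eq_false, not_false_eq_true]
  rw [prod_comm (s := (univ : Finset (Fin M))), prod_comm (s := (univ : Finset (Fin Mt)))]
  have e1 : ∏ δ : ℤˣ, ∏ j, S.s ((S.omega ν + I * lam * β) / 2 -
      (sg δ * q.1 j + I * (1 + lam) * β / 2) - -(I * lam * β)) /
      S.s ((S.omega ν + I * lam * β) / 2 - (sg δ * q.1 j + I * (1 + lam) * β / 2)) =
      exp (-2 * I * S.r * xi ν * (-2 * M * (I * lam * β))) *
      ∏ δ : ℤˣ, ∏ j, S.s (sg δ * q.1 j + S.omega ν / 2 + I * β / 2 - I * lam * β) /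
          S.s (sg δ * q.1 j + S.omega ν / 2 + I * β / 2) := by
    have : ∀ (δ : ℤˣ) j, S.s ((S.omega ν + I * lam * β) / 2 -
      (sg δ * q.1 j + I * (1 + lam) * β / 2) - -(I * lam * β)) /
      S.s ((S.omega ν + I * lam * β) / 2 - (sg δ * q.1 j + I * (1 + lam) * β / 2)) =
      exp (-2 * I * S.r * xi ν * (-(I * lam * β))) *
        (S.s (sg δ * q.1 j + S.omega ν / 2 + I * β / 2 - I * lam * β) /
          S.s (sg δ * q.1 j + S.omega ν / 2 + I * β / 2)) := fun δ j => by
      have := S.s_half_omega_sub_div hν (sg δ * q.1 j + I * β / 2 - I * lam * β)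
        (sg δ * q.1 j + I * β / 2)
      convert this using 3 <;> ring_nf
    simp only [this, prod_mul_distrib, prod_const, card_univ, Fintype.card_fin, ← exp_nat_mul,
      Fintype.card_units_int]
    congr 2
    push_cast
    ring
  have e2 : ∏ δ : ℤˣ, ∏ j, S.s ((S.omega ν + I * lam * β) / 2 - (sg δ * q.2 j + 0) - I * β) /
      S.s ((S.omega ν + I * lam * β) / 2 - (sg δ * q.2 j + 0)) =
      exp (-2 * I * S.r * xi ν * (2 * Mt * (I * β))) *
      ∏ δ : ℤˣ, ∏ k, S.s (sg δ * q.2 k + S.omega ν / 2 - I * lam * β / 2 + I * β) /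
          S.s (sg δ * q.2 k + S.omega ν / 2 - I * lam * β / 2) := by
    have : ∀ (δ : ℤˣ) j, S.s ((S.omega ν + I * lam * β) / 2 - (sg δ * q.2 j + 0) - I * β) /
      S.s ((S.omega ν + I * lam * β) / 2 - (sg δ * q.2 j + 0)) =
      exp (-2 * I * S.r * xi ν * (I * β)) *
        (S.s (sg δ * q.2 j + S.omega ν / 2 - I * lam * β / 2 + I * β) /
          S.s (sg δ * q.2 j + S.omega ν / 2 - I * lam * β / 2)) := fun δ j => by
      have := S.s_half_omega_sub_div hν (sg δ * q.2 j - I * lam * β / 2 + I * β)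
        (sg δ * q.2 j - I * lam * β / 2)
      convert this using 3 <;> ring_nf
    simp only [this, prod_mul_distrib, prod_const, card_univ, Fintype.card_fin, ← exp_nat_mul,
      Fintype.card_units_int]
    congr 2
    push_cast
    ring
  have e3 : ∏ μ, S.s ((S.omega ν + I * lam * β) / 2 - I * g μ * β) =
      exp (-2 * I * S.r * xi ν * (I * β * ∑ μ, g μ - (S.rho + 1) * (I * lam * β))) *
      ∏ μ, S.s (S.omega ν / 2 + I * β / 2 - I * gTilde S lam g μ * β) := by
    have := S.prod_s_half_omega_sub hν fun μ => I * g μ * β - I * lam * β / 2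
    convert this using 1
    · exact prod_congr rfl fun μ _ => by congr 1; ring
    · congr 1
      · rw [sum_sub_distrib, sum_const, card_univ, Fintype.card_fin, nsmul_eq_mul, ← sum_mul, ← mul_sum]
        congr 2
        push_cast
        ring
      · exact prod_congr rfl fun μ _ => by rw [gTilde]; congr 1; ring
  -- Interchanging `b` and `b'` produces the minus sign with which the potential of `(y, ỹ)` enters.
  have e4 : ∏ μ ∈ range (S.rho + 1), S.s ((S.omega ν - S.omega μ + (I * lam * β - I * β)) / 2) =
      -exp (-2 * I * S.r * xi ν * (2 * (I * (1 - lam) * β))) *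
      ∏ μ ∈ range (S.rho + 1), S.s ((S.omega ν - S.omega μ + I * (1 - lam) * β) / 2) := by
    have := S.prod_s_half_omega_sub_omega hν (I * (1 - lam) * β)
    convert this using 1
    · exact prod_congr rfl fun μ _ => by congr 1; ring
    · congr 3; ring
  have e5 : exp (-2 * I * S.r * xi ν * (I * lam * β)) ^ N *
      exp (-2 * I * S.r * xi ν * -(I * β)) ^ Nt *
      exp (-2 * I * S.r * xi ν * (-2 * M * (I * lam * β))) *
      exp (-2 * I * S.r * xi ν * (2 * Mt * (I * β))) *
      exp (-2 * I * S.r * xi ν * (I * β * ∑ μ, g μ - (S.rho + 1) * (I * lam * β))) /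
      exp (-2 * I * S.r * xi ν * (2 * (I * (1 - lam) * β))) = exp (-S.r * xi ν *
        (2 * lam * M - 2 * Mt + (∑ μ, gTilde S lam g μ) - (S.rho + 1) * (lam + 1) / 2) * β) := by
    rw [← exp_nat_mul, ← exp_nat_mul, ← exp_add, ← exp_add, ← exp_add, ← exp_add, ← exp_sub,
      show -S.r * xi ν * (2 * lam * M - 2 * Mt + (∑ μ, gTilde S lam g μ) -
          (S.rho + 1) * (lam + 1) / 2) * β =
        -2 * I * S.r * xi ν * (-I / 2 * (2 * lam * M - 2 * Mt + (∑ μ, gTilde S lam g μ) -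
          (S.rho + 1) * (lam + 1) / 2) * β) by
        linear_combination (-S.r * xi ν * (2 * lam * M - 2 * Mt + (∑ μ, gTilde S lam g μ) -
          (S.rho + 1) * (lam + 1) / 2) * β) * I_sq,
      show (N : ℂ) * (-2 * I * S.r * xi ν * (I * lam * β)) +
          Nt * (-2 * I * S.r * xi ν * -(I * β)) +
          -2 * I * S.r * xi ν * (-2 * M * (I * lam * β)) +
          -2 * I * S.r * xi ν * (2 * Mt * (I * β)) +
          -2 * I * S.r * xi ν * (I * β * ∑ μ, g μ - (S.rho + 1) * (I * lam * β)) -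
          -2 * I * S.r * xi ν * (2 * (I * (1 - lam) * β)) =
        -2 * I * S.r * xi ν * (I * β * (N * lam - Nt - 2 * M * lam + 2 * Mt + (∑ μ, g μ) -
          (S.rho + 1) * lam - 2 * (1 - lam))) by ring]
    refine exp_xi_eq S hν fun hk => ?_
    have hb := hbal hk
    simp only [gTilde, sum_sub_distrib, sum_const, card_univ, Fintype.card_fin, nsmul_eq_mul]
    have hr : (S.rho : ℂ) = 3 := by exact_mod_cast kind_elliptic_rho S hk
    push_cast
    linear_combination (I * β / 2) * hb + I * β * ((lam + 1) / 4 - lam) * hr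
  rw [e1, e2, e3, e4, ← e5]
  ring

/-- The functional identity behind the kernel function identity. -/
lemma functional_identity (G : ℂ → ℂ → ℂ) (p : Config N Nt) (q : Config M Mt)
    (hp : IsRegular S G g lam β p) (hq : IsRegular S G (gTilde S lam g) lam β q)
    (hpq : CrossNonzero S lam β p q)
    (hpot : ∀ ν ≤ S.rho, ∀ μ ≤ S.rho,
      S.s ((S.omega ν - S.omega μ + I * (1 - lam) * β) / 2) ≠ 0)
    (hbal : S.kind = .elliptic →
      2 * lam * ((N : ℂ) - M - 1) - 2 * ((Nt : ℂ) - Mt + 1) + ∑ ν, g ν = 0) :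
    (∑ ε : ℤˣ,
        (S.s (I * lam * β) * ∑ j, coeff S g lam β ε (.inl j) p * crossRatio S lam β ε (.inl j) p q -
          S.s (I * β) * ∑ k, coeff S g lam β ε (.inr k) p * crossRatio S lam β ε (.inr k) p q)) +
      potential S g lam β p -
      ((∑ ε : ℤˣ,
        (S.s (I * lam * β) * ∑ j, coeff S (gTilde S lam g) lam β ε (.inl j) q *
            crossRatio S lam β ε (.inl j) q p -
          S.s (I * β) * ∑ k, coeff S (gTilde S lam g) lam β ε (.inr k) q *
            crossRatio S lam β ε (.inr k) q p)) +
        potential S (gTilde S lam g) lam β q) -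
      kernelConst S lam β g N Nt M Mt = 0 := by
  -- The balance is minus the argument of `s` in `C`. In the elliptic case `|ω| = 0`, and its
  -- vanishing is the hypothesis on the parameters.
  have hB : S.balance (step N Nt M Mt lam β) (I * β) (I * lam * β) (fun ν => I * g ν * β) =
      -(I * β * (2 * lam * ((N : ℂ) - M) - 2 * ((Nt : ℂ) - Mt) + (∑ ν, g ν) -
        (S.rho + 1) * (lam + 1) / 2) - S.omegaSum) := by
    simp only [Setting.balance, step, species, Fintype.sum_sum_type, Sum.elim_inl, Sum.elim_inr,
      sum_const, card_univ, Fintype.card_fin, nsmul_eq_mul, ← sum_mul, ← mul_sum]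
    ring
  have hsrc := S.source_identity (allVars p q) (offset N Nt M Mt lam β) (step N Nt M Mt lam β)
    (doubleStep N Nt M Mt lam β) (I * β) (I * lam * β) (fun ν => I * g ν * β)
    (fun i => i.isLeft = true)
    (by
      rintro ((j | j) | (j | j)) hj <;>
        first
        | exact absurd hj Bool.false_ne_true
        | simp only [offset, step, doubleStep, species, Sum.elim_inl, Sum.elim_inr]
          constructor <;> ring)
    (by
      rintro ((j | j) | (j | j)) hj <;>
        first
        | exact absurd rfl hj
        | simp only [offset, step, doubleStep, species, Sum.elim_inl, Sum.elim_inr]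
          constructor <;> ring)
    (by
      rintro ((j | j) | (j | j)) ε <;> simp only [allVars, Sum.elim_inl, Sum.elim_inr]
      exacts [(hp.coeff_double ε j).1, (hp.coeff_double' ε j).1, (hq.coeff_double ε j).1,
        (hq.coeff_double' ε j).1])
    (by
      rintro ((j | j) | (j | j)) ε <;>
        simp only [allVars, doubleStep, species, Sum.elim_inl, Sum.elim_inr]
      · exact (hp.coeff_double ε j).2
      · rw [sub_neg_eq_add]; exact (hp.coeff_double' ε j).2
      · rw [← neg_ne_zero, ← S.s_neg]
        convert (hq.coeff_double (-ε) j).2 using 2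
        rw [sg_neg]; ring
      · rw [← neg_ne_zero, ← S.s_neg]
        convert (hq.coeff_double' (-ε) j).2 using 2
        rw [sg_neg]; ring)
    (by
      have key : ∀ {X Y w : ℂ}, (∀ ε δ : ℤˣ, S.s (X + sg δ * Y + sg ε * w) ≠ 0) → ∀ ε δ : ℤˣ,
          S.s (sg ε * X + 0 - (sg δ * Y + w)) ≠ 0 ∧ S.s (sg ε * X + w - (sg δ * Y + 0)) ≠ 0 ∧
          S.s (sg δ * Y + 0 - (sg ε * X + w)) ≠ 0 ∧ S.s (sg δ * Y + w - (sg ε * X + 0)) ≠ 0 :=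
        fun {X Y w} H ε δ => by
          obtain ⟨k1, k2, k3, k4⟩ := S.s_signs_ne_zero H ε δ
          refine ⟨?_, ?_, ?_, ?_⟩
          · convert k2 using 2; ring
          · convert k1 using 2; ring
          · convert k4 using 2; ring
          · convert k3 using 2; ring
      have key' : ∀ {X Y : ℂ}, (∀ δ : ℤˣ, S.s (X + sg δ * Y) ≠ 0) → ∀ (w : ℂ) (ε δ : ℤˣ),
          S.s (sg ε * X + w - (sg δ * Y + w)) ≠ 0 ∧ S.s (sg δ * Y + w - (sg ε * X + w)) ≠ 0 :=
        fun {X Y} H w ε δ => by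
          obtain ⟨k1, k2⟩ := S.s_signs_ne_zero' H ε δ
          constructor
          · convert k1 using 2; ring
          · convert k2 using 2; ring
      have hpm : ∀ j k (ε δ : ℤˣ),
          S.s (p.1 j + sg δ * p.2 k + sg ε * (I * (1 + lam) * β / 2)) ≠ 0 := fun j k ε δ => by
        convert hp.coeff_mixed ε δ j k using 2; ring
      have hqm : ∀ j k (ε δ : ℤˣ),
          S.s (q.1 j + sg δ * q.2 k + sg ε * (I * (1 + lam) * β / 2)) ≠ 0 := fun j k ε δ => by
        convert hq.coeff_mixed ε δ j k using 2; ring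
      rintro ((j | j) | (j | j)) ((i | i) | (i | i)) hji ε δ <;>
        simp only [allVars, offset, species, Sum.elim_inl, Sum.elim_inr]
      · exact (key' (fun δ => hp.coeff_pair δ j i (by rintro rfl; exact hji rfl)) _ ε δ).1
      · exact (key (hpm j i) ε δ).1
      · exact (key (fun ε δ => hpq.xy ε δ j i) ε δ).1
      · exact (key' (fun δ => hpq.xyt δ j i) _ ε δ).1
      · exact (key (hpm i j) δ ε).2.2.2
      · exact (key' (fun δ => hp.coeff_pair' δ j i (by rintro rfl; exact hji rfl)) _ ε δ).1
      · exact (key' (fun δ => hpq.xty δ j i) _ ε δ).1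
      · exact (key (fun ε δ => hpq.xtyt ε δ j i) ε δ).2.1
      · exact (key (fun ε δ => hpq.xy ε δ i j) δ ε).2.2.2
      · exact (key' (fun δ => hpq.xty δ i j) _ δ ε).2
      · exact (key' (fun δ => hq.coeff_pair δ j i (by rintro rfl; exact hji rfl)) _ ε δ).1
      · exact (key (hqm j i) ε δ).2.1
      · exact (key' (fun δ => hpq.xyt δ i j) _ δ ε).2
      · exact (key (fun ε δ => hpq.xtyt ε δ i j) δ ε).2.2.1
      · exact (key (hqm i j) δ ε).2.2.1
      · exact (key' (fun δ => hq.coeff_pair' δ j i (by rintro rfl; exact hji rfl)) _ ε δ).1)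
    (fun ν hν μ hμ => by convert hpot ν hν μ hμ using 3; ring)
    (fun hk => by
      have hb := hbal hk
      have hr : (S.rho : ℂ) = 3 := by exact_mod_cast kind_elliptic_rho S hk
      have ho : S.omegaSum = 0 := by
        simp only [Setting.omegaSum, kind_elliptic_rho S hk, sum_range_succ, sum_range_zero,
          Setting.omega]
        ring
      rw [hB, ho]
      linear_combination (-I * β) * hb + I * β * (lam + 1) / 2 * hr)
  have hhalf : ∀ ν ∈ range (S.rho + 1), _ := fun ν hν => congrArg₂ (· + ·)
    (halfPeriodTerm_left S lam β g p q (Nat.lt_succ_iff.1 (mem_range.1 hν)) hbal)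
    (halfPeriodTerm_right S lam β g p q (Nat.lt_succ_iff.1 (mem_range.1 hν)) hbal)
  rw [sum_congr rfl hhalf] at hsrc
  simp only [Fintype.sum_sum_type, sourceTerm_x, sourceTerm_xt, sourceTerm_y, sourceTerm_yt] at hsrc
  rw [hB, S.s_neg] at hsrc
  simp only [step, species, Sum.elim_inl, Sum.elim_inr, S.s_neg, sum_signs, neg_neg, sum_add_distrib,
    sum_neg_distrib, neg_mul, ← mul_sum] at hsrc
  rw [potential_eq, potential_eq, kernelConst]
  simp only [sum_signs]
  linear_combination hsrc

end HalfPeriod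

/-! ### The difference equation of the Gamma function at regular points -/

section Gamma

open Filter Topology

variable {S : Setting} {G : ℂ → ℂ → ℂ} {α : ℂ}

/-- The difference equation of the Gamma function, with the constant `c`, near every point. -/
def GammaRelation (S : Setting) (G : ℂ → ℂ → ℂ) (α c : ℂ) : Prop :=
  c ≠ 0 ∧ ∀ w, ∀ᶠ t in 𝓝[≠] (0 : ℂ), G (w + t) α / G (w - I * α + t) α = c * S.s (w - I * α / 2 + t)

lemma IsGammaFunction.exists_gammaRelation (hG : IsGammaFunction S G) (hα : α.re ≠ 0) :
    ∃ c, GammaRelation S G α c := by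
  obtain ⟨-, c, hc, h⟩ := hG α hα
  refine ⟨c, hc, fun w => ?_⟩
  have h2 := mem_codiscreteWithin_iff_forall_mem_nhdsNE.1 h (w - I * α / 2) trivial
  have h3 : Tendsto (fun t : ℂ => w - I * α / 2 + t) (𝓝[≠] 0) (𝓝[≠] (w - I * α / 2)) := by
    refine tendsto_nhdsWithin_iff.2 ⟨?_, ?_⟩
    · refine Tendsto.mono_left ?_ nhdsWithin_le_nhds
      have : Continuous fun t : ℂ => w - I * α / 2 + t := by fun_prop
      simpa using this.tendsto 0
    · filter_upwards [self_mem_nhdsWithin] with t ht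
      simpa using ht
  filter_upwards [h3 h2] with t ht
  rcases ht with ht | ht
  · have ht' : G (w - I * α / 2 + t + I * α / 2) α / G (w - I * α / 2 + t - I * α / 2) α =
        c * S.s (w - I * α / 2 + t) := ht
    rw [← ht']
    congr 2 <;> ring
  · exact absurd trivial ht

lemma GRegular.continuousAt {u : ℂ} (h : GRegular G u α) :
    ContinuousAt (fun t => G (u + t) α) 0 := by
  have h1 : ContinuousAt (fun z => G z α) (u + 0) := by rw [add_zero]; exact h.1.continuousAt
  exact ContinuousAt.comp (f := fun t => u + t) (g := fun z => G z α) h1 (by fun_prop)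

lemma GRegular.eventually_ne {u : ℂ} (h : GRegular G u α) :
    ∀ᶠ t in 𝓝[≠] (0 : ℂ), G (u + t) α ≠ 0 :=
  (h.continuousAt.eventually_ne (by simpa using h.2)).filter_mono nhdsWithin_le_nhds

lemma eq_of_eventually_eq {f k : ℂ → ℂ} (hf : ContinuousAt f 0) (hk : ContinuousAt k 0)
    (h : ∀ᶠ t in 𝓝[≠] (0 : ℂ), f t = k t) : f 0 = k 0 :=
  tendsto_nhds_unique_of_eventuallyEq (hf.mono_left nhdsWithin_le_nhds)
    (hk.mono_left nhdsWithin_le_nhds) h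

variable {c : ℂ}

/-- The relation is known only on punctured neighbourhoods; regularity at both ends extends it to
the point itself by continuity. -/
lemma GammaRelation.eq (h : GammaRelation S G α c) {u v z : ℂ} (hu : GRegular G u α)
    (hv : GRegular G v α) (huv : v = u - I * α) (hz : z = u - I * α / 2) :
    G u α = c * S.s z * G v α := by
  subst huv hz
  have hc := S.continuous_s
  have := eq_of_eventually_eq (f := fun t => G (u + t) α)
    (k := fun t => c * S.s (u - I * α / 2 + t) * G (u - I * α + t) α) hu.continuousAt
    (ContinuousAt.mul (by fun_prop) hv.continuousAt) (by
      filter_upwards [h.2 u, hv.eventually_ne] with t h1 h2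
      rw [← h1, div_mul_cancel₀ _ h2])
  simpa using this

/-- The midpoint `u - iα` may be a pole or a zero of `G`, so this is not two applications of
`GammaRelation.eq`. The midpoint is eliminated on a punctured neighbourhood before the limit is
taken. -/
lemma GammaRelation.eq_two (h : GammaRelation S G α c) {u v z w : ℂ} (hu : GRegular G u α)
    (hv : GRegular G v α) (huv : v = u - 2 * I * α) (hz : z = u - I * α / 2)
    (hw : w = u - 3 * I * α / 2) :
    G u α = c ^ 2 * (S.s z * S.s w) * G v α := by
  subst huv hz hw
  have hc := S.continuous_s
  have := eq_of_eventually_eq (f := fun t => G (u + t) α)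
    (k := fun t => c ^ 2 * (S.s (u - I * α / 2 + t) * S.s (u - 3 * I * α / 2 + t)) *
      G (u - 2 * I * α + t) α) hu.continuousAt
    (ContinuousAt.mul (by fun_prop) hv.continuousAt) (by
      have h3 := S.eventually_s_affine_ne_zero one_ne_zero (u - I * α / 2) 0
      filter_upwards [h.2 u, h.2 (u - I * α), h3, hv.eventually_ne] with t h1 h2 h3 h4
      rw [one_mul] at h3
      have e1 : u - I * α - I * α = u - 2 * I * α := by ring
      have e2 : u - I * α - I * α / 2 = u - 3 * I * α / 2 := by ring
      rw [e1, e2] at h2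
      -- A vanishing denominator would make the quotient in `h1` equal to `0` by the convention for
      -- division, although the right-hand side is nonzero.
      have h5 : G (u - I * α + t) α ≠ 0 := by
        intro h0
        rw [h0, div_zero] at h1
        exact mul_ne_zero h.1 h3 h1.symm
      rw [div_eq_iff h5] at h1
      rw [div_eq_iff h4] at h2
      rw [h1, h2]
      ring)
  simpa using this

lemma GammaRelation.s_ne_zero (h : GammaRelation S G α c) {u v z : ℂ} (hu : GRegular G u α)
    (hv : GRegular G v α) (huv : v = u - I * α) (hz : z = u - I * α / 2) : S.s z ≠ 0 := by
  intro h0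
  have := h.eq hu hv huv hz
  rw [h0, mul_zero, zero_mul] at this
  exact hu.2 this

end Gamma

/-! ### Detailed balance for one species -/

section Ground

variable {S : Setting} {G : ℂ → ℂ → ℂ}

/-- Isolates all pairs containing `j`, the only ones affected by a shift of the variable `j`;
symmetry removes the ordering in these pairs. -/
lemma prod_pairs_eq {R : Type*} [CommMonoid R] {N : ℕ} (f : Fin N → Fin N → R)
    (hf : ∀ i k, f i k = f k i) (j : Fin N) :
    ∏ i, ∏ k ∈ univ.filter (fun k => i < k), f i k =
      (∏ k ∈ univ.erase j, f j k) *
        ∏ i ∈ univ.erase j, ∏ k ∈ (univ.filter (fun k => i < k)).erase j, f i k := by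
  have h1 : ∏ k ∈ univ.filter (fun k => j < k), f j k =
      ∏ k ∈ univ.erase j, if j < k then f j k else 1 := by
    rw [prod_filter, ← mul_prod_erase univ _ (mem_univ j)]
    simp
  have h2 : ∀ i, ∏ k ∈ univ.filter (fun k => i < k), f i k =
      (if i < j then f i j else 1) * ∏ k ∈ (univ.filter (fun k => i < k)).erase j, f i k := by
    intro i
    split
    · rename_i hij
      rw [mul_prod_erase _ _ (by simpa using hij)]
    · rename_i hij
      rw [one_mul, erase_eq_of_notMem (by simpa using hij)]
  rw [← mul_prod_erase univ _ (mem_univ j), h1, prod_congr rfl fun i _ => h2 i, prod_mul_distrib,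
    ← mul_assoc, ← prod_mul_distrib]
  congr 1
  refine prod_congr rfl fun k hk => ?_
  rcases lt_trichotomy j k with h | h | h
  · simp [h, h.not_gt]
  · exact absurd h.symm (ne_of_mem_erase hk)
  · simp [h, h.not_gt, hf]

/-- The part of `V_j^ε` which depends on one species only. -/
def localCoeff (S : Setting) {N : ℕ} (g : Fin (2 * S.rho + 2) → ℂ) (lam β : ℂ) (ε : ℤˣ)
    (x : Fin N → ℂ) (j : Fin N) : ℂ :=
  (∏ ν, S.s (sg ε * x j - I * g ν * β)) /
      (S.s (sg ε * (2 * x j)) * S.s (sg ε * (2 * x j) - I * β)) *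
    ∏ i ∈ univ.erase j, ∏ δ : ℤˣ, S.s (x j + sg δ * x i - sg ε * I * lam * β) /
      S.s (x j + sg δ * x i)

variable {N : ℕ} {g : Fin (2 * S.rho + 2) → ℂ} {lam β c : ℂ}

lemma groundRegular_pair {x : Fin N → ℂ} (h : GroundRegular S G g lam β x) {j k : Fin N}
    (hjk : j ≠ k) (ε δ : ℤˣ) : GRegular G (sg ε * x j + sg δ * x k + I * β / 2) β ∧
      GRegular G (sg ε * x j + sg δ * x k - I * lam * β + I * β / 2) β := by
  rcases lt_or_gt_of_ne hjk with hlt | hlt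
  · exact ⟨h.pair_num ε δ j k hlt, h.pair_den ε δ j k hlt⟩
  · rw [add_comm (sg ε * x j)]
    exact ⟨h.pair_num δ ε k j hlt, h.pair_den δ ε k j hlt⟩

/-- The factors containing `x_j` split into a single-variable part (`hsingle`) and one part for each
other variable (`hpair`). Each balances separately, and the constants `c` cancel because for every
step of `G` downwards there is one upwards. -/
lemma groundSq_shift (hc : GammaRelation S G β c) {x x' : Fin N → ℂ} {j : Fin N}
    (hj : x' j = x j - I * β) (hne : ∀ i, i ≠ j → x' i = x i)
    (hx : GroundRegular S G g lam β x) (hx' : GroundRegular S G g lam β x')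
    (h2 : ∀ ε : ℤˣ, S.s (sg ε * (2 * x j)) ≠ 0 ∧ S.s (sg ε * (2 * x j) - I * β) ≠ 0)
    (h2' : ∀ ε : ℤˣ, S.s (sg ε * (2 * x' j)) ≠ 0 ∧ S.s (sg ε * (2 * x' j) - I * β) ≠ 0)
    (hp : ∀ (δ : ℤˣ) i, i ≠ j → S.s (x j + sg δ * x i) ≠ 0)
    (hp' : ∀ (δ : ℤˣ) i, i ≠ j → S.s (x' j + sg δ * x' i) ≠ 0) :
    groundSq S G g lam β x' * localCoeff S g lam β (-1) x' j =
      groundSq S G g lam β x * localCoeff S g lam β 1 x j := by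
  have c0 := hc.1
  set A : ℂ → ℂ := fun z => G (2 * z + I * β / 2) β * G (-2 * z + I * β / 2) β /
      ∏ ν, G (z + I * β / 2 - I * g ν * β) β * G (-z + I * β / 2 - I * g ν * β) β with hA
  set F : ℂ → ℂ → ℂ := fun z w => ∏ ε : ℤˣ, ∏ ε' : ℤˣ,
      G (sg ε * z + sg ε' * w + I * β / 2) β /
        G (sg ε * z + sg ε' * w - I * lam * β + I * β / 2) β with hF
  have hsymm : ∀ z w, F z w = F w z := fun z w => by
    simp only [hF]
    rw [prod_comm]
    simp only [add_comm (sg _ * z)]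
  have hsq : ∀ y : Fin N → ℂ, groundSq S G g lam β y = (A (y j) * ∏ k ∈ univ.erase j, F (y j) (y k)) *
      ((∏ i ∈ univ.erase j, A (y i)) *
        ∏ i ∈ univ.erase j, ∏ k ∈ (univ.filter (fun k => i < k)).erase j, F (y i) (y k)) := by
    intro y
    have e : groundSq S G g lam β y =
      (∏ i, A (y i)) * ∏ i, ∏ k ∈ univ.filter (fun k => i < k), F (y i) (y k) := rfl
    rw [e, ← mul_prod_erase univ (fun i => A (y i)) (mem_univ j),
      prod_pairs_eq (fun i k => F (y i) (y k)) (fun i k => hsymm _ _) j]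
    ring
  have hrest : (∏ i ∈ univ.erase j, A (x' i)) *
        ∏ i ∈ univ.erase j, ∏ k ∈ (univ.filter (fun k => i < k)).erase j, F (x' i) (x' k) =
      (∏ i ∈ univ.erase j, A (x i)) *
        ∏ i ∈ univ.erase j, ∏ k ∈ (univ.filter (fun k => i < k)).erase j, F (x i) (x k) := by
    congr 1
    · exact prod_congr rfl fun i hi => by rw [hne i (ne_of_mem_erase hi)]
    · exact prod_congr rfl fun i hi => prod_congr rfl fun k hk => by
        rw [hne i (ne_of_mem_erase hi), hne k (ne_of_mem_erase hk)]
  have hsingle : A (x' j) * ((∏ ν, S.s (sg (-1) * x' j - I * g ν * β)) /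
      (S.s (sg (-1) * (2 * x' j)) * S.s (sg (-1) * (2 * x' j) - I * β))) =
      A (x j) * ((∏ ν, S.s (sg 1 * x j - I * g ν * β)) /
      (S.s (sg 1 * (2 * x j)) * S.s (sg 1 * (2 * x j) - I * β))) := by
    -- The argument `2 x_j` moves by `2iβ`, hence the two-step relation.
    have e1 := hc.eq_two (hx.double 1 j) (hx'.double 1 j) (z := sg 1 * (2 * x j))
      (w := sg 1 * (2 * x j) - I * β) (by rw [hj, sg_one]; ring) (by ring) (by ring)
    have e2 := hc.eq_two (hx'.double (-1) j) (hx.double (-1) j) (z := sg (-1) * (2 * x' j))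
      (w := sg (-1) * (2 * x' j) - I * β) (by rw [hj, sg_neg_one]; ring) (by ring) (by ring)
    have hν : ∀ ν, G (x' j + I * β / 2 - I * g ν * β) β * G (-x' j + I * β / 2 - I * g ν * β) β *
        S.s (sg 1 * x j - I * g ν * β) = G (x j + I * β / 2 - I * g ν * β) β *
          G (-x j + I * β / 2 - I * g ν * β) β * S.s (sg (-1) * x' j - I * g ν * β) := by
      intro ν
      have k1 := hc.eq (hx.single 1 j ν) (hx'.single 1 j ν) (z := sg 1 * x j - I * g ν * β)
        (by rw [hj, sg_one]; ring) (by ring)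
      have k2 := hc.eq (hx'.single (-1) j ν) (hx.single (-1) j ν)
        (z := sg (-1) * x' j - I * g ν * β) (by rw [hj, sg_neg_one]; ring) (by ring)
      simp only [sg_one, sg_neg_one, one_mul, neg_one_mul] at k1 k2 ⊢
      rw [k1, k2]
      ring
    have hP : ∀ y : Fin N → ℂ, GroundRegular S G g lam β y →
        ∏ ν, G (y j + I * β / 2 - I * g ν * β) β * G (-y j + I * β / 2 - I * g ν * β) β ≠ 0 :=
      fun y hy => prod_ne_zero_iff.2 fun ν _ => by
        have k1 := (hy.single 1 j ν).2
        have k2 := (hy.single (-1) j ν).2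
        simp only [sg_one, sg_neg_one, one_mul, neg_one_mul] at k1 k2
        exact mul_ne_zero k1 k2
    have hprod := prod_congr rfl fun ν (_ : ν ∈ univ) => hν ν
    rw [prod_mul_distrib, prod_mul_distrib (f := fun ν => _ * _)] at hprod
    have q1 := hP x hx
    have q2 := hP x' hx'
    have q3 := h2 1
    have q4 := h2' (-1)
    have n1 : G (2 * x j + I * β / 2) β = G (sg 1 * (2 * x j) + I * β / 2) β := by rw [sg_one, one_mul]
    have n2 : G (-2 * x j + I * β / 2) β = G (sg (-1) * (2 * x j) + I * β / 2) β := by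
      rw [sg_neg_one]; congr 1; ring
    have n3 : G (2 * x' j + I * β / 2) β = G (sg 1 * (2 * x' j) + I * β / 2) β := by
      rw [sg_one, one_mul]
    have n4 : G (-2 * x' j + I * β / 2) β = G (sg (-1) * (2 * x' j) + I * β / 2) β := by
      rw [sg_neg_one]; congr 1; ring
    simp only [hA, n1, n2, n3, n4]
    rw [e1, e2]
    generalize S.s (sg 1 * (2 * x j)) = t1 at *
    generalize S.s (sg 1 * (2 * x j) - I * β) = t2 at *
    generalize S.s (sg (-1) * (2 * x' j)) = t3 at *
    generalize S.s (sg (-1) * (2 * x' j) - I * β) = t4 at *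
    generalize ∏ ν, G (x j + I * β / 2 - I * g ν * β) β * G (-x j + I * β / 2 - I * g ν * β) β = P1
      at *
    generalize ∏ ν, G (x' j + I * β / 2 - I * g ν * β) β * G (-x' j + I * β / 2 - I * g ν * β) β = P2
      at *
    obtain ⟨q31, q32⟩ := q3
    obtain ⟨q41, q42⟩ := q4
    generalize G (sg 1 * (2 * x' j) + I * β / 2) β = g1
    generalize G (sg (-1) * (2 * x j) + I * β / 2) β = g2
    generalize ∏ ν, S.s (sg 1 * x j - I * g ν * β) = Q1 at *
    generalize ∏ ν, S.s (sg (-1) * x' j - I * g ν * β) = Q2 at *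
    field_simp
    linear_combination (-g1 * g2) * hprod
  have hpair : ∀ i ∈ univ.erase j, F (x' j) (x' i) * ∏ δ : ℤˣ,
      S.s (x' j + sg δ * x' i - sg (-1) * I * lam * β) / S.s (x' j + sg δ * x' i) =
      F (x j) (x i) * ∏ δ : ℤˣ,
      S.s (x j + sg δ * x i - sg 1 * I * lam * β) / S.s (x j + sg δ * x i) := by
    intro i hi
    have hij := ne_of_mem_erase hi
    have hi' := hne i hij
    have key : ∀ δ : ℤˣ,
        (G (sg 1 * x' j + sg δ * x' i + I * β / 2) β /
          G (sg 1 * x' j + sg δ * x' i - I * lam * β + I * β / 2) β) *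
        (G (sg (-1) * x' j + sg (-δ) * x' i + I * β / 2) β /
          G (sg (-1) * x' j + sg (-δ) * x' i - I * lam * β + I * β / 2) β) *
        (S.s (x' j + sg δ * x' i - sg (-1) * I * lam * β) / S.s (x' j + sg δ * x' i)) =
        (G (sg 1 * x j + sg δ * x i + I * β / 2) β /
          G (sg 1 * x j + sg δ * x i - I * lam * β + I * β / 2) β) *
        (G (sg (-1) * x j + sg (-δ) * x i + I * β / 2) β /
          G (sg (-1) * x j + sg (-δ) * x i - I * lam * β + I * β / 2) β) *
        (S.s (x j + sg δ * x i - sg 1 * I * lam * β) / S.s (x j + sg δ * x i)) := by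
      intro δ
      obtain ⟨r1, r2⟩ := groundRegular_pair hx hij.symm 1 δ
      obtain ⟨r3, r4⟩ := groundRegular_pair hx hij.symm (-1) (-δ)
      obtain ⟨r1', r2'⟩ := groundRegular_pair hx' hij.symm 1 δ
      obtain ⟨r3', r4'⟩ := groundRegular_pair hx' hij.symm (-1) (-δ)
      have v1 := hp δ i hij
      have v2 := hp' δ i hij
      have k1 := hc.eq r1 r1' (z := x j + sg δ * x i) (by rw [hj, hi', sg_one]; ring)
        (by rw [sg_one]; ring)
      have k2 := hc.eq r2 r2' (z := x j + sg δ * x i - sg 1 * I * lam * β)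
        (by rw [hj, hi', sg_one]; ring) (by rw [sg_one]; ring)
      have k3 := hc.eq r3' r3 (z := -(x' j + sg δ * x' i)) (by rw [hj, hi', sg_neg_one]; ring)
        (by rw [sg_neg_one, sg_neg]; ring)
      have k4 := hc.eq r4' r4 (z := -(x' j + sg δ * x' i - sg (-1) * I * lam * β))
        (by rw [hj, hi', sg_neg_one]; ring) (by rw [sg_neg_one, sg_neg]; ring)
      have w2 := hc.s_ne_zero r2 r2' (z := x j + sg δ * x i - sg 1 * I * lam * β)
        (by rw [hj, hi', sg_one]; ring) (by rw [sg_one]; ring)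
      have w4 := hc.s_ne_zero r4' r4 (z := -(x' j + sg δ * x' i - sg (-1) * I * lam * β))
        (by rw [hj, hi', sg_neg_one]; ring) (by rw [sg_neg_one, sg_neg]; ring)
      rw [S.s_neg] at k3 k4 w4
      rw [neg_ne_zero] at w4
      rw [k1, k2, k3, k4]
      have p2 := r2'.2
      have p4 := r4.2
      generalize S.s (x j + sg δ * x i) = t1 at *
      generalize S.s (x' j + sg δ * x' i) = t2 at *
      generalize S.s (x j + sg δ * x i - sg 1 * I * lam * β) = t3 at *
      generalize S.s (x' j + sg δ * x' i - sg (-1) * I * lam * β) = t4 at *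
      generalize G (sg 1 * x' j + sg δ * x' i - I * lam * β + I * β / 2) β = G1 at *
      generalize G (sg (-1) * x j + sg (-δ) * x i - I * lam * β + I * β / 2) β = G2 at *
      field_simp
    have hFs : ∀ z w : ℂ, F z w = ∏ δ : ℤˣ,
        (G (sg 1 * z + sg δ * w + I * β / 2) β / G (sg 1 * z + sg δ * w - I * lam * β + I * β / 2) β) *
        (G (sg (-1) * z + sg (-δ) * w + I * β / 2) β /
          G (sg (-1) * z + sg (-δ) * w - I * lam * β + I * β / 2) β) := by
      intro z w
      simp only [hF, prod_signs, neg_neg]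
      ring
    rw [hFs, hFs, ← prod_mul_distrib, ← prod_mul_distrib]
    exact prod_congr rfl fun δ _ => key δ
  have hpairs := prod_congr rfl hpair
  rw [prod_mul_distrib, prod_mul_distrib] at hpairs
  rw [hsq, hsq, hrest, localCoeff, localCoeff]
  linear_combination
    ((∏ k ∈ univ.erase j, F (x' j) (x' k)) * (∏ i ∈ univ.erase j, ∏ δ : ℤˣ,
      S.s (x' j + sg δ * x' i - sg (-1) * I * lam * β) / S.s (x' j + sg δ * x' i)) *
    ((∏ i ∈ univ.erase j, A (x i)) *
        ∏ i ∈ univ.erase j, ∏ k ∈ (univ.filter (fun k => i < k)).erase j, F (x i) (x k))) * hsingle +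
    (A (x j) * ((∏ ν, S.s (sg 1 * x j - I * g ν * β)) /
      (S.s (sg 1 * (2 * x j)) * S.s (sg 1 * (2 * x j) - I * β))) *
    ((∏ i ∈ univ.erase j, A (x i)) *
        ∏ i ∈ univ.erase j, ∏ k ∈ (univ.filter (fun k => i < k)).erase j, F (x i) (x k))) * hpairs

end Ground

/-! ### Detailed balance for the deformed ground state -/

section GroundShift

variable {S : Setting} {G : ℂ → ℂ → ℂ} {N Nt : ℕ} {g : Fin (2 * S.rho + 2) → ℂ} {lam β : ℂ}

lemma coeff_inl (ε : ℤˣ) (j : Fin N) (p : Config N Nt) :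
    coeff S g lam β ε (.inl j) p = localCoeff S g lam β ε p.1 j *
      ∏ δ : ℤˣ, ∏ k, S.s (p.1 j + sg δ * p.2 k - sg ε * I * (lam - 1) * β / 2) /
        S.s (p.1 j + sg δ * p.2 k - sg ε * I * (lam + 1) * β / 2) := by
  obtain ⟨x, xt⟩ := p
  rw [localCoeff, prod_comm]
  simp only [coeff, prod_mul_distrib]
  ring

/-- The duality `(g, λ, β) ↦ (g', 1/λ, λβ)`: the factors in `x̃` alone are those of an undeformed
model with the opposite sign, since `x̃` is shifted in the opposite direction. This lets
`groundSq_shift` serve both species. -/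
lemma coeff_inr (hlam : lam ≠ 0) (ε : ℤˣ) (k : Fin Nt) (p : Config N Nt) :
    coeff S g lam β ε (.inr k) p =
      localCoeff S (gPrime S g lam) (1 / lam) (lam * β) (-ε) p.2 k *
      ∏ δ : ℤˣ, ∏ j, S.s (p.2 k + sg δ * p.1 j - sg ε * I * (lam - 1) * β / 2) /
        S.s (p.2 k + sg δ * p.1 j + sg ε * I * (lam + 1) * β / 2) := by
  obtain ⟨x, xt⟩ := p
  rw [localCoeff, prod_comm (s := univ.erase k)]
  simp only [coeff, prod_mul_distrib, sg_neg]
  rw [prod_congr rfl fun ν _ => show S.s (-sg ε * xt k - I * gPrime S g lam ν * (lam * β)) =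
      S.s (-(sg ε * xt k - I * (g ν - (lam + 1) / 2) * β)) by
        congr 1; rw [gPrime]; field_simp; ring,
    S.prod_s_neg fun ν => sg ε * xt k - I * (g ν - (lam + 1) / 2) * β,
    show -sg ε * (2 * xt k) = -(sg ε * (2 * xt k)) by ring,
    show -(sg ε * (2 * xt k)) - I * (lam * β) = -(sg ε * (2 * xt k) + I * lam * β) by ring,
    S.s_neg, S.s_neg, neg_mul_neg]
  have e : ∀ (δ : ℤˣ) i, xt k + sg δ * xt i - -sg ε * I * (1 / lam) * (lam * β) =
      xt k + sg δ * xt i + sg ε * I * β := fun δ i => by field_simp; ring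
  simp only [e]
  ring

/-- The factors of the mixed denominator of the ground state that contain the variable `z`. -/
def mixedDen (S : Setting) {n : ℕ} (u z : ℂ) (w : Fin n → ℂ) : ℂ :=
  ∏ δ : ℤˣ, ∏ k, S.s (z + sg δ * w k + u) * S.s (z + sg δ * w k - u)

lemma mixedDen_symm {n m : ℕ} (u : ℂ) (z : Fin n → ℂ) (w : Fin m → ℂ) :
    ∏ j, mixedDen S u (z j) w = ∏ k, mixedDen S u (w k) z := by
  simp only [mixedDen]
  rw [prod_congr rfl fun j _ => prod_comm, prod_comm]
  rw [prod_congr rfl fun k _ => prod_comm (s := univ (α := ℤˣ)) (t := univ (α := Fin n))]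
  refine prod_congr rfl fun k _ => prod_congr rfl fun j _ => ?_
  rw [prod_signs, prod_signs, sg_one, sg_neg_one,
    show z j + -1 * w k + u = -(w k + -1 * z j - u) by ring,
    show z j + -1 * w k - u = -(w k + -1 * z j + u) by ring, S.s_neg, S.s_neg,
    show z j + 1 * w k = w k + 1 * z j by ring]
  ring

/-- The mixed denominator of each coefficient is a factor of the ground-state denominator at the
neighbouring point. After the numerators cancel, both sides are the same product of reciprocals of
`s(z + δw + u) s(z' + δw - u)`. -/
lemma prod_div_mixedDen {n : ℕ} {u z z' : ℂ} {w : Fin n → ℂ} {v v' : ℤˣ → Fin n → ℂ}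
    (hv : ∀ δ k, v δ k = z' + sg δ * w k - u) (hv' : ∀ δ k, v' δ k = z + sg δ * w k + u)
    (h : ∀ (δ : ℤˣ) k, S.s (z + sg δ * w k - u) ≠ 0) (h' : ∀ (δ : ℤˣ) k, S.s (z' + sg δ * w k + u) ≠ 0) :
    (∏ δ : ℤˣ, ∏ k, S.s (z' + sg δ * w k + u) / S.s (v' δ k)) / mixedDen S u z' w =
      (∏ δ : ℤˣ, ∏ k, S.s (z + sg δ * w k - u) / S.s (v δ k)) / mixedDen S u z w := by
  simp only [mixedDen, ← prod_div_distrib]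
  refine prod_congr rfl fun δ _ => prod_congr rfl fun k _ => ?_
  rw [hv, hv']
  have h1 := h δ k
  have h2 := h' δ k
  generalize S.s (z + sg δ * w k - u) = a at *
  generalize S.s (z' + sg δ * w k + u) = b at *
  generalize S.s (z + sg δ * w k + u) = A
  generalize S.s (z' + sg δ * w k - u) = B
  calc b / A / (b * B) = b / b * (1 / (A * B)) := by ring
    _ = a / a * (1 / (A * B)) := by rw [div_self h1, div_self h2]
    _ = _ := by ring

lemma deformedGroundSq_eq (p : Config N Nt) :
    deformedGroundSq S G g lam β p =
      groundSq S G g lam β p.1 * groundSq S G (gPrime S g lam) (1 / lam) (lam * β) p.2 /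
        ∏ j, mixedDen S (I * (lam - 1) * β / 2) (p.1 j) p.2 := rfl

lemma prod_eq_mul_prod_erase_of_ne {n : ℕ} {R : Type*} [CommMonoid R] (f : ℂ → R)
    {x x' : Fin n → ℂ} {j : Fin n} (hne : ∀ i, i ≠ j → x' i = x i) :
    ∏ i, f (x' i) = f (x' j) * ∏ i ∈ univ.erase j, f (x i) := by
  rw [← mul_prod_erase univ _ (mem_univ j)]
  congr 1
  exact prod_congr rfl fun i hi => by rw [hne i (ne_of_mem_erase hi)]

lemma groundSq_ne_zero {g : Fin (2 * S.rho + 2) → ℂ} {lam β : ℂ} {x : Fin N → ℂ}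
    (h : GroundRegular S G g lam β x) : groundSq S G g lam β x ≠ 0 := by
  refine mul_ne_zero (prod_ne_zero_iff.2 fun j _ => div_ne_zero (mul_ne_zero ?_ ?_)
    (prod_ne_zero_iff.2 fun ν _ => mul_ne_zero ?_ ?_))
    (prod_ne_zero_iff.2 fun j _ => prod_ne_zero_iff.2 fun k hk => prod_ne_zero_iff.2 fun ε _ =>
      prod_ne_zero_iff.2 fun ε' _ => div_ne_zero
        (h.pair_num ε ε' j k (by simpa using hk)).2 (h.pair_den ε ε' j k (by simpa using hk)).2)
  · have := (h.double 1 j).2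
    simpa [sg_one] using this
  · have := (h.double (-1) j).2
    simpa [sg_neg_one] using this
  · have := (h.single 1 j ν).2
    simpa [sg_one] using this
  · have := (h.single (-1) j ν).2
    simpa [sg_neg_one] using this

lemma mixed_ne_zero {p : Config N Nt} (h : IsRegular S G g lam β p) (δ : ℤˣ) j k :
    S.s (p.1 j + sg δ * p.2 k + I * (lam - 1) * β / 2) ≠ 0 ∧
      S.s (p.1 j + sg δ * p.2 k - I * (lam - 1) * β / 2) ≠ 0 := by
  constructor
  · have := h.mixed 1 δ j k
    simpa [sg_one] using this
  · have := h.mixed (-1) δ j k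
    convert this using 2
    rw [sg_neg_one]; ring

lemma mixed_ne_zero' {p : Config N Nt} (h : IsRegular S G g lam β p) (δ : ℤˣ) j k :
    S.s (p.2 k + sg δ * p.1 j + I * (lam - 1) * β / 2) ≠ 0 ∧
      S.s (p.2 k + sg δ * p.1 j - I * (lam - 1) * β / 2) ≠ 0 := by
  have := S.s_signs_ne_zero (X := p.1 j) (Y := p.2 k) (w := I * (lam - 1) * β / 2)
    (fun ε δ => by convert h.mixed ε δ j k using 2; ring) (-δ) 1
  constructor
  · convert this.2.2.1 using 2
    rw [sg_neg, sg_one]; ring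
  · convert this.2.2.2 using 2
    rw [sg_neg, sg_one]; ring

lemma deformedGroundSq_ne_zero {p : Config N Nt} (h : IsRegular S G g lam β p) :
    deformedGroundSq S G g lam β p ≠ 0 := by
  rw [deformedGroundSq_eq]
  refine div_ne_zero (mul_ne_zero (groundSq_ne_zero h.ground) (groundSq_ne_zero h.ground')) ?_
  exact prod_ne_zero_iff.2 fun j _ => prod_ne_zero_iff.2 fun δ _ => prod_ne_zero_iff.2 fun k _ =>
    mul_ne_zero (mixed_ne_zero h δ j k).1 (mixed_ne_zero h δ j k).2

lemma shift_inl_self (ε : ℤˣ) (j : Fin N) (p : Config N Nt) :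
    (shift lam β ε (.inl j) p).1 j = p.1 j - sg ε * I * β := by
  simp [shift]

lemma shift_inl_of_ne (ε : ℤˣ) {i j : Fin N} (h : i ≠ j) (p : Config N Nt) :
    (shift lam β ε (.inl j) p).1 i = p.1 i := by
  simp [shift, h]

lemma shift_inl_snd (ε : ℤˣ) (j : Fin N) (p : Config N Nt) :
    (shift lam β ε (.inl j) p).2 = p.2 := rfl

lemma shift_inr_self (ε : ℤˣ) (j : Fin Nt) (p : Config N Nt) :
    (shift lam β ε (.inr j) p).2 j = p.2 j + sg ε * I * lam * β := by
  simp [shift]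

lemma shift_inr_of_ne (ε : ℤˣ) {i j : Fin Nt} (h : i ≠ j) (p : Config N Nt) :
    (shift lam β ε (.inr j) p).2 i = p.2 i := by
  simp [shift, h]

lemma shift_inr_fst (ε : ℤˣ) (j : Fin Nt) (p : Config N Nt) :
    (shift lam β ε (.inr j) p).1 = p.1 := rfl

lemma deformedGroundSq_shift {c ct : ℂ} (hlam : lam ≠ 0) (hc : GammaRelation S G β c)
    (hct : GammaRelation S G (lam * β) ct) (J : Fin N ⊕ Fin Nt) {p p' : Config N Nt}
    (hpp : p' = shift lam β 1 J p)
    (hp : IsRegular S G g lam β p) (hp' : IsRegular S G g lam β p') :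
    deformedGroundSq S G g lam β p' * coeff S g lam β (-1) J p' =
      deformedGroundSq S G g lam β p * coeff S g lam β 1 J p := by
  rcases J with j | j
  · have a1 : p'.1 j = p.1 j - I * β := by rw [hpp, shift_inl_self, sg_one, one_mul]
    have a2 : ∀ i, i ≠ j → p'.1 i = p.1 i := fun i hi => by rw [hpp, shift_inl_of_ne _ hi]
    have a3 : p'.2 = p.2 := by rw [hpp, shift_inl_snd]
    have hloc := groundSq_shift hc a1 a2 hp.ground hp'.ground (fun ε => hp.coeff_double ε j)
      (fun ε => hp'.coeff_double ε j) (fun δ i hi => hp.coeff_pair δ j i hi.symm)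
      (fun δ i hi => hp'.coeff_pair δ j i hi.symm)
    have hmix := prod_div_mixedDen (S := S) (u := I * (lam - 1) * β / 2) (z := p.1 j) (z' := p'.1 j)
      (w := p.2) (v := fun δ k => p.1 j + sg δ * p.2 k - sg 1 * I * (lam + 1) * β / 2)
      (v' := fun δ k => p'.1 j + sg δ * p.2 k - sg (-1) * I * (lam + 1) * β / 2)
      (fun δ k => by rw [a1, sg_one]; ring) (fun δ k => by rw [a1, sg_neg_one]; ring)
      (fun δ k => (mixed_ne_zero hp δ j k).2)
      (fun δ k => by rw [← a3]; exact (mixed_ne_zero hp' δ j k).1)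
    rw [deformedGroundSq_eq, deformedGroundSq_eq, coeff_inl, coeff_inl,
      prod_eq_mul_prod_erase_of_ne (fun z => mixedDen S (I * (lam - 1) * β / 2) z p'.2) a2, a3,
      ← mul_prod_erase univ (fun i => mixedDen S (I * (lam - 1) * β / 2) (p.1 i) p.2) (mem_univ j)]
    have n1 : ∀ δ : ℤˣ, ∀ k, p'.1 j + sg δ * p.2 k - sg (-1) * I * (lam - 1) * β / 2 =
      p'.1 j + sg δ * p.2 k + I * (lam - 1) * β / 2 := fun δ k => by rw [sg_neg_one]; ring
    have n2 : ∀ δ : ℤˣ, ∀ k, p.1 j + sg δ * p.2 k - sg 1 * I * (lam - 1) * β / 2 =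
      p.1 j + sg δ * p.2 k - I * (lam - 1) * β / 2 := fun δ k => by rw [sg_one]; ring
    simp only [n1, n2]
    generalize (∏ δ : ℤˣ, ∏ k, S.s (p'.1 j + sg δ * p.2 k + I * (lam - 1) * β / 2) /
      S.s (p'.1 j + sg δ * p.2 k - sg (-1) * I * (lam + 1) * β / 2)) = m' at *
    generalize (∏ δ : ℤˣ, ∏ k, S.s (p.1 j + sg δ * p.2 k - I * (lam - 1) * β / 2) /
      S.s (p.1 j + sg δ * p.2 k - sg 1 * I * (lam + 1) * β / 2)) = m at *
    generalize ∏ i ∈ univ.erase j, mixedDen S (I * (lam - 1) * β / 2) (p.1 i) p.2 = R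
    generalize groundSq S G (gPrime S g lam) (1 / lam) (lam * β) p.2 = Q
    rw [div_mul_eq_mul_div, div_mul_eq_mul_div]
    calc _ = (groundSq S G g lam β p'.1 * localCoeff S g lam β (-1) p'.1 j) *
          (m' / mixedDen S (I * (lam - 1) * β / 2) (p'.1 j) p.2) * Q / R := by ring
      _ = _ := by rw [hloc, hmix]; ring
  · have a1 : p'.2 j = p.2 j + I * lam * β := by rw [hpp, shift_inr_self, sg_one, one_mul]
    have a2 : ∀ i, i ≠ j → p'.2 i = p.2 i := fun i hi => by rw [hpp, shift_inr_of_ne _ hi]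
    have a3 : p'.1 = p.1 := by rw [hpp, shift_inr_fst]
    have hdbl : ∀ {q : Config N Nt}, IsRegular S G g lam β q → ∀ ε : ℤˣ,
        S.s (sg ε * (2 * q.2 j)) ≠ 0 ∧ S.s (sg ε * (2 * q.2 j) - I * (lam * β)) ≠ 0 :=
      fun {q} hq ε => ⟨(hq.coeff_double' ε j).1, by
        rw [← neg_ne_zero, ← S.s_neg]
        convert (hq.coeff_double' (-ε) j).2 using 2
        rw [sg_neg]; ring⟩
    -- For `x̃` the positive shift adds `iλβ`, so the downward step leads from `p'` to `p` and the
    -- two points change roles.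
    have hloc := groundSq_shift hct (x := p'.2) (x' := p.2) (j := j) (by rw [a1]; ring)
      (fun i hi => (a2 i hi).symm) hp'.ground' hp.ground' (hdbl hp') (hdbl hp)
      (fun δ i hi => hp'.coeff_pair' δ j i hi.symm) (fun δ i hi => hp.coeff_pair' δ j i hi.symm)
    have hmix := prod_div_mixedDen (S := S) (u := I * (lam - 1) * β / 2) (z := p.2 j) (z' := p'.2 j)
      (w := p.1) (v := fun δ k => p.2 j + sg δ * p.1 k + sg 1 * I * (lam + 1) * β / 2)
      (v' := fun δ k => p'.2 j + sg δ * p.1 k + sg (-1) * I * (lam + 1) * β / 2)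
      (fun δ k => by rw [a1, sg_one]; ring) (fun δ k => by rw [a1, sg_neg_one]; ring)
      (fun δ k => (mixed_ne_zero' hp δ k j).2)
      (fun δ k => by rw [← a3]; exact (mixed_ne_zero' hp' δ k j).1)
    rw [deformedGroundSq_eq, deformedGroundSq_eq, coeff_inr hlam, coeff_inr hlam,
      mixedDen_symm _ p'.1 p'.2, mixedDen_symm _ p.1 p.2,
      prod_eq_mul_prod_erase_of_ne (fun z => mixedDen S (I * (lam - 1) * β / 2) z p'.1) a2, a3,
      ← mul_prod_erase univ (fun i => mixedDen S (I * (lam - 1) * β / 2) (p.2 i) p.1) (mem_univ j)]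
    have n1 : ∀ δ : ℤˣ, ∀ k, p'.2 j + sg δ * p.1 k - sg (-1) * I * (lam - 1) * β / 2 =
      p'.2 j + sg δ * p.1 k + I * (lam - 1) * β / 2 := fun δ k => by rw [sg_neg_one]; ring
    have n2 : ∀ δ : ℤˣ, ∀ k, p.2 j + sg δ * p.1 k - sg 1 * I * (lam - 1) * β / 2 =
      p.2 j + sg δ * p.1 k - I * (lam - 1) * β / 2 := fun δ k => by rw [sg_one]; ring
    simp only [n1, n2, neg_neg]
    generalize (∏ δ : ℤˣ, ∏ k, S.s (p'.2 j + sg δ * p.1 k + I * (lam - 1) * β / 2) /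
      S.s (p'.2 j + sg δ * p.1 k + sg (-1) * I * (lam + 1) * β / 2)) = m' at *
    generalize (∏ δ : ℤˣ, ∏ k, S.s (p.2 j + sg δ * p.1 k - I * (lam - 1) * β / 2) /
      S.s (p.2 j + sg δ * p.1 k + sg 1 * I * (lam + 1) * β / 2)) = m at *
    generalize ∏ i ∈ univ.erase j, mixedDen S (I * (lam - 1) * β / 2) (p.2 i) p.1 = R
    generalize groundSq S G g lam β p.1 = Q
    rw [div_mul_eq_mul_div, div_mul_eq_mul_div]
    calc _ = (groundSq S G (gPrime S g lam) (1 / lam) (lam * β) p'.2 *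
          localCoeff S (gPrime S g lam) (1 / lam) (lam * β) 1 p'.2 j) *
          (m' / mixedDen S (I * (lam - 1) * β / 2) (p'.2 j) p.1) * Q / R := by ring
      _ = _ := by rw [← hloc, hmix]; ring

end GroundShift

/-! ### Shifts of the cross factor -/

section Cross

variable {S : Setting} {G : ℂ → ℂ → ℂ} {N Nt M Mt : ℕ} {lam β : ℂ}

lemma s_sg_mul (η : ℤˣ) (w : ℂ) : S.s (sg η * w) = sg η * S.s w := by
  rcases Int.units_eq_one_or η with rfl | rfl
  · rw [sg_one, one_mul, one_mul]
  · rw [sg_neg_one, neg_one_mul, neg_one_mul, S.s_neg]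

/-- The Gamma functions in the kernel function that contain the variables `X` and `Y`. -/
def pairKernel (G : ℂ → ℂ → ℂ) (m α X Y : ℂ) : ℂ :=
  ∏ ε : ℤˣ, ∏ ε' : ℤˣ, G (sg ε * X + sg ε' * Y - m) α

/-- The factors are paired as `±(X + δY)`. One member moves down by `iα` and the other up, so the
constant cancels and a quotient of two values of `s` remains; the minus signs of the two pairs
cancel. -/
lemma pairKernel_shift {α c m X X' Y : ℂ} {η : ℤˣ} (hc : GammaRelation S G α c)
    (hX : X' = X - sg η * I * α) (hr : ∀ ε ε' : ℤˣ, GRegular G (sg ε * X + sg ε' * Y - m) α)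
    (hr' : ∀ ε ε' : ℤˣ, GRegular G (sg ε * X' + sg ε' * Y - m) α) :
    pairKernel G m α X' Y = (∏ δ : ℤˣ, S.s (X + sg δ * Y - sg η * (I * α / 2 - m)) /
      S.s (X + sg δ * Y - sg η * (I * α / 2 + m))) * pairKernel G m α X Y := by
  have hη := sg_mul_self η
  have key : ∀ δ : ℤˣ, G (sg η * X' + sg (η * δ) * Y - m) α *
      G (sg (-η) * X' + sg (-η * δ) * Y - m) α =
      -(S.s (X + sg δ * Y - sg η * (I * α / 2 - m)) / S.s (X + sg δ * Y - sg η * (I * α / 2 + m))) *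
      (G (sg η * X + sg (η * δ) * Y - m) α * G (sg (-η) * X + sg (-η * δ) * Y - m) α) := by
    intro δ
    have e1 : sg η * X' + sg (η * δ) * Y - m = sg η * X + sg (η * δ) * Y - m - I * α := by
      rw [hX]; linear_combination (-I * α) * hη
    have e2 : sg η * (X + sg δ * Y - sg η * (I * α / 2 + m)) =
        sg η * X + sg (η * δ) * Y - m - I * α / 2 := by
      rw [sg_mul]; linear_combination (-(I * α / 2 + m)) * hη
    have e3 : sg (-η) * X + sg (-η * δ) * Y - m =
        sg (-η) * X' + sg (-η * δ) * Y - m - I * α := by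
      rw [hX, sg_neg]; linear_combination (-I * α) * hη
    have e4 : sg (-η) * (X + sg δ * Y - sg η * (I * α / 2 - m)) =
        sg (-η) * X' + sg (-η * δ) * Y - m - I * α / 2 := by
      rw [hX, sg_mul, sg_neg]; linear_combination (- I * α / 2 - m) * hη
    have k1 := hc.eq (hr η (η * δ)) (hr' η (η * δ)) e1 e2
    have k2 := hc.eq (hr' (-η) (-η * δ)) (hr (-η) (-η * δ)) e3 e4
    have k3 := hc.s_ne_zero (hr η (η * δ)) (hr' η (η * δ)) e1 e2
    rw [s_sg_mul] at k1 k2 k3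
    have k4 := right_ne_zero_of_mul k3
    rw [k1, k2, sg_neg]
    generalize S.s (X + sg δ * Y - sg η * (I * α / 2 + m)) = t at *
    generalize S.s (X + sg δ * Y - sg η * (I * α / 2 - m)) = t' at *
    field_simp
  have h1 := key 1
  have h2 := key (-1)
  have hs : ∀ X : ℂ, pairKernel G m α X Y =
      (G (sg η * X + sg (η * 1) * Y - m) α * G (sg (-η) * X + sg (-η * 1) * Y - m) α) *
      (G (sg η * X + sg (η * -1) * Y - m) α * G (sg (-η) * X + sg (-η * -1) * Y - m) α) := by
    intro X
    rw [pairKernel]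
    rcases Int.units_eq_one_or η with rfl | rfl <;> simp only [prod_signs] <;> simp <;> ring
  rw [hs, hs, h1, h2, prod_signs]
  ring

lemma crossFactor_eq (p : Config N Nt) (q : Config M Mt) : crossFactor S G lam β p q =
    (∏ j, ∏ k, pairKernel G (I * lam * β / 2) β (p.1 j) (q.1 k)) *
    (∏ j, ∏ k, ∏ δ : ℤˣ, S.s (p.1 j + sg δ * q.2 k)) *
    (∏ j, ∏ k, ∏ δ : ℤˣ, S.s (p.2 j + sg δ * q.1 k)) *
    ∏ j, ∏ k, pairKernel G (I * β / 2) (lam * β) (p.2 j) (q.2 k) := rfl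

lemma prod_div_mul_eq {n : ℕ} {f h : Fin n → ℤˣ → ℂ} (hf : ∀ k δ, f k δ ≠ 0) :
    (∏ δ : ℤˣ, ∏ k, h k δ / f k δ) * ∏ k, ∏ δ : ℤˣ, f k δ = ∏ k, ∏ δ : ℤˣ, h k δ := by
  rw [prod_comm, ← prod_mul_distrib]
  refine prod_congr rfl fun k _ => ?_
  rw [← prod_mul_distrib]
  exact prod_congr rfl fun δ _ => div_mul_cancel₀ _ (hf k δ)

lemma crossFactor_shift {c ct : ℂ} (hc : GammaRelation S G β c)
    (hct : GammaRelation S G (lam * β) ct) (ε : ℤˣ) (J : Fin N ⊕ Fin Nt) {p : Config N Nt}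
    {q : Config M Mt} (h : CrossRegular S G lam β p q)
    (h' : CrossRegular S G lam β (shift lam β ε J p) q) :
    crossFactor S G lam β (shift lam β ε J p) q =
      crossRatio S lam β ε J p q * crossFactor S G lam β p q := by
  rw [crossFactor_eq, crossFactor_eq]
  rcases J with j | j
  · have a1 := shift_inl_self (lam := lam) (β := β) ε j p
    have a2 : ∀ i, i ≠ j → (shift lam β ε (.inl j) p).1 i = p.1 i :=
      fun i hi => shift_inl_of_ne _ hi _
    have hr : crossRatio S lam β ε (.inl j) p q =
        (∏ k, ∏ δ : ℤˣ, S.s (p.1 j + sg δ * q.1 k - sg ε * (I * β / 2 - I * lam * β / 2)) /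
          S.s (p.1 j + sg δ * q.1 k - sg ε * (I * β / 2 + I * lam * β / 2))) *
        ∏ δ : ℤˣ, ∏ k, S.s ((shift lam β ε (.inl j) p).1 j + sg δ * q.2 k) /
          S.s (p.1 j + sg δ * q.2 k) := by
      obtain ⟨x, xt⟩ := p
      obtain ⟨y, yt⟩ := q
      rw [a1, prod_comm (s := univ (α := Fin M))]
      simp only [crossRatio, prod_mul_distrib]
      congr 1
      · refine prod_congr rfl fun δ _ => prod_congr rfl fun k _ => ?_
        congr 2 <;> ring
      · refine prod_congr rfl fun δ _ => prod_congr rfl fun k _ => ?_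
        congr 2; ring
    have hk := prod_congr rfl fun k (_ : k ∈ univ) => pairKernel_shift hc a1
      (fun ε ε' => h.xy ε ε' j k) (fun ε ε' => h'.xy ε ε' j k)
    have hs := prod_div_mul_eq (f := fun k δ => S.s (p.1 j + sg δ * q.2 k))
      (h := fun k δ => S.s ((shift lam β ε (.inl j) p).1 j + sg δ * q.2 k)) fun k δ => h.xyt δ j k
    rw [prod_mul_distrib] at hk
    rw [prod_eq_mul_prod_erase_of_ne
        (fun z => ∏ k, pairKernel G (I * lam * β / 2) β z (q.1 k)) a2,
      prod_eq_mul_prod_erase_of_ne (fun z => ∏ k, ∏ δ : ℤˣ, S.s (z + sg δ * q.2 k)) a2,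
      ← mul_prod_erase univ (fun i => ∏ k, pairKernel G (I * lam * β / 2) β (p.1 i) (q.1 k))
        (mem_univ j),
      ← mul_prod_erase univ (fun i => ∏ k, ∏ δ : ℤˣ, S.s (p.1 i + sg δ * q.2 k)) (mem_univ j),
      hr, hk, ← hs, shift_inl_snd]
    ring
  · have a1 := shift_inr_self (lam := lam) (β := β) ε j p
    have a1' : (shift lam β ε (.inr j) p).2 j = p.2 j - sg (-ε) * I * (lam * β) := by
      rw [a1, sg_neg]; ring
    have a2 : ∀ i, i ≠ j → (shift lam β ε (.inr j) p).2 i = p.2 i :=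
      fun i hi => shift_inr_of_ne _ hi _
    have hr : crossRatio S lam β ε (.inr j) p q =
        (∏ k, ∏ δ : ℤˣ, S.s (p.2 j + sg δ * q.2 k - sg (-ε) * (I * (lam * β) / 2 - I * β / 2)) /
          S.s (p.2 j + sg δ * q.2 k - sg (-ε) * (I * (lam * β) / 2 + I * β / 2))) *
        ∏ δ : ℤˣ, ∏ k, S.s ((shift lam β ε (.inr j) p).2 j + sg δ * q.1 k) /
          S.s (p.2 j + sg δ * q.1 k) := by
      obtain ⟨x, xt⟩ := p
      obtain ⟨y, yt⟩ := q
      rw [a1, prod_comm (s := univ (α := Fin Mt)), sg_neg]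
      simp only [crossRatio, prod_mul_distrib]
      congr 1
      · refine prod_congr rfl fun δ _ => prod_congr rfl fun k _ => ?_
        congr 2 <;> ring
      · refine prod_congr rfl fun δ _ => prod_congr rfl fun k _ => ?_
        congr 2; ring
    have hk := prod_congr rfl fun k (_ : k ∈ univ) => pairKernel_shift hct a1'
      (fun ε ε' => h.xtyt ε ε' j k) (fun ε ε' => h'.xtyt ε ε' j k)
    have hs := prod_div_mul_eq (f := fun k δ => S.s (p.2 j + sg δ * q.1 k))
      (h := fun k δ => S.s ((shift lam β ε (.inr j) p).2 j + sg δ * q.1 k)) fun k δ => h.xty δ j k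
    rw [prod_mul_distrib] at hk
    rw [prod_eq_mul_prod_erase_of_ne
        (fun z => ∏ k, pairKernel G (I * β / 2) (lam * β) z (q.2 k)) a2,
      prod_eq_mul_prod_erase_of_ne (fun z => ∏ k, ∏ δ : ℤˣ, S.s (z + sg δ * q.1 k)) a2,
      ← mul_prod_erase univ (fun i => ∏ k, pairKernel G (I * β / 2) (lam * β) (p.2 i) (q.2 k))
        (mem_univ j),
      ← mul_prod_erase univ (fun i => ∏ k, ∏ δ : ℤˣ, S.s (p.2 i + sg δ * q.1 k)) (mem_univ j),
      hr, hk, ← hs, shift_inr_fst]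
    ring

lemma pairKernel_comm (m α X Y : ℂ) : pairKernel G m α X Y = pairKernel G m α Y X := by
  rw [pairKernel, pairKernel, prod_comm]
  simp only [add_comm (sg _ * X)]

lemma prod_s_comm (X Y : ℂ) :
    ∏ δ : ℤˣ, S.s (X + sg δ * Y) = -1 * ∏ δ : ℤˣ, S.s (Y + sg δ * X) := by
  rw [prod_signs, prod_signs, sg_one, sg_neg_one, show X + -1 * Y = -(Y + -1 * X) by ring, S.s_neg,
    show X + 1 * Y = Y + 1 * X by ring]
  ring

/-- Exchanging the two sides costs only a sign independent of the variables, from the odd function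
`s`. It cancels in quotients, so shifts in `(y, ỹ)` reduce to shifts in `(x, x̃)`. -/
lemma exists_crossFactor_comm (S : Setting) (G : ℂ → ℂ → ℂ) (N Nt M Mt : ℕ) (lam β : ℂ) :
    ∃ σ : ℂ, ∀ (p : Config N Nt) (q : Config M Mt),
    crossFactor S G lam β p q = σ * crossFactor S G lam β q p := by
  refine ⟨(∏ _k : Fin Mt, ∏ _j : Fin N, -1) * (∏ _k : Fin M, ∏ _j : Fin Nt, -1), fun p q => ?_⟩
  rw [crossFactor_eq, crossFactor_eq]
  simp only [pairKernel_comm _ _ (p.1 _), pairKernel_comm _ _ (p.2 _), prod_s_comm (p.1 _),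
    prod_s_comm (p.2 _), prod_mul_distrib]
  rw [prod_comm (s := univ (α := Fin N)), prod_comm (s := univ (α := Fin N)),
    prod_comm (s := univ (α := Fin N)), prod_comm (s := univ (α := Fin Nt)),
    prod_comm (s := univ (α := Fin Nt)), prod_comm (s := univ (α := Fin Nt))]
  ring

lemma s_add_sg_mul_ne_zero {X Y : ℂ} {δ : ℤˣ} (h : S.s (X + sg δ * Y) ≠ 0) :
    S.s (Y + sg δ * X) ≠ 0 := by
  have hδ := sg_mul_self δ
  rw [show Y + sg δ * X = sg δ * (X + sg δ * Y) by linear_combination (-Y) * hδ, s_sg_mul]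
  exact mul_ne_zero (left_ne_zero_of_mul_eq_one hδ) h

lemma CrossRegular.symm {p : Config N Nt} {q : Config M Mt} (h : CrossRegular S G lam β p q) :
    CrossRegular S G lam β q p where
  xy ε ε' j k := by rw [add_comm (sg ε * q.1 j)]; exact h.xy ε' ε k j
  xtyt ε ε' j k := by rw [add_comm (sg ε * q.2 j)]; exact h.xtyt ε' ε k j
  xyt δ j k := s_add_sg_mul_ne_zero (h.xty δ k j)
  xty δ j k := s_add_sg_mul_ne_zero (h.xyt δ k j)

lemma crossFactor_shift_right {c ct : ℂ} (hc : GammaRelation S G β c)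
    (hct : GammaRelation S G (lam * β) ct) (ε : ℤˣ) (J : Fin M ⊕ Fin Mt) {p : Config N Nt}
    {q : Config M Mt} (h : CrossRegular S G lam β p q)
    (h' : CrossRegular S G lam β p (shift lam β ε J q)) :
    crossFactor S G lam β p (shift lam β ε J q) =
      crossRatio S lam β ε J q p * crossFactor S G lam β p q := by
  obtain ⟨σ, hσ⟩ := exists_crossFactor_comm S G N Nt M Mt lam β
  rw [hσ, hσ, crossFactor_shift hc hct ε J h.symm h'.symm]
  ring

/-- A zero of `s` in a denominator would, by the difference equation, force `G` to vanish at one of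
two adjacent arguments that are both regular. -/
lemma CrossRegularNear.crossNonzero {c ct : ℂ} (hc : GammaRelation S G β c)
    (hct : GammaRelation S G (lam * β) ct) {p : Config N Nt} {q : Config M Mt}
    (h : CrossRegularNear S G lam β p q) : CrossNonzero S lam β p q where
  xy ε δ j k := by
    have r := h.1.xy (-ε) (-ε * δ) j k
    have r' := (h.2.1 (-ε) (.inl j)).xy (-ε) (-ε * δ) j k
    have := hc.s_ne_zero (z := sg (-ε) * (p.1 j + sg δ * q.1 k + sg ε * (I * (1 + lam) * β / 2)))
      r r' (by rw [shift_inl_self]; linear_combination (-I * β) * sg_mul_self (-ε))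
      (by rw [sg_mul, sg_neg]; linear_combination (-(I * (1 + lam) * β / 2)) * sg_mul_self ε)
    rw [s_sg_mul] at this
    exact right_ne_zero_of_mul this
  xyt := h.1.xyt
  xty := h.1.xty
  xtyt ε δ j k := by
    have r := h.1.xtyt (-ε) (-ε * δ) j k
    have r' := (h.2.1 ε (.inr j)).xtyt (-ε) (-ε * δ) j k
    have := hct.s_ne_zero (z := sg (-ε) * (p.2 j + sg δ * q.2 k + sg ε * (I * (1 + lam) * β / 2)))
      r r' (by rw [shift_inr_self, sg_neg]; linear_combination (-I * lam * β) * sg_mul_self ε)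
      (by rw [sg_mul, sg_neg]; linear_combination (-(I * (1 + lam) * β / 2)) * sg_mul_self ε)
    rw [s_sg_mul] at this
    exact right_ne_zero_of_mul this

end Cross

/-! ### Choice of the square roots and conjugation by the ground state -/

section Roots

variable {S : Setting} {G : ℂ → ℂ → ℂ} {N Nt : ℕ} {g : Fin (2 * S.rho + 2) → ℂ} {lam β : ℂ}

lemma shift_shift_neg (ε : ℤˣ) (J : Fin N ⊕ Fin Nt) (p : Config N Nt) :
    shift lam β ε J (shift lam β (-ε) J p) = p := by
  rcases J with j | j <;> simp only [shift, Function.update_self, Function.update_idem, sg_neg] <;>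
    ring_nf <;> simp

/-- The determination of the square roots of the coefficients which satisfies
`(V_J^-)^{1/2} Ψ = T⁻¹ (V_J^+)^{1/2} Ψ`. -/
def rootOf (lam β : ℂ) (Ψ : Config N Nt → ℂ) (v : Fin N ⊕ Fin Nt → Config N Nt → ℂ) (ε : ℤˣ)
    (J : Fin N ⊕ Fin Nt) (p : Config N Nt) : ℂ :=
  if ε = 1 then v J p else v J (shift lam β (-1) J p) * Ψ (shift lam β (-1) J p) / Ψ p

variable {D : Set (Config N Nt)} {Ψ : Config N Nt → ℂ} {v : Fin N ⊕ Fin Nt → Config N Nt → ℂ}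

lemma rootOf_one : rootOf lam β Ψ v 1 = v := by
  ext J p
  simp [rootOf]

lemma rootOf_neg_one (J : Fin N ⊕ Fin Nt) (p : Config N Nt) : rootOf lam β Ψ v (-1) J p =
    v J (shift lam β (-1) J p) * Ψ (shift lam β (-1) J p) / Ψ p := by
  simp [rootOf]

lemma IsDeformedGroundState.ne_zero (hD : IsAdmissible S G g lam β D)
    (hΨ : IsDeformedGroundState S G g lam β D Ψ) {p : Config N Nt} (hp : p ∈ D) : Ψ p ≠ 0 := by
  have := deformedGroundSq_ne_zero (hD p hp).1
  rw [← hΨ p hp] at this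
  exact fun h => this (by rw [h]; ring)

lemma isCoeffRoot_rootOf {c ct : ℂ} (hlam : lam ≠ 0) (hc : GammaRelation S G β c)
    (hct : GammaRelation S G (lam * β) ct) (hD : IsAdmissible S G g lam β D)
    (hΨ : IsDeformedGroundState S G g lam β D Ψ)
    (hv : ∀ J, ∀ p ∈ D, v J p ^ 2 = coeff S g lam β 1 J p) :
    IsCoeffRoot S g lam β D (rootOf lam β Ψ v) := by
  intro ε J p hp
  rcases Int.units_eq_one_or ε with rfl | rfl
  · rw [rootOf_one, hv J p hp]
  · have hp' := (hD p hp).2 (-1) J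
    have := deformedGroundSq_shift hlam hc hct J (p := shift lam β (-1) J p) (p' := p)
      (shift_shift_neg 1 J p).symm (hD _ hp').1 (hD p hp).1
    rw [rootOf_neg_one, div_pow, mul_pow, hv J _ hp', hΨ p hp, hΨ _ hp',
      div_eq_iff (deformedGroundSq_ne_zero (hD p hp).1)]
    linear_combination -this

lemma differentiable_shift (ε : ℤˣ) (J : Fin N ⊕ Fin Nt) :
    Differentiable ℂ (shift (N := N) (Nt := Nt) lam β ε J) := by
  rcases J with j | j
  · refine Differentiable.prodMk (differentiable_pi.2 fun i => ?_) differentiable_snd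
    by_cases h : i = j
    · subst h
      simp only [Function.update_self]
      fun_prop
    · simp only [Function.update_of_ne h]
      fun_prop
  · refine Differentiable.prodMk differentiable_fst (differentiable_pi.2 fun i => ?_)
    by_cases h : i = j
    · subst h
      simp only [Function.update_self]
      fun_prop
    · simp only [Function.update_of_ne h]
      fun_prop

lemma differentiableOn_rootOf (hD : IsAdmissible S G g lam β D)
    (hΨ : IsDeformedGroundState S G g lam β D Ψ) (hΨd : DifferentiableOn ℂ Ψ D)
    (J : Fin N ⊕ Fin Nt) (hvd : DifferentiableOn ℂ (v J) D) :
    DifferentiableOn ℂ (rootOf lam β Ψ v (-1) J) D := by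
  have hm : Set.MapsTo (shift lam β (-1) J) D D := fun p hp => (hD p hp).2 (-1) J
  have hs := (differentiable_shift (lam := lam) (β := β) (-1) J).differentiableOn (s := D)
  refine (((hvd.comp hs hm).mul (hΨd.comp hs hm)).mul
    (hΨd.inv fun p hp => hΨ.ne_zero hD hp)).congr fun p _ => ?_
  rw [rootOf_neg_one, div_eq_mul_inv]
  rfl

/-- For `ε = 1` the backward translation in the definition of the root is undone by the shift,
leaving a square. For `ε = -1` the value at the shifted point recombines with `Ψ` into the root at
`p`, and its square is the coefficient by detailed balance. -/
lemma rootOf_mul {c ct : ℂ} (hlam : lam ≠ 0) (hc : GammaRelation S G β c)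
    (hct : GammaRelation S G (lam * β) ct) (hD : IsAdmissible S G g lam β D)
    (hΨ : IsDeformedGroundState S G g lam β D Ψ)
    (hv : ∀ J, ∀ p ∈ D, v J p ^ 2 = coeff S g lam β 1 J p) (ε : ℤˣ) (J : Fin N ⊕ Fin Nt)
    {p : Config N Nt} (hp : p ∈ D) :
    rootOf lam β Ψ v ε J p * (rootOf lam β Ψ v (-ε) J (shift lam β ε J p) *
      Ψ (shift lam β ε J p)) = coeff S g lam β ε J p * Ψ p := by
  have hp' := (hD p hp).2 ε J
  have h0 := hΨ.ne_zero hD hp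
  have h1 := hΨ.ne_zero hD hp'
  rcases Int.units_eq_one_or ε with rfl | rfl
  · have := shift_shift_neg (lam := lam) (β := β) (-1) J p
    rw [neg_neg] at this
    rw [rootOf_neg_one, this, rootOf_one, div_mul_cancel₀ _ h1, ← hv J p hp]
    ring
  · have := isCoeffRoot_rootOf hlam hc hct hD hΨ hv (-1) J p hp
    rw [← this, neg_neg, rootOf_one, rootOf_neg_one]
    field_simp

lemma deformedOperator_rootOf {c ct : ℂ} (hlam : lam ≠ 0) (hc : GammaRelation S G β c)
    (hct : GammaRelation S G (lam * β) ct) (hD : IsAdmissible S G g lam β D)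
    (hΨ : IsDeformedGroundState S G g lam β D Ψ)
    (hv : ∀ J, ∀ p ∈ D, v J p ^ 2 = coeff S g lam β 1 J p) {p : Config N Nt} (hp : p ∈ D)
    {R : Config N Nt → ℂ} {ρ : ℤˣ → Fin N ⊕ Fin Nt → ℂ}
    (hR : ∀ ε J, R (shift lam β ε J p) = ρ ε J * R p) :
    deformedOperator S g lam β (rootOf lam β Ψ v) (fun p' => Ψ p' * R p') p =
      ((∑ ε : ℤˣ,
        (S.s (I * lam * β) * ∑ j, coeff S g lam β ε (.inl j) p * ρ ε (.inl j) -
          S.s (I * β) * ∑ k, coeff S g lam β ε (.inr k) p * ρ ε (.inr k))) +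
      potential S g lam β p) * (Ψ p * R p) := by
  have key : ∀ ε J, rootOf lam β Ψ v ε J p * (rootOf lam β Ψ v (-ε) J (shift lam β ε J p) *
      (Ψ (shift lam β ε J p) * R (shift lam β ε J p))) =
      coeff S g lam β ε J p * ρ ε J * (Ψ p * R p) := fun ε J => by
    rw [hR]
    linear_combination (ρ ε J * R p) * rootOf_mul hlam hc hct hD hΨ hv ε J hp
  simp only [deformedOperator, key, ← sum_mul]
  rw [add_mul, sum_mul]
  congr 1
  exact sum_congr rfl fun ε _ => by ring

end Roots

end

end KvD

/-! ### The kernel function identity -/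

theorem mainTheorem2 (S : Setting) (G : ℂ → ℂ → ℂ) (hG : IsGammaFunction S G)
    (β : ℝ) (hβ : 0 < β) (lam : ℂ) (hlam : lam.re ≠ 0)
    (hper : ∀ n : ℤ, n ≠ 0 → S.s (n * (I * β)) ≠ 0 ∧ S.s (n * (I * lam * β)) ≠ 0)
    (hpot : ∀ ν ≤ S.rho, ∀ μ ≤ S.rho,
      S.s ((S.omega ν - S.omega μ + I * (1 - lam) * β) / 2) ≠ 0)
    (N Nt M Mt : ℕ) (g : Fin (2 * S.rho + 2) → ℂ)
    (hbal : S.kind = Kind.elliptic →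
      2 * lam * ((N : ℂ) - M - 1) - 2 * ((Nt : ℂ) - Mt + 1) + ∑ ν, g ν = 0)
    (D : Set (Config N Nt)) (hD : IsAdmissible S G g lam β D)
    (E : Set (Config M Mt)) (hE : IsAdmissible S G (gTilde S lam g) lam β E)
    (Ψ : Config N Nt → ℂ) (hΨ : IsDeformedGroundState S G g lam β D Ψ)
    (Θ : Config M Mt → ℂ) (hΘ : IsDeformedGroundState S G (gTilde S lam g) lam β E Θ)
    (v : Fin N ⊕ Fin Nt → Config N Nt → ℂ)
    (hv : ∀ J, ∀ p ∈ D, v J p ^ 2 = coeff S g lam β 1 J p)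
    (u : Fin M ⊕ Fin Mt → Config M Mt → ℂ)
    (hu : ∀ J, ∀ q ∈ E, u J q ^ 2 = coeff S (gTilde S lam g) lam β 1 J q) :
    ∃ (V : ℤˣ → Fin N ⊕ Fin Nt → Config N Nt → ℂ) (U : ℤˣ → Fin M ⊕ Fin Mt → Config M Mt → ℂ),
      IsCoeffRoot S g lam β D V ∧ V 1 = v ∧
      IsCoeffRoot S (gTilde S lam g) lam β E U ∧ U 1 = u ∧
      (DifferentiableOn ℂ Ψ D → ∀ J, DifferentiableOn ℂ (v J) D →
        DifferentiableOn ℂ (V (-1) J) D) ∧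
      (DifferentiableOn ℂ Θ E → ∀ J, DifferentiableOn ℂ (u J) E →
        DifferentiableOn ℂ (U (-1) J) E) ∧
      ∀ p ∈ D, ∀ q ∈ E, CrossRegularNear S G lam β p q →
        deformedOperator S g lam β V (fun p' => kernelFunction S G lam β Ψ Θ p' q) p -
            deformedOperator S (gTilde S lam g) lam β U
              (fun q' => kernelFunction S G lam β Ψ Θ p q') q -
            kernelConst S lam β g N Nt M Mt * kernelFunction S G lam β Ψ Θ p q = 0 := by
  have hβ' : ((β : ℂ)).re ≠ 0 := by rw [ofReal_re]; exact hβ.ne'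
  have hlamβ : (lam * β).re ≠ 0 := by
    rw [re_mul_ofReal]; exact mul_ne_zero hlam hβ.ne'
  have hlam0 : lam ≠ 0 := fun h => hlam (by rw [h, zero_re])
  obtain ⟨c, hc⟩ := hG.exists_gammaRelation hβ'
  obtain ⟨ct, hct⟩ := hG.exists_gammaRelation hlamβ
  refine ⟨rootOf lam β Ψ v, rootOf lam β Θ u, isCoeffRoot_rootOf hlam0 hc hct hD hΨ hv, rootOf_one,
    isCoeffRoot_rootOf hlam0 hc hct hE hΘ hu, rootOf_one,
    fun hd J hJ => differentiableOn_rootOf hD hΨ hd J hJ,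
    fun hd J hJ => differentiableOn_rootOf hE hΘ hd J hJ, fun p hp q hq hpq => ?_⟩
  have hid := functional_identity S lam β g G p q (hD p hp).1 (hE q hq).1
    (hpq.crossNonzero hc hct) hpot hbal
  -- With `q` frozen, `Θ q` is a constant, and the cross factor is multiplied by its ratio under
  -- each shift. The analogous step for `q` then reduces the claim to `hid` times the kernel
  -- function.
  have h1 := deformedOperator_rootOf hlam0 hc hct hD hΨ hv hp
    (R := fun p' => Θ q * crossFactor S G lam β p' q)
    (ρ := fun ε J => crossRatio S lam β ε J p q) fun ε J => by
      simp only [crossFactor_shift hc hct ε J hpq.1 (hpq.2.1 ε J)]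
      ring
  have h2 := deformedOperator_rootOf hlam0 hc hct hE hΘ hu hq
    (R := fun q' => Ψ p * crossFactor S G lam β p q')
    (ρ := fun ε J => crossRatio S lam β ε J q p) fun ε J => by
      simp only [crossFactor_shift_right hc hct ε J hpq.1 (hpq.2.2 ε J)]
      ring
  have e1 : (fun p' => kernelFunction S G lam β Ψ Θ p' q) =
      fun p' => Ψ p' * (Θ q * crossFactor S G lam β p' q) := by
    funext p'; rw [kernelFunction, mul_assoc]
  have e2 : (fun q' => kernelFunction S G lam β Ψ Θ p q') =
      fun q' => Θ q' * (Ψ p * crossFactor S G lam β p q') := by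
    funext q'; rw [kernelFunction]; ring
  rw [e1, e2, h1, h2, kernelFunction]
  linear_combination (Ψ p * Θ q * crossFactor S G lam β p q) * hid
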